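/- Let $d\ge 4$ be an integer, $p\ge 3$ an odd integer, $T>0$, $k=d-1$, $\ell=1+\frac4{p-1}$, and let $\beta>1$ satisfy $k>\beta(\ell+\sqrt\ell)$. Write $Z=|x|/(T-t)$ and $\tau=-\ln(T-t)$ for $(t,x)\in[0,T)\times\mathbb R^d$. Let $\partial_0=-\partial^0=\partial_t$, $\partial_j=\partial^j=\partial_{x_j}$ for $1\le j\le d$, let repeated Greek indices be summed over $0,\dots,d$, and let $\Box=\partial^\alpha\partial_\alpha=-\partial_t^2+\Delta$. Function spaces. $C^\infty_{\rm e}$ (resp. $C^\infty_{\rm o}$) is the set of $f\in C^\infty([0,\infty))$ such that $f(Z)=\tilde f(Z^2)$ (resp. $f(Z)=Z\tilde f(Z^2)$) for some $\tilde f\in C^\infty([0,\infty))$. $\mathscr X_0$ is the set of functions on $[0,T)\times\mathbb R^d$ of the form $\sum_{j=0}^m f_j(Z)\tau^j$ with $m\ge 0$ and complex-valued $f_j\in C^\infty_{\rm e}$, and $\mathscr X_\lambda=(T-t)^\lambda\mathscr X_0$ for $\lambda\in\mathbb C$. Leading-order profile. Assume that $v\in C^\infty_{\rm o}$ takes values in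 $(-1,1)$, satisfies $v(0)=0$, and solves on $[0,\infty)$ the ODE $$Z\big[(1-Zv)^2-\ell(v-Z)^2\big]\frac{dv}{dZ}=(1-v^2)\big[\beta\ell(1-v^2)Z-kv(1-Zv)\big].$$ Define $$\hat\phi_0(Z)=\frac1{\beta-1}\exp\Big((\beta-1)\int_0^Z\frac{v(s)}{1-sv(s)}\,ds\Big),\qquad \hat\rho_0(Z)=\frac{(\beta-1)^{\frac2{p-1}}\hat\phi_0(Z)^{\frac2{p-1}}(1-v(Z)^2)^{\frac1{p-1}}}{(1-Zv(Z))^{\frac2{p-1}}},$$ $$\phi_0(t,x)=(T-t)^{1-\beta}\hat\phi_0(Z),\qquad \rho_0(t,x)=(T-t)^{-\frac{2\beta}{p-1}}\hat\rho_0(Z).$$ Let $\lambda_n=(2n-1)(\beta-1)$ and $\mu_n=2n(\beta-1)-\frac{2\beta}{p-1}$ for $n\ge 0$. Proposition. We have $\phi_0\in\mathscr X_{\lambda_0}$ and $\rho_0\in\mathscr X_{\mu_0}$, and for every $n\ge 1$ there are real-valued $\phi_n\in\mathscr X_{\lambda_n}$ and $\rho_n\in\mathscr X_{\mu_n}$ such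 that the sequences $(\phi_n)_{n\ge 0}$, $(\rho_n)_{n\ge 0}$ satisfy, for every $n\ge 1$, on $[0,T)\times\mathbb R^d$, $$(p-1)\rho_0^{p-1}\rho_n+2\rho_0\,\partial^\alpha\phi_0\partial_\alpha\phi_n=F_n,\qquad \partial^\alpha(\rho_0^2\partial_\alpha\phi_n)+2\partial^\alpha(\rho_0\,\partial_\alpha\phi_0\,\rho_n)=\rho_0G_n,$$ where $$F_n=\Box\rho_{n-1}-\sum_{\substack{n_1+\cdots+n_p=n\\ n_i\le n-1}}\rho_{n_1}\cdots\rho_{n_p}-\sum_{\substack{n_1+n_2+n_3=n\\ n_i\le n-1}}\rho_{n_1}\partial^\alpha\phi_{n_2}\partial_\alpha\phi_{n_3},$$ $$G_n=-2\sum_{\substack{n_1+n_2=n\\ n_i\le n-1}}\partial^\alpha\rho_{n_1}\partial_\alpha\phi_{n_2}-\sum_{\substack{n_1+n_2=n\\ n_i\le n-1}}\rho_{n_1}\Box\phi_{n_2}$$ (all indices $n_i$ being nonnegative integers). Hence, for every $n\ge 0$, with the convention $\rho_{-1}=0$, $$\Box\rho_{n-1}=\sum_{n_1+\cdots+n_p=n}\rho_{n_1}\cdots\rho_{n_p}+\sum_{n_1+n_2+n_3=n}\rho_{n_1}\partial^\alpha\phi_{n_2}\partial_\alpha\phi_{n_3},\qquad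 0=2\sum_{n_1+n_2=n}\partial^\alpha\rho_{n_1}\partial_\alpha\phi_{n_2}+\sum_{n_1+n_2=n}\rho_{n_1}\Box\phi_{n_2}.$$ -/

import Mathlib

open scoped ContDiff

noncomputable section

namespace WaveBlowup

/-- Spacetime functions `f (t, x)`, with `t` real and `x` in Euclidean `d`-space. -/
abbrev STFun (d : ℕ) (𝕜 : Type) : Type := ℝ → EuclideanSpace ℝ (Fin d) → 𝕜

/-! ### Smooth even and odd functions on the closed half-line -/

/-- `f` is smooth on `[0, ∞)` (up to the endpoint) and `f Z = g (Z ^ 2)` with `g` smooth on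
`[0, ∞)`. -/
def SmoothEven {E : Type*} [NormedAddCommGroup E] [NormedSpace ℝ E] (f : ℝ → E) : Prop :=
  ContDiffOn ℝ ∞ f (Set.Ici 0) ∧
    ∃ g : ℝ → E, ContDiffOn ℝ ∞ g (Set.Ici 0) ∧ ∀ Z : ℝ, 0 ≤ Z → f Z = g (Z ^ 2)

/-- `f` is smooth on `[0, ∞)` (up to the endpoint) and `f Z = Z g (Z ^ 2)` with `g` smooth on
`[0, ∞)`. -/
def SmoothOdd {E : Type*} [NormedAddCommGroup E] [NormedSpace ℝ E] (f : ℝ → E) : Prop :=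
  ContDiffOn ℝ ∞ f (Set.Ici 0) ∧
    ∃ g : ℝ → E, ContDiffOn ℝ ∞ g (Set.Ici 0) ∧ ∀ Z : ℝ, 0 ≤ Z → f Z = Z • g (Z ^ 2)

/-! ### The profile equation -/

/-- The parameter `ℓ = 1 + 4 / (p - 1)`. -/
def ell (p : ℕ) : ℝ := 1 + 4 / ((p : ℝ) - 1)

/-- `Δ_Z (Z, v) = Z [(1 - Z v)² - ℓ (v - Z)²]`. -/
def DeltaZ (p : ℕ) (Z v : ℝ) : ℝ :=
  Z * ((1 - Z * v) ^ 2 - ell p * (v - Z) ^ 2)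

/-- `Δ_v (Z, v) = (1 - v²) [β ℓ (1 - v²) Z - k v (1 - Z v)]` with `k = d - 1`. -/
def DeltaV (d p : ℕ) (β Z v : ℝ) : ℝ :=
  (1 - v ^ 2) * (β * ell p * (1 - v ^ 2) * Z - ((d : ℝ) - 1) * v * (1 - Z * v))

/-- `v` is a smooth odd global solution on `[0, ∞)`, with values in `(-1, 1)` and `v 0 = 0`, of
`Δ_Z (Z, v) dv/dZ = Δ_v (Z, v)`. -/
structure IsProfile (d p : ℕ) (β : ℝ) (v : ℝ → ℝ) : Prop where
  odd : SmoothOdd v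
  mem_Ioo : ∀ Z : ℝ, 0 ≤ Z → v Z ∈ Set.Ioo (-1 : ℝ) 1
  zero : v 0 = 0
  ode : ∀ Z : ℝ, 0 ≤ Z →
    DeltaZ p Z (v Z) * derivWithin v (Set.Ici 0) Z = DeltaV d p β Z (v Z)

/-! ### The leading-order self-similar solution -/

/-- The profile of the leading-order phase. -/
def phiHat (β : ℝ) (v : ℝ → ℝ) (Z : ℝ) : ℝ :=
  1 / (β - 1) * Real.exp ((β - 1) * ∫ s in (0 : ℝ)..Z, v s / (1 - s * v s))

/-- The profile of the leading-order modulus. -/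
def rhoHat (p : ℕ) (β : ℝ) (v : ℝ → ℝ) (Z : ℝ) : ℝ :=
  (β - 1) ^ (2 / ((p : ℝ) - 1)) * phiHat β v Z ^ (2 / ((p : ℝ) - 1)) *
      (1 - v Z ^ 2) ^ (1 / ((p : ℝ) - 1)) /
    (1 - Z * v Z) ^ (2 / ((p : ℝ) - 1))

/-- `φ₀ (t, x) = (T - t)^(1 - β) phiHat (|x| / (T - t))`. -/
def phiZero (d : ℕ) (T β : ℝ) (v : ℝ → ℝ) : STFun d ℝ := fun t x =>
  (T - t) ^ (1 - β) * phiHat β v (‖x‖ / (T - t))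

/-- `ρ₀ (t, x) = (T - t)^(-2 β / (p - 1)) rhoHat (|x| / (T - t))`. -/
def rhoZero (d p : ℕ) (T β : ℝ) (v : ℝ → ℝ) : STFun d ℝ := fun t x =>
  (T - t) ^ (-(2 * β / ((p : ℝ) - 1))) * rhoHat p β v (‖x‖ / (T - t))

/-! ### Differential operators on `[0, T) × ℝ^d` with the Minkowski metric -/

/-- The diagonal entries `(-1, 1, …, 1)` of the Minkowski metric. -/
def mink {d : ℕ} (α : Fin (d + 1)) : ℝ := if α = 0 then -1 else 1

/-- The coordinate derivative `∂_α f`: `α = 0` is the time derivative on `[0, T)` (one-sided at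
`t = 0`), and `α = j + 1` is the derivative in the `j`-th space coordinate. -/
def pd {d : ℕ} (T : ℝ) (α : Fin (d + 1)) (f : STFun d ℝ) : STFun d ℝ := fun t x =>
  Fin.cases (motive := fun _ => ℝ)
    (derivWithin (fun s => f s x) (Set.Ico 0 T) t)
    (fun j => fderiv ℝ (f t) x (EuclideanSpace.single j 1)) α

/-- `∂^α V_α`, summed over `α`. -/
def div {d : ℕ} (T : ℝ) (V : Fin (d + 1) → STFun d ℝ) : STFun d ℝ := fun t x =>
  ∑ α, mink α * pd T α (V α) t x

/-- The d'Alembertian `□ f = ∂^α ∂_α f`. -/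
def box {d : ℕ} (T : ℝ) (f : STFun d ℝ) : STFun d ℝ := div T fun α => pd T α f

/-- `∂^α f ∂_α g`, summed over `α`. -/
def mform {d : ℕ} (T : ℝ) (f g : STFun d ℝ) : STFun d ℝ := fun t x =>
  ∑ α, mink α * pd T α f t x * pd T α g t x

/-! ### The function spaces -/

/-- The space `𝓧₀` of functions on `[0, T) × ℝ^d` which are polynomials in `τ = - log (T - t)`
whose coefficients are smooth even (complex-valued) functions of `Z = |x| / (T - t)`. -/
def XZero (d : ℕ) (T : ℝ) : Set (STFun d ℂ) :=
  {f | ∃ (n : ℕ) (c : ℕ → ℝ → ℂ), (∀ j ≤ n, SmoothEven (c j)) ∧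
    ∀ t ∈ Set.Ico 0 T, ∀ x, f t x =
      ∑ j ∈ Finset.range (n + 1),
        c j (‖x‖ / (T - t)) * ((-Real.log (T - t) : ℝ) : ℂ) ^ j}

/-- The space `𝓧_lam = (T - t)^lam 𝓧₀`, for complex `lam`. -/
def X (d : ℕ) (T : ℝ) (lam : ℂ) : Set (STFun d ℂ) :=
  {f | ∃ g ∈ XZero d T, ∀ t ∈ Set.Ico 0 T, ∀ x, f t x = ((T - t : ℝ) : ℂ) ^ lam * g t x}

/-- `λ_n = (2 n - 1) (β - 1)`. -/
def lamSeq (β : ℝ) (n : ℕ) : ℝ := (2 * n - 1) * (β - 1)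

/-- `μ_n = 2 n (β - 1) - 2 β / (p - 1)`. -/
def muSeq (p : ℕ) (β : ℝ) (n : ℕ) : ℝ := 2 * n * (β - 1) - 2 * β / ((p : ℝ) - 1)

/-! ### The recurrence relations -/

section Recurrence

variable {d : ℕ}

/-- `□ ρ_{n-1}`, with `ρ_{-1} = 0`. -/
def boxPrev (T : ℝ) (ρ : ℕ → STFun d ℝ) (n : ℕ) : STFun d ℝ := fun t x =>
  if n = 0 then 0 else box T (ρ (n - 1)) t x

/-- The source term `F_n`, in which only terms of index smaller than `n` occur. -/
def sourceF (p : ℕ) (T : ℝ) (ρ φ : ℕ → STFun d ℝ) (n : ℕ) : STFun d ℝ := fun t x =>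
  boxPrev T ρ n t x
    - ∑ ν ∈ (Finset.Nat.antidiagonalTuple p n).filter (fun ν => ∀ i, ν i < n),
        ∏ i, ρ (ν i) t x
    - ∑ ν ∈ (Finset.Nat.antidiagonalTuple 3 n).filter (fun ν => ∀ i, ν i < n),
        ρ (ν 0) t x * mform T (φ (ν 1)) (φ (ν 2)) t x

/-- The source term `G_n`, in which only terms of index smaller than `n` occur. -/
def sourceG (T : ℝ) (ρ φ : ℕ → STFun d ℝ) (n : ℕ) : STFun d ℝ := fun t x =>
  -2 * ∑ ν ∈ (Finset.HasAntidiagonal.antidiagonal n).filter (fun ν => ν.1 < n ∧ ν.2 < n),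
        mform T (ρ ν.1) (φ ν.2) t x
    - ∑ ν ∈ (Finset.HasAntidiagonal.antidiagonal n).filter (fun ν => ν.1 < n ∧ ν.2 < n),
        ρ ν.1 t x * box T (φ ν.2) t x

/-- The linearized equations of order `n` on `[0, T) × ℝ^d`:
`(p - 1) ρ₀^(p-1) ρ_n + 2 ρ₀ ∂^α φ₀ ∂_α φ_n = F_n` and
`∂^α (ρ₀² ∂_α φ_n) + 2 ∂^α (ρ₀ ∂_α φ₀ ρ_n) = ρ₀ G_n`. -/
def LinearizedEqs (p : ℕ) (T : ℝ) (ρ φ : ℕ → STFun d ℝ) (n : ℕ) : Prop :=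
  ∀ t ∈ Set.Ico 0 T, ∀ x : EuclideanSpace ℝ (Fin d),
    ((p : ℝ) - 1) * ρ 0 t x ^ (p - 1) * ρ n t x
        + 2 * ρ 0 t x * mform T (φ 0) (φ n) t x = sourceF p T ρ φ n t x ∧
    div T (fun α t x => ρ 0 t x ^ 2 * pd T α (φ n) t x) t x
        + 2 * div T (fun α t x => ρ 0 t x * pd T α (φ 0) t x * ρ n t x) t x
      = ρ 0 t x * sourceG T ρ φ n t x

/-- The recurrence relations of order `n` on `[0, T) × ℝ^d`: the coefficients of `b^n` in
`b □ρ = ρ^p + ρ ∂^α φ ∂_α φ` and `2 ∂^α ρ ∂_α φ + ρ □φ = 0`, for `ρ = ∑ ρ_n b^n` and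
`φ = ∑ φ_n b^n`. -/
def RecurrenceRelation (p : ℕ) (T : ℝ) (ρ φ : ℕ → STFun d ℝ) (n : ℕ) : Prop :=
  ∀ t ∈ Set.Ico 0 T, ∀ x : EuclideanSpace ℝ (Fin d),
    boxPrev T ρ n t x =
        ∑ ν ∈ Finset.Nat.antidiagonalTuple p n, ∏ i, ρ (ν i) t x
        + ∑ ν ∈ Finset.Nat.antidiagonalTuple 3 n,
            ρ (ν 0) t x * mform T (φ (ν 1)) (φ (ν 2)) t x ∧
    0 = 2 * ∑ ν ∈ Finset.HasAntidiagonal.antidiagonal n, mform T (ρ ν.1) (φ ν.2) t x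
        + ∑ ν ∈ Finset.HasAntidiagonal.antidiagonal n, ρ ν.1 t x * box T (φ ν.2) t x

end Recurrence

end WaveBlowup

end

/-! Put `y = Z²` and look for `φ_n = (T-t)^λ g(y, τ)`. The first linearized equation is algebraic in
`ρ_n`, with nonvanishing coefficient `(p-1) ρ_0^(p-1)`. Eliminating `ρ_n` from the second leaves one
linear equation for `g`, in which `τ` enters only through `Λ = λ - ∂_τ`: `y a g_yy + (b₀ + Λ b₁) g_y
+ (Λ c₁ - Λ² C) g = h`, with `C > 0`. The coefficient `a` vanishes at exactly one point `y₁ > 0`,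
the sonic point, and the zero is simple (`exists_sonic_point`; the lower bound on `k` serves here).
So there are two singular points, `0` and `y₁`, and `g` has to be smooth through both.

First let `Λ = λ + ε` with a number `ε`. Near a singular point, with local variable `x`, write `u`
as a polynomial of degree `m` plus a remainder given by `u' = ... + x^m w`. The inverse of `x d/dx +
m` is a weighted average along rays, of norm at most `1/m`; for large `m` the equation of `w` is
therefore a small perturbation of the identity. Each singular point leaves `m` equations for `m + 1`
coefficients, and the two missing equations are the matching of `u` and `u'` at the midpoint. The
Schur complement of the remainders is then a square matrix analytic in `ε`. If it is injective at
one real `ε₀`, its determinant is not identically zero, and the system can be inverted at `ε = 0` up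
to a factor `ε^N` (`exists_chain_of_injective`). Injectivity holds when `Λ` is very negative: the
zeroth order coefficient is negative, the first order coefficient has the favourable sign at both
singular points, and the maximum principle applies (`IsJet.eq_zero`). Smoothness of the solutions is
a bootstrap on the averages (`JetEq.smooth`), and beyond `y₁` the equation is regular
(`TwoPointPencil.exists_chain`).

The result is a power series `∑ ε^n u_n` sent to `ε^N h` by the operator. Replacing `ε` by `-∂_τ`,
that is, forming `∑ u_(K-j) (-τ)^j / j!`, solves the equation for polynomials in `τ`
(`exists_op_eq`). No `λ` has to be excluded: a resonance only costs `N` additional powers of `τ`.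

The corrections follow by recursion on `n`, the powers of `T - t` being consistent
(`exists_linear_solution`, `exists_hierarchy`). The recurrence relations are the linearized
equations with the top order terms reinserted; the two equations of order zero, `∂^α φ₀ ∂_α φ₀ =
-ρ₀^(p-1)` and the continuity equation, make both forms agree. -/

noncomputable section

namespace WaveBlowup

open Set MeasureTheory Filter Topology

/-! ### Weighted averages along rays -/

/-- The weighted average `∫₀¹ s^(κ - 1) f (s x) ds`. -/
def rayAvg (κ : ℝ) (f : ℝ → ℝ) (x : ℝ) : ℝ := ∫ s in (0 : ℝ)..1, s ^ (κ - 1) * f (s * x)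

lemma continuous_rayAvg_integrand {κ : ℝ} (hκ : 1 ≤ κ) {f : ℝ → ℝ} (hf : Continuous f) :
    Continuous (fun q : ℝ × ℝ => q.2 ^ (κ - 1) * f (q.2 * q.1)) := by
  have h : Continuous (fun s : ℝ => s ^ (κ - 1)) := Real.continuous_rpow_const (by linarith)
  exact (h.comp continuous_snd).mul (hf.comp (continuous_snd.mul continuous_fst))

lemma intervalIntegrable_rayAvg {κ : ℝ} (hκ : 1 ≤ κ) {f : ℝ → ℝ} (hf : Continuous f) (x : ℝ) :
    IntervalIntegrable (fun s : ℝ => s ^ (κ - 1) * f (s * x)) volume 0 1 :=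
  ((continuous_rayAvg_integrand hκ hf).comp (Continuous.prodMk_right x)).intervalIntegrable _ _

lemma continuous_rayAvg {κ : ℝ} (hκ : 1 ≤ κ) {f : ℝ → ℝ} (hf : Continuous f) :
    Continuous (rayAvg κ f) :=
  intervalIntegral.continuous_parametric_intervalIntegral_of_continuous'
    (f := fun x s => s ^ (κ - 1) * f (s * x)) (continuous_rayAvg_integrand hκ hf) 0 1

lemma rayAvg_congr {κ : ℝ} {f g : ℝ → ℝ} {x : ℝ}
    (h : ∀ s ∈ Icc (0 : ℝ) 1, f (s * x) = g (s * x)) : rayAvg κ f x = rayAvg κ g x := by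
  refine intervalIntegral.integral_congr fun s hs => ?_
  rw [uIcc_of_le zero_le_one] at hs
  simp only [h s hs]

lemma integral_rpow_sub_one {κ : ℝ} (hκ : 1 ≤ κ) :
    ∫ s in (0 : ℝ)..1, s ^ (κ - 1) = 1 / κ := by
  rw [integral_rpow (Or.inl (by linarith))]
  have : κ ≠ 0 := by linarith
  simp [Real.zero_rpow this]

lemma abs_rayAvg_le {κ : ℝ} (hκ : 1 ≤ κ) {f : ℝ → ℝ} {x C : ℝ}
    (h : ∀ s ∈ Icc (0 : ℝ) 1, |f (s * x)| ≤ C) : |rayAvg κ f x| ≤ C / κ := by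
  have h1 : ‖∫ s in (0 : ℝ)..1, s ^ (κ - 1) * f (s * x)‖ ≤ ∫ s in (0 : ℝ)..1, s ^ (κ - 1) * C := by
    refine intervalIntegral.norm_integral_le_of_norm_le zero_le_one ?_ ?_
    · refine Eventually.of_forall fun s hs => ?_
      rw [norm_mul, Real.norm_of_nonneg (Real.rpow_nonneg hs.1.le _)]
      exact mul_le_mul_of_nonneg_left (h s ⟨hs.1.le, hs.2⟩) (Real.rpow_nonneg hs.1.le _)
    · exact ((Real.continuous_rpow_const (by linarith)).mul continuous_const).intervalIntegrable _ _
  rw [intervalIntegral.integral_mul_const, integral_rpow_sub_one hκ] at h1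
  rw [rayAvg]
  calc _ ≤ _ := h1
    _ = C / κ := by ring

lemma rayAvg_add {κ : ℝ} (hκ : 1 ≤ κ) {f g : ℝ → ℝ} (hf : Continuous f) (hg : Continuous g)
    (x : ℝ) : rayAvg κ (fun x => f x + g x) x = rayAvg κ f x + rayAvg κ g x := by
  rw [rayAvg, rayAvg, rayAvg, ← intervalIntegral.integral_add (intervalIntegrable_rayAvg hκ hf x)
    (intervalIntegrable_rayAvg hκ hg x)]
  exact intervalIntegral.integral_congr fun s _ => by ring

lemma rayAvg_const_mul {κ : ℝ} (c : ℝ) {f : ℝ → ℝ} (x : ℝ) :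
    rayAvg κ (fun x => c * f x) x = c * rayAvg κ f x := by
  rw [rayAvg, rayAvg, ← intervalIntegral.integral_const_mul]
  exact intervalIntegral.integral_congr fun s _ => by ring

/-- Weighted averages commute with differentiation, up to a shift of the weight. -/
lemma hasDerivAt_rayAvg {κ : ℝ} (hκ : 1 ≤ κ) {f f' : ℝ → ℝ} (hf : ∀ x, HasDerivAt f (f' x) x)
    (hf' : Continuous f') (x : ℝ) : HasDerivAt (rayAvg κ f) (rayAvg (κ + 1) f' x) x := by
  have hfc : Continuous f := continuous_iff_continuousAt.2 fun x => (hf x).continuousAt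
  obtain ⟨C, hC⟩ := (isCompact_Icc (a := -(|x| + 1)) (b := |x| + 1)).exists_bound_of_continuousOn
    hf'.continuousOn
  have key := intervalIntegral.hasDerivAt_integral_of_dominated_loc_of_deriv_le
    (μ := volume) (a := 0) (b := 1) (F := fun y s => s ^ (κ - 1) * f (s * y))
    (F' := fun y s => s ^ (κ - 1) * (f' (s * y) * s)) (x₀ := x) (bound := fun _ => C)
    (s := Metric.ball x 1) (Metric.ball_mem_nhds x one_pos)
    (Eventually.of_forall fun y =>
      (((continuous_rayAvg_integrand hκ hfc).comp
        (Continuous.prodMk_right y)).aestronglyMeasurable))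
    (intervalIntegrable_rayAvg hκ hfc x)
    (by
      refine Continuous.aestronglyMeasurable ?_
      have := (continuous_rayAvg_integrand hκ hf').comp (Continuous.prodMk_right x)
      refine (this.mul continuous_id).congr fun s => ?_
      simp [mul_assoc])
    (by
      refine Eventually.of_forall fun s hs y hy => ?_
      rw [uIoc_of_le zero_le_one] at hs
      have hy' : |y| ≤ |x| + 1 := by
        rw [Metric.mem_ball, Real.dist_eq] at hy
        have := abs_sub_abs_le_abs_sub y x
        linarith
      have hsy : ‖f' (s * y)‖ ≤ C := by
        refine hC _ (abs_le.1 ?_)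
        rw [abs_mul, abs_of_pos hs.1]
        nlinarith [hs.1, hs.2, abs_nonneg y]
      have hC0 : 0 ≤ C := (norm_nonneg _).trans hsy
      rw [norm_mul, norm_mul, Real.norm_of_nonneg (Real.rpow_nonneg hs.1.le _),
        Real.norm_of_nonneg hs.1.le]
      have h1 : s ^ (κ - 1) ≤ 1 := Real.rpow_le_one hs.1.le hs.2 (by linarith)
      have h2 : ‖f' (s * y)‖ * s ≤ C := by
        nlinarith [norm_nonneg (f' (s * y)), hs.1, hs.2]
      have h3 := Real.rpow_nonneg hs.1.le (κ - 1)
      have h4 : 0 ≤ ‖f' (s * y)‖ * s := mul_nonneg (norm_nonneg _) hs.1.le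
      nlinarith)
    (by simp)
    (by
      refine Eventually.of_forall fun s _ y _ => ?_
      have h1 : HasDerivAt (fun y => s * y) s y := by simpa using (hasDerivAt_id y).const_mul s
      exact ((hf (s * y)).comp y h1).const_mul _)
  have e : ∫ s in (0 : ℝ)..1, s ^ (κ - 1) * (f' (s * x) * s) = rayAvg (κ + 1) f' x := by
    rw [rayAvg]
    refine intervalIntegral.integral_congr_ae (Eventually.of_forall fun s hs => ?_)
    rw [uIoc_of_le zero_le_one] at hs
    have : s ^ (κ + 1 - 1) = s ^ (κ - 1) * s := by
      rw [← Real.rpow_add_one hs.1.ne']; congr 1; ring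
    rw [this]; ring
  rw [← e]
  exact key.2

/-- The primitive of a continuous function vanishing at the origin. -/
lemma hasDerivAt_primitive {f : ℝ → ℝ} (hf : Continuous f) (a x : ℝ) :
    HasDerivAt (fun x => ∫ r in a..x, f r) (f x) x :=
  intervalIntegral.integral_hasDerivAt_right (hf.intervalIntegrable _ _)
    (hf.stronglyMeasurableAtFilter _ _) hf.continuousAt

/-- Integration by parts: the derivative of `s ^ κ * F (s * x)`, with `F` the primitive of `f`, is
integrated over `[0, 1]`. The right side involves `f` only through `F`, so it is differentiable in
`x` even if `f` is merely continuous. -/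
lemma mul_rayAvg_eq {κ : ℝ} (hκ : 1 ≤ κ) {f : ℝ → ℝ} (hf : Continuous f) (x : ℝ) :
    x * rayAvg (κ + 1) f x
      = (∫ r in (0 : ℝ)..x, f r) - κ * rayAvg κ (fun y => ∫ r in (0 : ℝ)..y, f r) x := by
  set F : ℝ → ℝ := fun y => ∫ r in (0 : ℝ)..y, f r with hF
  have hFd : ∀ y, HasDerivAt F (f y) y := hasDerivAt_primitive hf 0
  have hFc : Continuous F := continuous_iff_continuousAt.2 fun x => (hFd x).continuousAt
  have hd : ∀ s ∈ uIcc (0 : ℝ) 1, HasDerivAt (fun s => s ^ κ * F (s * x))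
      (κ * (s ^ (κ - 1) * F (s * x)) + x * (s ^ (κ + 1 - 1) * f (s * x))) s := by
    intro s _
    have h1 : HasDerivAt (fun s : ℝ => s * x) x s := by simpa using (hasDerivAt_id s).mul_const x
    have h2 := (Real.hasDerivAt_rpow_const (x := s) (p := κ) (Or.inr hκ)).mul ((hFd (s * x)).comp s h1)
    refine h2.congr_deriv ?_
    simp only [add_sub_cancel_right, Function.comp]
    ring
  have hi1 := intervalIntegrable_rayAvg hκ hFc x
  have hi2 := intervalIntegrable_rayAvg (κ := κ + 1) (by linarith) hf x
  have h := intervalIntegral.integral_eq_sub_of_hasDerivAt hd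
    ((hi1.const_mul κ).add (hi2.const_mul x))
  rw [intervalIntegral.integral_add (hi1.const_mul κ) (hi2.const_mul x),
    intervalIntegral.integral_const_mul, intervalIntegral.integral_const_mul] at h
  have hκ0 : κ ≠ 0 := by linarith
  simp only [Real.one_rpow, one_mul, Real.zero_rpow hκ0, zero_mul, sub_zero] at h
  rw [rayAvg, rayAvg]
  linarith

lemma hasDerivAt_mul_rayAvg {κ : ℝ} (hκ : 1 ≤ κ) {f : ℝ → ℝ} (hf : Continuous f) (x : ℝ) :
    HasDerivAt (fun x => x * rayAvg (κ + 1) f x) (f x - κ * rayAvg (κ + 1) f x) x := by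
  have h : (fun x => x * rayAvg (κ + 1) f x) = fun x =>
      (∫ r in (0 : ℝ)..x, f r) - κ * rayAvg κ (fun y => ∫ r in (0 : ℝ)..y, f r) x :=
    funext fun x => mul_rayAvg_eq hκ hf x
  rw [h]
  exact (hasDerivAt_primitive hf 0 x).sub
    ((hasDerivAt_rayAvg hκ (hasDerivAt_primitive hf 0) hf x).const_mul κ)

lemma contDiff_of_hasDerivAt {n : ℕ} {f f' : ℝ → ℝ} (hf : ∀ x, HasDerivAt f (f' x) x)
    (hf' : ContDiff ℝ n f') : ContDiff ℝ (n + 1) f := by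
  rw [contDiff_succ_iff_deriv]
  refine ⟨fun x => (hf x).differentiableAt, by simp, ?_⟩
  rwa [funext fun x => (hf x).deriv]

lemma contDiff_rayAvg (n : ℕ) : ∀ {κ : ℝ}, 1 ≤ κ → ∀ {f : ℝ → ℝ}, ContDiff ℝ n f →
    ContDiff ℝ n (rayAvg κ f) := by
  induction n with
  | zero =>
    intro κ hκ f hf
    exact contDiff_zero.2 (continuous_rayAvg hκ hf.continuous)
  | succ n ih =>
    intro κ hκ f hf
    have h : ContDiff ℝ ((n : WithTop ℕ∞) + 1) f := by exact_mod_cast hf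
    rw [contDiff_succ_iff_deriv] at h
    have := contDiff_of_hasDerivAt
      (hasDerivAt_rayAvg hκ (fun x => (h.1 x).hasDerivAt) h.2.2.continuous)
      (ih (by linarith) h.2.2)
    exact_mod_cast this

/-- The factor `x` gains one derivative, because the derivative of the product is `f - κ * rayAvg (κ
+ 1) f`, in which `f` is not differentiated. This gain drives the bootstrap in `JetEq.smooth`. -/
lemma contDiff_mul_rayAvg (n : ℕ) {κ : ℝ} (hκ : 1 ≤ κ) {f : ℝ → ℝ} (hf : ContDiff ℝ n f) :
    ContDiff ℝ (n + 1) (fun x => x * rayAvg (κ + 1) f x) :=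
  contDiff_of_hasDerivAt (hasDerivAt_mul_rayAvg hκ hf.continuous)
    (hf.sub (contDiff_const.mul (contDiff_rayAvg n (by linarith) hf)))

/-- A solution of `x w' + κ w = f`, continuous at the origin, is a weighted average of `f`. -/
lemma eq_rayAvg_of_hasDerivAt {κ : ℝ} (hκ : 1 ≤ κ) {w w' f : ℝ → ℝ} (hw : Continuous w)
    (hd : ∀ x, x ≠ 0 → HasDerivAt w (w' x) x) (hf : Continuous f)
    (he : ∀ x, x * w' x + κ * w x = f x) (x : ℝ) : w x = rayAvg κ f x := by
  have hκ0 : κ ≠ 0 := by linarith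
  rcases eq_or_ne x 0 with rfl | hx
  · have h0 := he 0
    rw [zero_mul, zero_add] at h0
    simp only [rayAvg, mul_zero]
    rw [intervalIntegral.integral_mul_const, integral_rpow_sub_one hκ, ← h0]
    field_simp
  -- Along the ray through `x`, the integrating factor `s ^ κ` turns `x w' + κ w = f` into a total
  -- derivative; the open interval avoids the origin, where `w` is only continuous.
  have hd' : ∀ s ∈ Ioo (0 : ℝ) 1, HasDerivAt (fun s => s ^ κ * w (s * x))
      (s ^ (κ - 1) * f (s * x)) s := by
    intro s hs
    have h1 : HasDerivAt (fun s : ℝ => s * x) x s := by simpa using (hasDerivAt_id s).mul_const x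
    have h2 := (Real.hasDerivAt_rpow_const (x := s) (p := κ) (Or.inr hκ)).mul
      ((hd (s * x) (mul_ne_zero hs.1.ne' hx)).comp s h1)
    refine h2.congr_deriv ?_
    rw [← he (s * x)]
    have : s ^ κ = s ^ (κ - 1) * s := by
      rw [← Real.rpow_add_one hs.1.ne']; congr 1; ring
    simp only [Function.comp, this]
    ring
  have hc : Continuous (fun s : ℝ => s ^ κ * w (s * x)) :=
    (Real.continuous_rpow_const (by linarith)).mul (hw.comp (continuous_id.mul continuous_const))
  have h := intervalIntegral.integral_eq_sub_of_hasDerivAt_of_le zero_le_one hc.continuousOn hd'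
    (intervalIntegrable_rayAvg hκ hf x)
  simp only [Real.one_rpow, one_mul, Real.zero_rpow hκ0, zero_mul, sub_zero] at h
  rw [rayAvg, h]

/-- Off the origin the average solves `x w' + κ w = f`, with `f` only continuous. -/
lemma hasDerivAt_rayAvg_of_ne {κ : ℝ} (hκ : 2 ≤ κ) {f : ℝ → ℝ} (hf : Continuous f) {x : ℝ}
    (hx : x ≠ 0) : HasDerivAt (rayAvg κ f) ((f x - κ * rayAvg κ f x) / x) x := by
  have h := hasDerivAt_mul_rayAvg (κ := κ - 1) (by linarith) hf x
  rw [sub_add_cancel] at h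
  have h2 := h.div (hasDerivAt_id x) hx
  refine (h2.congr_of_eventuallyEq ?_).congr_deriv ?_
  · filter_upwards [isOpen_ne.mem_nhds hx] with y hy
    simp only [Pi.div_apply, id]
    field_simp [show y ≠ 0 from hy]
  · simp only [id]
    field_simp
    ring

/-- Multiplication by a power removes the singularity of the derivative of a weighted average. -/
lemma hasDerivAt_pow_mul_rayAvg {m : ℕ} (hm : 2 ≤ m) {f : ℝ → ℝ} (hf : Continuous f) (x : ℝ) :
    HasDerivAt (fun x => x ^ m * rayAvg m f x) (x ^ (m - 1) * f x) x := by
  obtain ⟨n, rfl⟩ : ∃ n, m = n + 2 := ⟨m - 2, by omega⟩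
  have h := hasDerivAt_mul_rayAvg (κ := n + 1) (by linarith [n.cast_nonneg (α := ℝ)]) hf x
  have h2 := (hasDerivAt_pow (n + 1) x).mul h
  have e : ((n + 2 : ℕ) : ℝ) = (n : ℝ) + 1 + 1 := by push_cast; ring
  rw [e]
  refine (h2.congr_of_eventuallyEq (Eventually.of_forall fun y => ?_)).congr_deriv ?_
  · simp only [Pi.mul_apply]; ring
  · simp only [Nat.add_sub_cancel, show n + 2 - 1 = n + 1 from rfl]
    push_cast
    ring

/-- Averages of functions vanishing at the origin. -/
lemma rayAvg_mul_self {κ : ℝ} {f : ℝ → ℝ} (x : ℝ) :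
    rayAvg κ (fun x => x * f x) x = x * rayAvg (κ + 1) f x := by
  rw [rayAvg, rayAvg, ← intervalIntegral.integral_const_mul]
  refine intervalIntegral.integral_congr_ae (Eventually.of_forall fun s hs => ?_)
  rw [uIoc_of_le zero_le_one] at hs
  have : s ^ (κ + 1 - 1) = s ^ (κ - 1) * s := by
    rw [← Real.rpow_add_one hs.1.ne']; congr 1; ring
  simp only [this]; ring

/-! ### Extension and Taylor expansion of smooth functions on an interval -/

/-- A `C^n` function on a compact interval extends to a `C^n` function on the line. -/
lemma exists_contDiff_extension {a b : ℝ} (hab : a < b) (n : ℕ) : ∀ {f : ℝ → ℝ},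
    ContDiffOn ℝ n f (Icc a b) → ∃ F : ℝ → ℝ, ContDiff ℝ n F ∧ EqOn F f (Icc a b) := by
  induction n with
  | zero =>
    intro f hf
    refine ⟨IccExtend hab.le ((Icc a b).domRestrict f), contDiff_zero.2 ?_, fun x hx => ?_⟩
    · exact (continuousOn_iff_continuous_domRestrict.1 hf.continuousOn).Icc_extend'
    · rw [IccExtend_of_mem _ _ hx]; rfl
  | succ n ih =>
    intro f hf
    have hu : UniqueDiffOn ℝ (Icc a b) := uniqueDiffOn_Icc hab
    have hf' : ContDiffOn ℝ ((n : WithTop ℕ∞) + 1) f (Icc a b) := by exact_mod_cast hf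
    rw [contDiffOn_succ_iff_derivWithin hu] at hf'
    -- The extension of `f` is the primitive of an extension of its derivative.
    obtain ⟨F, hF, hFe⟩ := ih hf'.2.2
    have hc := contDiff_of_hasDerivAt (fun x => (hasDerivAt_primitive hF.continuous a x).const_add (f a)) hF
    refine ⟨fun x => f a + ∫ r in a..x, F r, by exact_mod_cast hc, fun x hx => ?_⟩
    have : ∫ r in a..x, F r = f x - f a := by
      refine intervalIntegral.integral_eq_sub_of_hasDerivAt_of_le hx.1
        (hf.continuousOn.mono (Icc_subset_Icc le_rfl hx.2)) (fun y hy => ?_)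
        (hF.continuous.intervalIntegrable _ _)
      have hy' : y ∈ Icc a b := ⟨hy.1.le, hy.2.le.trans hx.2⟩
      rw [hFe hy']
      exact ((hf'.1 y hy').hasDerivWithinAt).hasDerivAt (Icc_mem_nhds hy.1 (hy.2.trans_le hx.2))
    simp only [this]; ring

lemma mul_mem_Icc {a b s x : ℝ} (ha : a ≤ 0) (hb : 0 ≤ b) (hs : s ∈ Icc (0 : ℝ) 1)
    (hx : x ∈ Icc a b) : s * x ∈ Icc a b := by
  obtain ⟨h1, h2⟩ := hs
  obtain ⟨h3, h4⟩ := hx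
  constructor <;> nlinarith

/-- The average at `x` only sees `f` on the segment from `0` to `x`, so it is independent of the
extension used, and a separate `C^n` extension for each `n` is enough. -/
lemma contDiffOn_rayAvg {a b κ : ℝ} (hab : a < b) (ha : a ≤ 0) (hb : 0 ≤ b) (hκ : 1 ≤ κ)
    {f : ℝ → ℝ} (hf : ContDiffOn ℝ ∞ f (Icc a b)) : ContDiffOn ℝ ∞ (rayAvg κ f) (Icc a b) := by
  refine contDiffOn_infty.2 fun n => ?_
  obtain ⟨F, hF, hFe⟩ := exists_contDiff_extension hab n (contDiffOn_infty.1 hf n)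
  refine (contDiff_rayAvg n hκ hF).contDiffOn.congr fun x hx => ?_
  exact rayAvg_congr fun s hs => (hFe (mul_mem_Icc ha hb hs hx)).symm

/-- Hadamard's lemma on an interval. -/
lemma exists_hadamard {a b : ℝ} (hab : a < b) (ha : a ≤ 0) (hb : 0 ≤ b) {f : ℝ → ℝ}
    (hf : ContDiffOn ℝ ∞ f (Icc a b)) : ∃ g : ℝ → ℝ, ContDiffOn ℝ ∞ g (Icc a b) ∧
      ∀ x ∈ Icc a b, f x = f 0 + x * g x := by
  have hu : UniqueDiffOn ℝ (Icc a b) := uniqueDiffOn_Icc hab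
  have hf' : ContDiffOn ℝ ∞ (derivWithin f (Icc a b)) (Icc a b) :=
    ((contDiffOn_infty_iff_derivWithin hu).1 hf).2
  -- The quotient is `∫₀¹ f'(s x) ds`, the average of weight one of the derivative.
  refine ⟨rayAvg 1 (derivWithin f (Icc a b)), contDiffOn_rayAvg hab ha hb le_rfl hf',
    fun x hx => ?_⟩
  obtain ⟨F, hF, hFe⟩ := exists_contDiff_extension hab 1 (contDiffOn_infty.1 hf 1)
  have hFd : ∀ y, HasDerivAt F (deriv F y) y := fun y =>
    (hF.differentiable (by simp) y).hasDerivAt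
  have hFc : Continuous (deriv F) := hF.continuous_deriv (by simp)
  have h0 : (0 : ℝ) ∈ Icc a b := ⟨ha, hb⟩
  have h1 : rayAvg 1 (derivWithin f (Icc a b)) x = rayAvg 1 (deriv F) x := by
    refine rayAvg_congr fun s hs => ?_
    have hm := mul_mem_Icc ha hb hs hx
    rw [derivWithin_congr hFe.symm (hFe hm).symm, (hFd _).hasDerivWithinAt.derivWithin (hu _ hm)]
  have h2 : x * rayAvg 1 (deriv F) x = F x - F 0 := by
    have hd : ∀ s ∈ uIcc (0 : ℝ) 1, HasDerivAt (fun s => F (s * x)) (x * deriv F (s * x)) s := by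
      intro s _
      have h1 : HasDerivAt (fun s : ℝ => s * x) x s := by simpa using (hasDerivAt_id s).mul_const x
      exact ((hFd (s * x)).comp s h1).congr_deriv (by ring)
    have h := intervalIntegral.integral_eq_sub_of_hasDerivAt hd
      ((continuous_const.mul (hFc.comp
        (continuous_id.mul continuous_const))).intervalIntegrable _ _)
    rw [intervalIntegral.integral_const_mul] at h
    simp only [one_mul, zero_mul] at h
    rw [← h, rayAvg]
    simp
  rw [h1, h2, hFe hx, hFe h0]; ring

/-- Taylor's formula with smooth remainder on an interval. -/
lemma exists_taylor {a b : ℝ} (hab : a < b) (ha : a ≤ 0) (hb : 0 ≤ b) (m : ℕ) {f : ℝ → ℝ}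
    (hf : ContDiffOn ℝ ∞ f (Icc a b)) : ∃ (t : ℕ → ℝ) (r : ℝ → ℝ), ContDiffOn ℝ ∞ r (Icc a b) ∧
      ∀ x ∈ Icc a b, f x = ∑ k ∈ Finset.range m, t k * x ^ k + x ^ m * r x := by
  induction m with
  | zero => exact ⟨0, f, hf, fun x _ => by simp⟩
  | succ m ih =>
    obtain ⟨t, r, hr, h⟩ := ih
    obtain ⟨g, hg, hg'⟩ := exists_hadamard hab ha hb hr
    refine ⟨fun k => if k = m then r 0 else t k, g, hg, fun x hx => ?_⟩
    rw [Finset.sum_range_succ, h x hx, hg' x hx]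
    have : ∑ k ∈ Finset.range m, (if k = m then r 0 else t k) * x ^ k
        = ∑ k ∈ Finset.range m, t k * x ^ k :=
      Finset.sum_congr rfl fun k hk => by rw [if_neg (Finset.mem_range.1 hk).ne]
    simp only [this, if_true]; ring

end WaveBlowup

end

noncomputable section

namespace WaveBlowup

open Set MeasureTheory Filter Topology

/-! ### Continuous functions on an interval around the singular point -/

/-- A nondegenerate compact interval containing the origin. -/
structure RayInterval where
  /-- the left endpoint -/
  lo : ℝ
  /-- the right endpoint -/
  hi : ℝ
  lt : lo < hi
  lo_nonpos : lo ≤ 0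
  hi_nonneg : 0 ≤ hi

namespace RayInterval

variable (J : RayInterval)

/-- The underlying set. -/
def set : Set ℝ := Icc J.lo J.hi

/-- The Banach space of continuous functions on the interval. -/
abbrev Fn : Type := C(Icc J.lo J.hi, ℝ)

/-- Extension of a continuous function by constants. -/
def ext (w : J.Fn) : ℝ → ℝ := IccExtend J.lt.le w

lemma continuous_ext (w : J.Fn) : Continuous (J.ext w) := w.continuous.Icc_extend'

lemma ext_of_mem (w : J.Fn) {x : ℝ} (hx : x ∈ J.set) : J.ext w x = w ⟨x, hx⟩ :=
  IccExtend_of_mem _ _ hx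

lemma abs_ext_le (w : J.Fn) (x : ℝ) : |J.ext w x| ≤ ‖w‖ := w.norm_coe_le_norm _

lemma mul_mem {s x : ℝ} (hs : s ∈ Icc (0 : ℝ) 1) (hx : x ∈ J.set) : s * x ∈ J.set :=
  mul_mem_Icc J.lo_nonpos J.hi_nonneg hs hx

lemma zero_mem : (0 : ℝ) ∈ J.set := ⟨J.lo_nonpos, J.hi_nonneg⟩

open Classical in
/-- Restriction of a function continuous on the interval. -/
def restr (f : ℝ → ℝ) : J.Fn :=
  if h : ContinuousOn f J.set then ⟨fun x => f x, continuousOn_iff_continuous_domRestrict.1 h⟩ else 0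

lemma ext_restr {f : ℝ → ℝ} (hf : ContinuousOn f J.set) {x : ℝ} (hx : x ∈ J.set) :
    J.ext (J.restr f) x = f x := by
  rw [ext_of_mem _ _ hx, restr, dif_pos hf]; rfl

/-- The weighted average as a bounded operator. -/
def avg (κ : ℝ) (hκ : 1 ≤ κ) : J.Fn →L[ℝ] J.Fn :=
  LinearMap.mkContinuous
    { toFun := fun w => ⟨fun x => rayAvg κ (J.ext w) x,
        (continuous_rayAvg hκ (J.continuous_ext w)).comp continuous_subtype_val⟩
      map_add' := fun w w' => by
        ext x
        exact rayAvg_add hκ (J.continuous_ext w) (J.continuous_ext w') x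
      map_smul' := fun c w => by
        ext x
        exact rayAvg_const_mul c (f := J.ext w) x }
    (1 / κ) fun w => by
      rw [ContinuousMap.norm_le _ (by positivity)]
      intro x
      calc _ ≤ ‖w‖ / κ := abs_rayAvg_le hκ fun s _ => J.abs_ext_le w _
        _ = 1 / κ * ‖w‖ := by ring

lemma ext_avg {κ : ℝ} (hκ : 1 ≤ κ) (w : J.Fn) {x : ℝ} (hx : x ∈ J.set) :
    J.ext (J.avg κ hκ w) x = rayAvg κ (J.ext w) x := by
  rw [ext_of_mem _ _ hx]; rfl

/-- The decay in the weight is what makes the remainder equation a small perturbation of the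
identity at high expansion order. -/
lemma norm_avg_le {κ : ℝ} (hκ : 1 ≤ κ) : ‖J.avg κ hκ‖ ≤ 1 / κ :=
  LinearMap.mkContinuous_norm_le _ (by positivity) _

lemma ext_add (w w' : J.Fn) (x : ℝ) : J.ext (w + w') x = J.ext w x + J.ext w' x := rfl

lemma ext_sub (w w' : J.Fn) (x : ℝ) : J.ext (w - w') x = J.ext w x - J.ext w' x := rfl

lemma ext_mul (w w' : J.Fn) (x : ℝ) : J.ext (w * w') x = J.ext w x * J.ext w' x := rfl

lemma ext_smul (c : ℝ) (w : J.Fn) (x : ℝ) : J.ext (c • w) x = c * J.ext w x := rfl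

lemma ext_sum {α : Type*} (s : Finset α) (w : α → J.Fn) (x : ℝ) :
    J.ext (∑ i ∈ s, w i) x = ∑ i ∈ s, J.ext (w i) x := by
  simp [ext, IccExtend, Function.comp]

end RayInterval

/-! ### Second order equations with a simple singular point at the origin -/

/-- The equation `x u'' + β u' + γ u = g` on an interval around the origin, where
`β = β₀ + ε β₁ + ε² β₂`, `γ = γ₀ + ε γ₁ + ε² γ₂`, with an order `m` of Taylor expansion. -/
structure SingularBlock where
  /-- the interval -/
  J : RayInterval
  /-- the order of expansion -/
  m : ℕ
  /-- the first order coefficients -/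
  β : Fin 3 → ℝ → ℝ
  /-- the zeroth order coefficients -/
  γ : Fin 3 → ℝ → ℝ
  smooth_β : ∀ l, ContDiffOn ℝ ∞ (β l) J.set
  smooth_γ : ∀ l, ContDiffOn ℝ ∞ (γ l) J.set
  two_le : 2 ≤ m

namespace SingularBlock

variable (D : SingularBlock)

lemma one_le_m : (1 : ℝ) ≤ D.m := by
  have := D.two_le
  exact_mod_cast (by omega : 1 ≤ D.m)

lemma one_le_m_succ : (1 : ℝ) ≤ (D.m : ℝ) + 1 := by linarith [D.one_le_m]

/-- The value of the `l`-th coefficient of the operator on the monomial `x^i`. -/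
def mono (i : ℕ) (l : Fin 3) (x : ℝ) : ℝ :=
  (if l = 0 then (i : ℝ) * (i - 1) * x ^ (i - 1) else 0)
    + i * x ^ (i - 1) * D.β l x + x ^ i * D.γ l x

lemma smooth_mono (i : ℕ) (l : Fin 3) : ContDiffOn ℝ ∞ (D.mono i l) D.J.set := by
  have h1 : ContDiffOn ℝ ∞ (fun x : ℝ => (i : ℝ) * x ^ (i - 1)) D.J.set := by fun_prop
  have h2 : ContDiffOn ℝ ∞ (fun x : ℝ => x ^ i) D.J.set := by fun_prop
  have h3 : ContDiffOn ℝ ∞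
      (fun x : ℝ => (if l = 0 then (i : ℝ) * (i - 1) * x ^ (i - 1) else 0)) D.J.set := by
    split_ifs <;> fun_prop
  exact (h3.add (h1.mul (D.smooth_β l))).add (h2.mul (D.smooth_γ l))

lemma exists_taylor_of_smooth {f : ℝ → ℝ} (hf : ContDiffOn ℝ ∞ f D.J.set) :
    ∃ q : (ℕ → ℝ) × (ℝ → ℝ), ContDiffOn ℝ ∞ q.2 D.J.set ∧
      ∀ x ∈ D.J.set, f x = ∑ k ∈ Finset.range D.m, q.1 k * x ^ k + x ^ D.m * q.2 x := by
  obtain ⟨t, r, hr, h⟩ := exists_taylor D.J.lt D.J.lo_nonpos D.J.hi_nonneg D.m hf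
  exact ⟨(t, r), hr, h⟩

open Classical in
/-- Taylor coefficients and remainder, of order `m`. -/
def taylor (f : ℝ → ℝ) : (ℕ → ℝ) × (ℝ → ℝ) :=
  if hf : ContDiffOn ℝ ∞ f D.J.set then (D.exists_taylor_of_smooth hf).choose else 0

lemma taylor_smooth {f : ℝ → ℝ} (hf : ContDiffOn ℝ ∞ f D.J.set) :
    ContDiffOn ℝ ∞ (D.taylor f).2 D.J.set := by
  rw [taylor, dif_pos hf]; exact (D.exists_taylor_of_smooth hf).choose_spec.1

lemma taylor_eq {f : ℝ → ℝ} (hf : ContDiffOn ℝ ∞ f D.J.set) {x : ℝ} (hx : x ∈ D.J.set) :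
    f x = ∑ k ∈ Finset.range D.m, (D.taylor f).1 k * x ^ k + x ^ D.m * (D.taylor f).2 x := by
  rw [taylor, dif_pos hf]; exact (D.exists_taylor_of_smooth hf).choose_spec.2 x hx

/-- The average of order `m`. -/
def avg0 : D.J.Fn →L[ℝ] D.J.Fn := D.J.avg D.m D.one_le_m

/-- The average of order `m + 1`. -/
def avg1 : D.J.Fn →L[ℝ] D.J.Fn := D.J.avg (D.m + 1) D.one_le_m_succ

/-- The undifferentiated form of the lower order terms acting on the remainder. -/
def low (l : Fin 3) : D.J.Fn →L[ℝ] D.J.Fn :=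
  ContinuousLinearMap.mul ℝ D.J.Fn (D.J.restr (D.β l))
    + (ContinuousLinearMap.mul ℝ D.J.Fn (D.J.restr fun x => x * D.γ l x)).comp D.avg1

/-- The perturbation operator acting on the remainder. -/
def pert (l : Fin 3) : D.J.Fn →L[ℝ] D.J.Fn := D.avg0.comp (D.low l)

/-- The contribution of the monomials to the equation of the remainder. -/
def src (i : Fin (D.m + 1)) (l : Fin 3) : D.J.Fn :=
  D.avg0 (D.J.restr (D.taylor (D.mono i l)).2)

/-- Unknowns: the Taylor coefficients and the remainder. -/
abbrev Jet : Type := (Fin (D.m + 1) → ℝ) × D.J.Fn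

/-- The function `u` with given Taylor coefficients and remainder. -/
def U (X : D.Jet) (x : ℝ) : ℝ :=
  ∑ i, X.1 i * x ^ (i : ℕ) + x ^ (D.m + 1) * rayAvg (D.m + 1) (D.J.ext X.2) x

/-- The derivative of `u`. -/
def V (X : D.Jet) (x : ℝ) : ℝ :=
  ∑ i, X.1 i * ((i : ℕ) * x ^ ((i : ℕ) - 1)) + x ^ D.m * D.J.ext X.2 x

lemma ext_low (l : Fin 3) (w : D.J.Fn) {x : ℝ} (hx : x ∈ D.J.set) :
    D.J.ext (D.low l w) x
      = D.β l x * D.J.ext w x + x * D.γ l x * rayAvg (D.m + 1) (D.J.ext w) x := by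
  have h1 : ContinuousOn (fun x => x * D.γ l x) D.J.set :=
    continuousOn_id.mul (D.smooth_γ l).continuousOn
  rw [low, add_apply, RayInterval.ext_add, ContinuousLinearMap.mul_apply',
    RayInterval.ext_mul, ContinuousLinearMap.comp_apply, ContinuousLinearMap.mul_apply',
    RayInterval.ext_mul, RayInterval.ext_restr _ (D.smooth_β l).continuousOn hx,
    RayInterval.ext_restr _ h1 hx, avg1, RayInterval.ext_avg _ _ _ hx]

/-- Only the outer average contributes a factor `1 / m`; `low` is bounded independently of `m`,
since the inner average has norm at most one. -/
lemma norm_pert_le {l : Fin 3} {Cβ Cγ : ℝ} (hβ : ∀ x ∈ D.J.set, |D.β l x| ≤ Cβ)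
    (hγ : ∀ x ∈ D.J.set, |x * D.γ l x| ≤ Cγ) : ‖D.pert l‖ ≤ (Cβ + Cγ) / D.m := by
  have hm := D.one_le_m
  have h1 : ContinuousOn (fun x => x * D.γ l x) D.J.set :=
    continuousOn_id.mul (D.smooth_γ l).continuousOn
  have hβ0 : 0 ≤ Cβ := (abs_nonneg _).trans (hβ 0 D.J.zero_mem)
  have hγ0 : 0 ≤ Cγ := (abs_nonneg _).trans (hγ 0 D.J.zero_mem)
  have n1 : ‖D.J.restr (D.β l)‖ ≤ Cβ := by
    rw [ContinuousMap.norm_le _ hβ0]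
    intro x
    rw [← RayInterval.ext_of_mem _ _ x.2, RayInterval.ext_restr _ (D.smooth_β l).continuousOn x.2]
    exact hβ _ x.2
  have n2 : ‖D.J.restr fun x => x * D.γ l x‖ ≤ Cγ := by
    rw [ContinuousMap.norm_le _ hγ0]
    intro x
    rw [← RayInterval.ext_of_mem _ _ x.2, RayInterval.ext_restr _ h1 x.2]
    exact hγ _ x.2
  have n3 : ‖D.avg1‖ ≤ 1 := (D.J.norm_avg_le _).trans (by
    rw [div_le_one (by linarith)]; linarith)
  have n4 : ‖D.low l‖ ≤ Cβ + Cγ := by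
    refine (norm_add_le (E := D.J.Fn →L[ℝ] D.J.Fn) _ _).trans (add_le_add ?_ ?_)
    · exact (ContinuousLinearMap.opNorm_mul_apply_le ℝ D.J.Fn _).trans n1
    · refine (ContinuousLinearMap.opNorm_comp_le _ _).trans ?_
      have := (ContinuousLinearMap.opNorm_mul_apply_le ℝ D.J.Fn
        (D.J.restr fun x => x * D.γ l x)).trans n2
      calc _ ≤ Cγ * 1 := mul_le_mul this n3 (norm_nonneg D.avg1) hγ0
        _ = Cγ := mul_one _
  calc ‖D.pert l‖ ≤ ‖D.avg0‖ * ‖D.low l‖ := ContinuousLinearMap.opNorm_comp_le _ _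
    _ ≤ 1 / D.m * (Cβ + Cγ) :=
      mul_le_mul (D.J.norm_avg_le _) n4 (norm_nonneg (D.low l)) (by positivity)
    _ = (Cβ + Cγ) / D.m := by ring

/-- The equations satisfied by the jets of a solution of
`∑ l, (x u_l'' [l = 0] + β_l u_l' + γ_l u_l) = g`, where `q` consists of the Taylor coefficients
and the remainder of `g`. -/
structure JetEq (X : Fin 3 → D.Jet) (q : (ℕ → ℝ) × (ℝ → ℝ)) : Prop where
  coeff : ∀ k < D.m, ∑ l, ∑ i, (X l).1 i * (D.taylor (D.mono i l)).1 k = q.1 k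
  rem : (X 0).2 + ∑ l, (D.pert l (X l).2 + ∑ i, (X l).1 i • D.src i l)
      = D.avg0 (D.J.restr q.2)

/-- The source of the remainder. -/
def remSrc (X : Fin 3 → D.Jet) (q : (ℕ → ℝ) × (ℝ → ℝ)) : D.J.Fn :=
  D.J.restr q.2
    - ∑ l, (D.low l (X l).2 + ∑ i, (X l).1 i • D.J.restr (D.taylor (D.mono i l)).2)

variable {D} {X : Fin 3 → D.Jet} {q : (ℕ → ℝ) × (ℝ → ℝ)}

lemma JetEq.rem_eq (h : D.JetEq X q) : (X 0).2 = D.avg0 (D.remSrc X q) := by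
  rw [eq_sub_of_add_eq h.rem, remSrc]
  simp only [map_sub, map_sum, map_add, map_smul, pert, src, ContinuousLinearMap.comp_apply]

lemma JetEq.ext_rem (h : D.JetEq X q) {x : ℝ} (hx : x ∈ D.J.set) :
    D.J.ext (X 0).2 x = rayAvg D.m (D.J.ext (D.remSrc X q)) x := by
  rw [h.rem_eq, avg0, RayInterval.ext_avg _ _ _ hx]

lemma ext_remSrc (hq : ContinuousOn q.2 D.J.set) {x : ℝ} (hx : x ∈ D.J.set) :
    D.J.ext (D.remSrc X q) x = q.2 x
      - ∑ l, (D.β l x * D.J.ext (X l).2 x + x * D.γ l x * rayAvg (D.m + 1) (D.J.ext (X l).2) x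
        + ∑ i, (X l).1 i * (D.taylor (D.mono i l)).2 x) := by
  rw [remSrc, RayInterval.ext_sub, RayInterval.ext_restr _ hq hx,
    RayInterval.ext_sum]
  congr 1
  refine Finset.sum_congr rfl fun l _ => ?_
  rw [RayInterval.ext_add, D.ext_low l _ hx, RayInterval.ext_sum]
  congr 1
  refine Finset.sum_congr rfl fun i _ => ?_
  rw [RayInterval.ext_smul,
    RayInterval.ext_restr _ (D.taylor_smooth (D.smooth_mono i l)).continuousOn hx]

lemma hasDerivAt_U (Y : D.Jet) (x : ℝ) : HasDerivAt (D.U Y) (D.V Y x) x := by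
  have h1 : HasDerivAt (fun x => ∑ i, Y.1 i * x ^ (i : ℕ))
      (∑ i, Y.1 i * ((i : ℕ) * x ^ ((i : ℕ) - 1))) x := by
    refine HasDerivAt.fun_sum fun i _ => ?_
    exact (hasDerivAt_pow (i : ℕ) x).const_mul _
  have h2 := hasDerivAt_pow_mul_rayAvg (m := D.m + 1) (by linarith [D.two_le])
    (D.J.continuous_ext Y.2) x
  rw [Nat.add_sub_cancel, Nat.cast_succ] at h2
  exact h1.add h2

/-- The remainder `w` is only a continuous function a priori, but by its equation it is an average
of weight `m`, and `x ^ m` times such an average is a primitive of `x ^ (m - 1)` times the averaged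
function. -/
lemma JetEq.hasDerivWithinAt_V (h : D.JetEq X q) {x : ℝ} (hx : x ∈ D.J.set) :
    HasDerivWithinAt (D.V (X 0)) (∑ i, (X 0).1 i * ((i : ℕ) * (((i : ℕ) - 1 : ℕ)
      * x ^ ((i : ℕ) - 1 - 1))) + x ^ (D.m - 1) * D.J.ext (D.remSrc X q) x) D.J.set x := by
  have h1 : HasDerivAt (fun x => ∑ i, (X 0).1 i * ((i : ℕ) * x ^ ((i : ℕ) - 1)))
      (∑ i, (X 0).1 i * ((i : ℕ) * (((i : ℕ) - 1 : ℕ) * x ^ ((i : ℕ) - 1 - 1)))) x := by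
    refine HasDerivAt.fun_sum fun i _ => ?_
    exact ((hasDerivAt_pow ((i : ℕ) - 1) x).const_mul _).const_mul _
  have h2 := hasDerivAt_pow_mul_rayAvg D.two_le (D.J.continuous_ext (D.remSrc X q)) x
  refine (h1.add h2).hasDerivWithinAt.congr (fun y hy => ?_) ?_
  · simp only [V, Pi.add_apply, h.ext_rem hy]
  · simp only [V, Pi.add_apply, h.ext_rem hx]

lemma V_zero_sum (Y : D.Jet) (l : Fin 3) (x : ℝ) :
    D.β l x * D.V Y x + D.γ l x * D.U Y x
      = ∑ i, Y.1 i * (i * x ^ ((i : ℕ) - 1) * D.β l x + x ^ (i : ℕ) * D.γ l x)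
        + x ^ D.m * (D.β l x * D.J.ext Y.2 x
          + x * D.γ l x * rayAvg (D.m + 1) (D.J.ext Y.2) x) := by
  simp only [U, V, mul_add, Finset.mul_sum, Finset.sum_add_distrib]
  have e1 : ∑ i, D.β l x * (Y.1 i * ((i : ℕ) * x ^ ((i : ℕ) - 1)))
      = ∑ i, Y.1 i * (i * x ^ ((i : ℕ) - 1) * D.β l x) :=
    Finset.sum_congr rfl fun i _ => by ring
  have e2 : ∑ i, D.γ l x * (Y.1 i * x ^ (i : ℕ)) = ∑ i, Y.1 i * (x ^ (i : ℕ) * D.γ l x) :=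
    Finset.sum_congr rfl fun i _ => by ring
  rw [e1, e2]; ring

/-- Jets satisfying the jet equations give solutions. -/
theorem JetEq.solves (h : D.JetEq X q) (hq : ContinuousOn q.2 D.J.set) :
    ∃ V' : ℝ → ℝ, ∀ x ∈ D.J.set, HasDerivWithinAt (D.V (X 0)) (V' x) D.J.set x ∧
      x * V' x + ∑ l, (D.β l x * D.V (X l) x + D.γ l x * D.U (X l) x) =
        ∑ k ∈ Finset.range D.m, q.1 k * x ^ k + x ^ D.m * q.2 x := by
  refine ⟨_, fun x hx => ⟨h.hasDerivWithinAt_V hx, ?_⟩⟩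
  obtain ⟨n, hn⟩ : ∃ n, D.m = n + 1 := ⟨D.m - 1, by have := D.two_le; omega⟩
  have e1 : x * (∑ i, (X 0).1 i * ((i : ℕ) * (((i : ℕ) - 1 : ℕ) * x ^ ((i : ℕ) - 1 - 1)))
      + x ^ (D.m - 1) * D.J.ext (D.remSrc X q) x)
      = ∑ l : Fin 3, ∑ i, (X l).1 i * (if l = 0 then (i : ℝ) * (i - 1) * x ^ ((i : ℕ) - 1) else 0)
        + x ^ D.m * D.J.ext (D.remSrc X q) x := by
    rw [mul_add]
    congr 1
    · rw [Fin.sum_univ_three]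
      simp only [Finset.mul_sum, if_true, Fin.isValue, one_ne_zero, if_false, mul_zero,
        Finset.sum_const_zero, add_zero, show ¬ ((2 : Fin 3) = 0) by decide]
      refine Finset.sum_congr rfl fun i _ => ?_
      rcases i with ⟨i, hi⟩
      rcases i with _ | _ | i
      · simp
      · simp
      · simp only [Nat.add_sub_cancel, pow_succ]; push_cast; ring
    · rw [← mul_assoc, ← pow_succ', hn]; rfl
  rw [e1, ext_remSrc hq hx]
  simp only [V_zero_sum]
  -- Each Taylor remainder is exchanged for the full function minus its Taylor polynomial; the
  -- polynomials then recombine, through the coefficient equations, into that of the right-hand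
  -- side.
  have e3 : ∀ (i : Fin (D.m + 1)) (l : Fin 3), x ^ D.m * (D.taylor (D.mono i l)).2 x
      = D.mono i l x - ∑ k ∈ Finset.range D.m, (D.taylor (D.mono i l)).1 k * x ^ k := by
    intro i l
    rw [D.taylor_eq (D.smooth_mono i l) hx]; ring
  have e4 : ∑ l, ∑ i, (X l).1 i * ∑ k ∈ Finset.range D.m, (D.taylor (D.mono i l)).1 k * x ^ k
      = ∑ k ∈ Finset.range D.m, q.1 k * x ^ k := by
    rw [← Finset.sum_congr rfl fun k hk =>
      congrArg (· * x ^ k) (h.coeff k (Finset.mem_range.1 hk))]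
    simp only [Finset.mul_sum, Finset.sum_mul]
    conv_rhs => rw [Finset.sum_comm]
    refine Finset.sum_congr rfl fun l _ => ?_
    conv_rhs => rw [Finset.sum_comm]
    exact Finset.sum_congr rfl fun i _ => Finset.sum_congr rfl fun k _ => by ring
  have e5 : x ^ D.m * ∑ l, ∑ i, (X l).1 i * (D.taylor (D.mono i l)).2 x
      = ∑ l, ∑ i, (X l).1 i * D.mono i l x
        - ∑ k ∈ Finset.range D.m, q.1 k * x ^ k := by
    rw [← e4, ← Finset.sum_sub_distrib, Finset.mul_sum]
    refine Finset.sum_congr rfl fun l _ => ?_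
    rw [← Finset.sum_sub_distrib, Finset.mul_sum]
    refine Finset.sum_congr rfl fun i _ => ?_
    rw [← mul_sub, ← e3]; ring
  have e6 : ∑ l, ∑ i, (X l).1 i * D.mono i l x
      = ∑ l : Fin 3, ∑ i, (X l).1 i * (if l = 0 then (i : ℝ) * (i - 1) * x ^ ((i : ℕ) - 1) else 0)
        + ∑ l, ∑ i, (X l).1 i * (i * x ^ ((i : ℕ) - 1) * D.β l x + x ^ (i : ℕ) * D.γ l x) := by
    rw [← Finset.sum_add_distrib]
    refine Finset.sum_congr rfl fun l _ => ?_
    rw [← Finset.sum_add_distrib]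
    refine Finset.sum_congr rfl fun i _ => ?_
    rw [mono]; ring
  simp only [Finset.sum_add_distrib (ι := Fin 3), ← Finset.mul_sum (ι := Fin 3)] at e5 e6 ⊢
  linear_combination -e5 - e6

end SingularBlock

end WaveBlowup

end

/-! ### Uniqueness of Taylor coefficients and smoothness at a singular point -/

noncomputable section

namespace WaveBlowup

open Set MeasureTheory Filter Topology

/-- A Taylor expansion which vanishes frequently near the origin has zero coefficients. -/
lemma coeff_eq_zero_of_frequently (n : ℕ) : ∀ {c : ℕ → ℝ} {r : ℝ → ℝ}, Continuous r →
    (∃ᶠ x in 𝓝[≠] (0 : ℝ), ∑ i ∈ Finset.range n, c i * x ^ i + x ^ n * r x = 0) →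
    ∀ i < n, c i = 0 := by
  induction n with
  | zero => intro c r _ _ i hi; omega
  | succ n ih =>
    intro c r hr h
    have e : ∀ x, ∑ i ∈ Finset.range (n + 1), c i * x ^ i + x ^ (n + 1) * r x
        = c 0 + x * (∑ i ∈ Finset.range n, c (i + 1) * x ^ i + x ^ n * r x) := by
      intro x
      rw [Finset.sum_range_succ', mul_add, Finset.mul_sum]
      have : ∑ i ∈ Finset.range n, c (i + 1) * x ^ (i + 1)
          = ∑ i ∈ Finset.range n, x * (c (i + 1) * x ^ i) :=
        Finset.sum_congr rfl fun i _ => by ring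
      rw [this]; ring
    simp only [e] at h
    have hc : Continuous fun x =>
        c 0 + x * (∑ i ∈ Finset.range n, c (i + 1) * x ^ i + x ^ n * r x) := by fun_prop
    have h0 : c 0 = 0 := by
      have hcl : IsClosed {x | c 0 + x * (∑ i ∈ Finset.range n, c (i + 1) * x ^ i + x ^ n * r x) = 0} :=
        isClosed_eq hc continuous_const
      have := hcl.mem_of_frequently_of_tendsto h (tendsto_id.mono_left nhdsWithin_le_nhds)
      simpa using this
    -- With the constant term gone, one factor `x` cancels off the origin and the expansion is
    -- shorter by one term.
    have h' := h.and_eventually (self_mem_nhdsWithin)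
    have ih' := ih (c := fun i => c (i + 1)) hr (h'.mono fun x hx => by
      have := hx.1
      rw [h0, zero_add] at this
      exact (mul_eq_zero.1 this).resolve_left hx.2)
    intro i hi
    rcases i with _ | i
    · exact h0
    · exact ih' i (by omega)

namespace SingularBlock

variable {D : SingularBlock} {X : Fin 3 → D.Jet} {q : (ℕ → ℝ) × (ℝ → ℝ)}

/-- Vanishing of the coefficients is all that the Fredholm argument asks for: the remainder is
determined by them. -/
lemma coeff_eq_zero (Y : D.Jet) (h : ∃ᶠ x in 𝓝[≠] (0 : ℝ), D.U Y x = 0) : Y.1 = 0 := by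
  have key := coeff_eq_zero_of_frequently (D.m + 1)
    (c := fun i => if hi : i < D.m + 1 then Y.1 ⟨i, hi⟩ else 0)
    (r := rayAvg (D.m + 1) (D.J.ext Y.2))
    (continuous_rayAvg D.one_le_m_succ (D.J.continuous_ext _)) (h.mono fun x hx => by
      rw [← hx, U, Finset.sum_range]
      congr 1
      refine Finset.sum_congr rfl fun i _ => ?_
      rw [dif_pos i.2])
  funext i
  have := key i i.2
  rwa [dif_pos i.2] at this

lemma contDiffOn_avg1 {w : D.J.Fn} (hw : ContDiffOn ℝ ∞ (D.J.ext w) D.J.set) :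
    ContDiffOn ℝ ∞ (rayAvg (D.m + 1) (D.J.ext w)) D.J.set :=
  contDiffOn_rayAvg D.J.lt D.J.lo_nonpos D.J.hi_nonneg D.one_le_m_succ hw

lemma contDiffOn_U {Y : D.Jet} (hw : ContDiffOn ℝ ∞ (D.J.ext Y.2) D.J.set) :
    ContDiffOn ℝ ∞ (D.U Y) D.J.set := by
  have h1 : ContDiffOn ℝ ∞ (fun x => ∑ i, Y.1 i * x ^ (i : ℕ)) D.J.set := by fun_prop
  have h2 : ContDiffOn ℝ ∞ (fun x : ℝ => x ^ (D.m + 1)) D.J.set := by fun_prop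
  exact h1.add (h2.mul (contDiffOn_avg1 hw))

/-- Solutions of the jet equations with smooth data are smooth. -/
theorem JetEq.smooth (h : D.JetEq X q) (hq : ContDiffOn ℝ ∞ q.2 D.J.set)
    (hm : |D.β 0 0| + 1 ≤ D.m)
    (hX : ∀ l, l ≠ 0 → ContDiffOn ℝ ∞ (D.J.ext (X l).2) D.J.set) :
    ContDiffOn ℝ ∞ (D.J.ext (X 0).2) D.J.set := by
  have hm2 : (2 : ℝ) ≤ D.m := by exact_mod_cast D.two_le
  -- The bound `hm` serves to make `m + β₀(0)` an admissible weight.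
  have hκ : (1 : ℝ) ≤ D.m + D.β 0 0 := by linarith [neg_abs_le (D.β 0 0)]
  obtain ⟨b, hb, hb'⟩ := exists_hadamard D.J.lt D.J.lo_nonpos D.J.hi_nonneg (D.smooth_β 0)
  set Φ := D.J.ext (D.remSrc X q) with hΦ
  have hΦc : Continuous Φ := D.J.continuous_ext _
  set W := rayAvg D.m Φ with hW
  have hWc : Continuous W := continuous_rayAvg D.one_le_m hΦc
  have hWX : ∀ x ∈ D.J.set, D.J.ext (X 0).2 x = W x := fun x hx => h.ext_rem hx
  -- The term `β₀(0) w` gives no gain of regularity, so it is moved to the left of `x w' + m w = Φ`;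
  -- this shifts the weight from `m` to `m + β₀(0)`.
  have hWd : ∀ x, W x = rayAvg (D.m + D.β 0 0) (fun x => Φ x + D.β 0 0 * W x) x := by
    refine eq_rayAvg_of_hasDerivAt hκ hWc (w' := fun x => (Φ x - D.m * W x) / x)
      (fun x hx => hasDerivAt_rayAvg_of_ne hm2 hΦc hx)
      (hΦc.add (continuous_const.mul hWc)) fun x => ?_
    rcases eq_or_ne x 0 with rfl | hx
    · have : W 0 = Φ 0 / D.m := by
        simp only [hW, rayAvg, mul_zero]
        rw [intervalIntegral.integral_mul_const, integral_rpow_sub_one D.one_le_m]; ring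
      have hm0 : (D.m : ℝ) ≠ 0 := by linarith
      simp only [zero_mul, zero_add, this]
      field_simp
    · field_simp
      ring
  -- the smooth part of the source
  set G : ℝ → ℝ := fun x => q.2 x
    - ∑ l, ((if l = 0 then 0 else D.β l x * D.J.ext (X l).2 x
        + x * D.γ l x * rayAvg (D.m + 1) (D.J.ext (X l).2) x)
      + ∑ i, (X l).1 i * (D.taylor (D.mono i l)).2 x) with hG
  have hGs : ContDiffOn ℝ ∞ G D.J.set := by
    refine hq.sub (ContDiffOn.sum fun l _ => ContDiffOn.add ?_
      (ContDiffOn.sum fun i _ => contDiffOn_const.mul (D.taylor_smooth (D.smooth_mono i l))))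
    by_cases hl : l = 0
    · simp only [hl, if_true]; exact contDiffOn_const
    · simp only [hl, if_false]
      exact ((D.smooth_β l).mul (hX l hl)).add
        ((contDiffOn_id.mul (D.smooth_γ l)).mul (contDiffOn_avg1 (hX l hl)))
  set w := D.J.ext (X 0).2 with hw
  -- By Hadamard's lemma `β₀ = β₀(0) + x b`, so every remaining occurrence of the unknown `w`
  -- carries a factor `x`.
  have hΦG : ∀ x ∈ D.J.set, Φ x + D.β 0 0 * W x
      = G x + (-1) * (x * (b x * w x + D.γ 0 x * rayAvg (D.m + 1) w x)) := by
    intro x hx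
    rw [hΦ, ext_remSrc hq.continuousOn hx, hG, ← hWX x hx]
    simp only [Fin.sum_univ_three, Fin.isValue, if_true, one_ne_zero, if_false,
      show ¬ ((2 : Fin 3) = 0) by decide, hb' x hx, ← hw]
    ring
  refine contDiffOn_infty.2 fun k => ?_
  induction k with
  | zero => exact contDiffOn_zero.2 (D.J.continuous_ext _).continuousOn
  | succ k ih =>
    -- If `w` is `C^k` then so is the bracket multiplied by `x`, and the average of `x` times a
    -- `C^k` function is `C^(k+1)`.
    have hw1 : ContDiffOn ℝ k (fun x => b x * w x + D.γ 0 x * rayAvg (D.m + 1) w x) D.J.set := by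
      refine ((contDiffOn_infty.1 hb k).mul ih).add ((contDiffOn_infty.1 (D.smooth_γ 0) k).mul ?_)
      obtain ⟨F, hF, hFe⟩ := exists_contDiff_extension D.J.lt k ih
      exact (contDiff_rayAvg k D.one_le_m_succ hF).contDiffOn.congr fun x hx =>
        rayAvg_congr fun s hs => (hFe (D.J.mul_mem hs hx)).symm
    obtain ⟨F, hF, hFe⟩ := exists_contDiff_extension D.J.lt k hw1
    obtain ⟨H, hH, hHe⟩ := exists_contDiff_extension D.J.lt (k + 1) (contDiffOn_infty.1 hGs (k + 1))
    have hfin : ContDiff ℝ ((k + 1 : ℕ) : WithTop ℕ∞) (fun x => rayAvg (D.m + D.β 0 0) H x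
        + (-1) * (x * rayAvg (D.m + D.β 0 0 + 1) F x)) := by
      refine (contDiff_rayAvg (k + 1) hκ hH).add (contDiff_const.mul ?_)
      exact_mod_cast contDiff_mul_rayAvg k hκ hF
    refine hfin.contDiffOn.congr fun x hx => ?_
    have hc : Continuous fun x => (-1) * (x * F x) :=
      continuous_const.mul (continuous_id.mul hF.continuous)
    rw [hWX x hx, hWd x, ← rayAvg_mul_self, ← rayAvg_const_mul, ← rayAvg_add hκ hH.continuous hc]
    refine rayAvg_congr fun s hs => ?_
    have hm' := D.J.mul_mem hs hx
    simp only [hΦG _ hm']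
    rw [hHe hm', hFe hm']

end SingularBlock

end WaveBlowup

end

noncomputable section

namespace WaveBlowup

open Set Filter Topology

/-! ### Convergent power series with values in a normed space -/

section Series

variable {V W : Type*} [NormedAddCommGroup V] [NormedSpace ℝ V] [NormedAddCommGroup W]
  [NormedSpace ℝ W]

/-- `X ε = ∑ εⁿ aₙ` for small `ε`. -/
def HasSeries (X : ℝ → V) (a : ℕ → V) : Prop :=
  ∀ᶠ z in 𝓝 (0 : ℝ), HasSum (fun n => z ^ n • a n) (X z)

lemma HasSeries.add {X Y : ℝ → V} {a b : ℕ → V} (hX : HasSeries X a) (hY : HasSeries Y b) :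
    HasSeries (fun z => X z + Y z) (fun n => a n + b n) := by
  filter_upwards [hX, hY] with z h1 h2
  simpa only [smul_add] using h1.add h2

lemma HasSeries.sum {α : Type*} (s : Finset α) {X : α → ℝ → V} {a : α → ℕ → V}
    (h : ∀ i ∈ s, HasSeries (X i) (a i)) :
    HasSeries (fun z => ∑ i ∈ s, X i z) (fun n => ∑ i ∈ s, a i n) := by
  have : ∀ᶠ z in 𝓝 (0 : ℝ), ∀ i ∈ s, HasSum (fun n => z ^ n • a i n) (X i z) :=
    (eventually_all_finset s).2 h
  filter_upwards [this] with z hz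
  simpa only [Finset.smul_sum] using hasSum_sum hz

lemma HasSeries.map (T : V →L[ℝ] W) {X : ℝ → V} {a : ℕ → V} (hX : HasSeries X a) :
    HasSeries (fun z => T (X z)) (fun n => T (a n)) := by
  filter_upwards [hX] with z h
  simpa using h.mapL T

/-- The sequence delayed by `l` steps. -/
def delay {V : Type*} [Zero V] (a : ℕ → V) (l n : ℕ) : V := if l ≤ n then a (n - l) else 0

lemma delay_single {V : Type*} [Zero V] (y : V) (N n : ℕ) :
    delay (fun n => if n = 0 then y else 0) N n = if n = N then y else 0 := by
  unfold delay
  rcases lt_trichotomy n N with h | h | h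
  · rw [if_neg (by omega), if_neg (by omega)]
  · subst h; simp
  · rw [if_pos h.le]
    simp only [show n - N ≠ 0 by omega, h.ne', if_false]

lemma HasSeries.pow_smul {X : ℝ → V} {a : ℕ → V} (hX : HasSeries X a) (l : ℕ) :
    HasSeries (fun z => z ^ l • X z) (delay a l) := by
  filter_upwards [hX] with z h
  rw [← hasSum_nat_add_iff' l]
  have h0 : ∑ i ∈ Finset.range l, z ^ i • delay a l i = 0 :=
    Finset.sum_eq_zero fun i hi => by
      rw [delay, if_neg (by simpa using Finset.mem_range.1 hi), smul_zero]
  rw [h0, sub_zero]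
  convert h.const_smul (z ^ l) using 2 with n
  rw [delay, if_pos (Nat.le_add_left l n), Nat.add_sub_cancel, pow_add, smul_smul, mul_comm]

lemma HasSeries.const (y : V) : HasSeries (fun _ => y) (fun n => if n = 0 then y else 0) := by
  refine Eventually.of_forall fun z => ?_
  convert hasSum_single 0 (fun n hn => ?_) using 1
  · simp
  · simp [hn]

lemma HasSeries.unique {X Y : ℝ → V} {a b : ℕ → V} (hX : HasSeries X a) (hY : HasSeries Y b)
    (h : X =ᶠ[𝓝 0] Y) : a = b := by
  have key : ∀ {X : ℝ → V} {a : ℕ → V}, HasSeries X a → HasFPowerSeriesAt X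
      (fun n => ContinuousMultilinearMap.mkPiRing ℝ (Fin n) (a n)) 0 := by
    intro X a hX
    refine hasFPowerSeriesAt_iff.2 ?_
    filter_upwards [hX] with z hz
    simpa [FormalMultilinearSeries.coeff] using hz
  have := (key hX).eq_formalMultilinearSeries ((key hY).congr h.symm)
  funext n
  have h2 := congrFun this n
  have h3 := congrArg (fun M => M fun _ => (1 : ℝ)) h2
  simpa using h3

lemma AnalyticAt.exists_hasSeries {X : ℝ → V} (h : AnalyticAt ℝ X 0) : ∃ a, HasSeries X a := by
  obtain ⟨p, hp⟩ := h
  refine ⟨p.coeff, ?_⟩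
  filter_upwards [hasFPowerSeriesAt_iff.1 hp] with z hz
  simpa using hz

end Series

/-! ### Quadratic pencils of operators which are a small perturbation of the identity up to a
finite number of dimensions -/

/-- The quadratic pencil `A₀ + ε A₁ + ε² A₂`. -/
def pencil {V : Type*} [AddCommGroup V] [Module ℝ V] (A : Fin 3 → V) (ε : ℝ) : V :=
  ∑ l : Fin 3, ε ^ (l : ℕ) • A l

lemma analyticAt_pencil {V : Type*} [NormedAddCommGroup V] [NormedSpace ℝ V] (A : Fin 3 → V)
    (ε : ℝ) : AnalyticAt ℝ (pencil A) ε := by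
  unfold pencil
  refine Finset.analyticAt_fun_sum _ fun l _ => ?_
  exact (analyticAt_id.pow (l : ℕ)).smul analyticAt_const

lemma analyticAt_clm_apply {V W : Type*} [NormedAddCommGroup V] [NormedSpace ℝ V]
    [NormedAddCommGroup W] [NormedSpace ℝ W] {T : ℝ → V →L[ℝ] W} {X : ℝ → V} {z : ℝ}
    (hT : AnalyticAt ℝ T z) (hX : AnalyticAt ℝ X z) : AnalyticAt ℝ (fun ε => T ε (X ε)) z :=
  ((ContinuousLinearMap.id ℝ (V →L[ℝ] W)).analyticAt_bilinear (T z, X z)).comp₂ hT hX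

lemma analyticAt_det {ι : Type*} [Fintype ι] [DecidableEq ι] {S : ℝ → Matrix ι ι ℝ} {z : ℝ}
    (h : ∀ i j, AnalyticAt ℝ (fun ε => S ε i j) z) : AnalyticAt ℝ (fun ε => (S ε).det) z := by
  simp only [Matrix.det_apply']
  refine Finset.analyticAt_fun_sum _ fun σ _ => ?_
  exact analyticAt_const.mul (Finset.analyticAt_fun_prod _ fun i _ => h _ _)

lemma analyticAt_adjugate {ι : Type*} [Fintype ι] [DecidableEq ι] {S : ℝ → Matrix ι ι ℝ} {z : ℝ}
    (h : ∀ i j, AnalyticAt ℝ (fun ε => S ε i j) z) (i j : ι) :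
    AnalyticAt ℝ (fun ε => (S ε).adjugate i j) z := by
  simp only [Matrix.adjugate_apply]
  refine analyticAt_det fun k l => ?_
  by_cases hk : k = j
  · subst hk
    simp only [Matrix.updateRow_self]
    exact analyticAt_const
  · simp only [Matrix.updateRow_ne hk]
    exact h k l

section Fredholm

variable {ι E : Type*} [Fintype ι] [DecidableEq ι] [NormedAddCommGroup E] [NormedSpace ℝ E]
  [CompleteSpace E]

/-- Analytic Fredholm alternative for a pencil in block form, the block acting on the Banach
space being a small perturbation of the identity. If the pencil is injective somewhere, then at
`ε = 0` it can be inverted up to a power of `ε`. -/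
theorem exists_chain_of_injective (M : Fin 3 → Matrix ι ι ℝ) (B : Fin 3 → ι → E →L[ℝ] ℝ)
    (C : Fin 3 → ι → E) (K : Fin 3 → E →L[ℝ] E) {L ε₀ : ℝ} (hL : 0 < L) (hε₀ : |ε₀| < L)
    (hK : ∀ ε, |ε| < L → ‖pencil K ε‖ < 1)
    (hinj : ∀ (ξ : ι → ℝ) (w : E),
      (∀ i, ∑ l : Fin 3, ε₀ ^ (l : ℕ) * (∑ j, M l i j * ξ j + B l i w) = 0) →
      w + ∑ l : Fin 3, ε₀ ^ (l : ℕ) • (K l w + ∑ j, ξ j • C l j) = 0 → ξ = 0)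
    (f : ι → ℝ) (e : E) :
    ∃ (N : ℕ) (Ξ : ℕ → ι → ℝ) (W : ℕ → E), ∀ n,
      (∀ i, ∑ l : Fin 3, (∑ j, M l i j * delay Ξ l n j + B l i (delay W l n))
        = if n = N then f i else 0) ∧
      W n + ∑ l : Fin 3, (K l (delay W l n) + ∑ j, delay Ξ l n j • C l j)
        = if n = N then e else 0 := by
  -- The Banach space block is invertible for all `|ε| < L` by the Neumann series, with an analytic
  -- inverse. Eliminating `w` leaves the finite matrix `S`, the Schur complement.
  set A : ℝ → E →L[ℝ] E := fun ε => Ring.inverse (1 + pencil K ε) with hA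
  have hunit : ∀ ε, |ε| < L → IsUnit (1 + pencil K ε) := fun ε hε => by
    have := isUnit_one_sub_of_norm_lt_one (x := -pencil K ε) (by rw [norm_neg]; exact hK ε hε)
    rwa [sub_neg_eq_add] at this
  have hAan : ∀ ε, |ε| < L → AnalyticAt ℝ A ε := fun ε hε => by
    obtain ⟨u, hu⟩ := hunit ε hε
    have h1 : AnalyticAt ℝ (fun ε => 1 + pencil K ε) ε := analyticAt_const.add (analyticAt_pencil K ε)
    have h2 := analyticAt_inverse (𝕜 := ℝ) u
    rw [hu] at h2
    exact AnalyticAt.fun_comp h2 h1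
  have hA1 : ∀ ε, |ε| < L → ∀ x, A ε x + pencil K ε (A ε x) = x := fun ε hε x => by
    have := congrArg (fun T : E →L[ℝ] E => T x) (Ring.mul_inverse_cancel _ (hunit ε hε))
    simpa using this
  have happ : ∀ ε (w : E), pencil K ε w = ∑ l : Fin 3, ε ^ (l : ℕ) • K l w := fun ε w => by
    simp [pencil]
  set S : ℝ → Matrix ι ι ℝ := fun ε => Matrix.of fun i j =>
    pencil (fun l => M l i j) ε - pencil (fun l => B l i) ε (A ε (pencil (fun l => C l j) ε))
    with hS
  set F : ℝ → ι → ℝ := fun ε i => f i - pencil (fun l => B l i) ε (A ε e) with hF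
  have hSan : ∀ ε, |ε| < L → ∀ i j, AnalyticAt ℝ (fun ε => S ε i j) ε := fun ε hε i j =>
    (analyticAt_pencil _ ε).sub
      (analyticAt_clm_apply (analyticAt_pencil _ ε) (analyticAt_clm_apply (hAan ε hε) (analyticAt_pencil _ ε)))
  -- the block system in terms of the Schur complement
  have hred : ∀ ε, |ε| < L → ∀ (ξ : ι → ℝ) (c : ℝ), (S ε).mulVec ξ = c • F ε →
      ∀ w, w = A ε (c • e - ∑ j, ξ j • pencil (fun l => C l j) ε) →
      (∀ i, ∑ l : Fin 3, ε ^ (l : ℕ) * (∑ j, M l i j * ξ j + B l i w) = c * f i) ∧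
      w + ∑ l : Fin 3, ε ^ (l : ℕ) • (K l w + ∑ j, ξ j • C l j) = c • e := by
    intro ε hε ξ c hξ w hw
    constructor
    · intro i
      have h1 := congrFun hξ i
      simp only [Matrix.mulVec, dotProduct, hS, Matrix.of_apply, hF, Pi.smul_apply,
        smul_eq_mul, sub_mul, Finset.sum_sub_distrib] at h1
      have h2 : ∑ l : Fin 3, ε ^ (l : ℕ) * (∑ j, M l i j * ξ j + B l i w)
          = ∑ j, pencil (fun l => M l i j) ε * ξ j + pencil (fun l => B l i) ε w := by
        simp only [mul_add, Finset.sum_add_distrib, pencil, Finset.mul_sum, Finset.sum_mul,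
          smul_eq_mul]
        congr 1
        rw [Finset.sum_comm]
        exact Finset.sum_congr rfl fun j _ => Finset.sum_congr rfl fun l _ => by ring
      rw [h2, hw]
      simp only [map_sub, map_smul, map_sum, smul_eq_mul]
      have h3 : ∑ j, ξ j * pencil (fun l => B l i) ε (A ε (pencil (fun l => C l j) ε))
          = ∑ j, pencil (fun l => B l i) ε (A ε (pencil (fun l => C l j) ε)) * ξ j :=
        Finset.sum_congr rfl fun j _ => mul_comm _ _
      rw [h3]
      linear_combination h1
    · have h1 := hA1 ε hε (c • e - ∑ j, ξ j • pencil (fun l => C l j) ε)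
      rw [← hw, happ] at h1
      have h2 : ∑ l : Fin 3, ε ^ (l : ℕ) • (K l w + ∑ j, ξ j • C l j)
          = ∑ l : Fin 3, ε ^ (l : ℕ) • K l w + ∑ j, ξ j • pencil (fun l => C l j) ε := by
        simp only [smul_add, Finset.sum_add_distrib, pencil, Finset.smul_sum]
        congr 1
        rw [Finset.sum_comm]
        exact Finset.sum_congr rfl fun j _ => Finset.sum_congr rfl fun l _ => smul_comm _ _ _
      rw [h2, ← add_assoc, h1]
      abel
  -- A kernel vector of `S ε₀` lifts to a solution of the homogeneous block system, which
  -- injectivity forbids.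
  have hdet₀ : (S ε₀).det ≠ 0 := by
    intro h0
    obtain ⟨ξ, hξ0, hξ⟩ := Matrix.exists_mulVec_eq_zero_iff.2 h0
    obtain ⟨h1, h2⟩ := hred ε₀ hε₀ ξ 0 (by rw [hξ, zero_smul]) _ rfl
    simp only [zero_mul] at h1
    rw [zero_smul ℝ e] at h1 h2
    exact hξ0 (hinj ξ _ h1 h2)
  have hdan : AnalyticOnNhd ℝ (fun ε => (S ε).det) (Ioo (-L) L) := fun ε hε =>
    analyticAt_det (hSan ε (abs_lt.2 hε))
  have h0mem : (0 : ℝ) ∈ Ioo (-L) L := ⟨by linarith, hL⟩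
  -- Identity theorem on the interval `(-L, L)`, which contains both `0` and `ε₀`.
  have hnz : ¬ ∀ᶠ z in 𝓝 (0 : ℝ), (S z).det = 0 := by
    intro h
    exact hdet₀ (hdan.eqOn_zero_of_preconnected_of_eventuallyEq_zero isPreconnected_Ioo h0mem h
      (abs_lt.1 hε₀))
  have h0L : |(0 : ℝ)| < L := by simpa using hL
  obtain ⟨N, h, han, hne, heq⟩ :=
    ((hdan 0 h0mem).exists_eventuallyEq_pow_smul_nonzero_iff).2 hnz
  -- Cramer's rule, with the determinant factored as `ε ^ N * h ε`: dividing only by the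
  -- nonvanishing factor `h` keeps the solution analytic and leaves `ε ^ N` on the right-hand side.
  set ξ : ℝ → ι → ℝ := fun ε i => (h ε)⁻¹ * ∑ j, (S ε).adjugate i j * F ε j with hξ
  have hξan : AnalyticAt ℝ ξ 0 := by
    rw [analyticAt_pi_iff]
    intro i
    refine (han.inv hne).mul (Finset.analyticAt_fun_sum _ fun j _ => ?_)
    exact (analyticAt_adjugate (hSan 0 h0L) i j).mul
      (analyticAt_const.sub (analyticAt_clm_apply (analyticAt_pencil _ 0)
        (analyticAt_clm_apply (hAan 0 h0L) analyticAt_const)))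
  have hξ' : ∀ᶠ ε in 𝓝 (0 : ℝ), (S ε).mulVec (ξ ε) = ε ^ N • F ε := by
    filter_upwards [heq, han.continuousAt.eventually_ne hne] with ε h1 h2
    have e1 : ξ ε = (h ε)⁻¹ • ((S ε).adjugate.mulVec (F ε)) := by
      funext i; simp [hξ, Matrix.mulVec, dotProduct]
    rw [e1, Matrix.mulVec_smul, Matrix.mulVec_mulVec, Matrix.mul_adjugate, h1, sub_zero,
      Matrix.smul_mulVec, Matrix.one_mulVec, smul_smul, smul_eq_mul]
    congr 1
    field_simp
  set w : ℝ → E := fun ε => A ε (ε ^ N • e - ∑ j, ξ ε j • pencil (fun l => C l j) ε) with hw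
  have hwan : AnalyticAt ℝ w 0 := by
    refine analyticAt_clm_apply (hAan 0 h0L) (((analyticAt_id.pow N).smul analyticAt_const).sub
      (Finset.analyticAt_fun_sum _ fun j _ => ?_))
    exact ((analyticAt_pi_iff.1 hξan) j).smul (analyticAt_pencil _ 0)
  obtain ⟨Ξ, hΞ⟩ := AnalyticAt.exists_hasSeries hξan
  obtain ⟨W, hW⟩ := AnalyticAt.exists_hasSeries hwan
  have hsol : ∀ᶠ ε in 𝓝 (0 : ℝ),
      (∀ i, ∑ l : Fin 3, ε ^ (l : ℕ) * (∑ j, M l i j * ξ ε j + B l i (w ε)) = ε ^ N * f i) ∧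
      w ε + ∑ l : Fin 3, ε ^ (l : ℕ) • (K l (w ε) + ∑ j, ξ ε j • C l j) = ε ^ N • e := by
    filter_upwards [hξ', Ioo_mem_nhds h0mem.1 h0mem.2] with ε h1 h2
    exact hred ε (abs_lt.2 h2) (ξ ε) (ε ^ N) h1 (w ε) rfl
  have hproj : ∀ j, HasSeries (fun ε => ξ ε j) (fun n => Ξ n j) := fun j =>
    hΞ.map (ContinuousLinearMap.proj (R := ℝ) (φ := fun _ : ι => ℝ) j)
  refine ⟨N, Ξ, W, fun n => ⟨fun i => ?_, ?_⟩⟩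
  -- Comparison of power series coefficients: multiplication by `ε ^ l` is the delay by `l` steps,
  -- and `ε ^ N f` contributes only at order `N`.
  · have s1 : HasSeries (fun ε => ∑ l : Fin 3,
        ε ^ (l : ℕ) • (∑ j, M l i j * ξ ε j + B l i (w ε)))
        (fun n => ∑ l : Fin 3, delay (fun n => ∑ j, M l i j * Ξ n j + B l i (W n)) l n) := by
      refine HasSeries.sum _ fun l _ => HasSeries.pow_smul (HasSeries.add ?_ (hW.map (B l i))) _
      exact HasSeries.sum _ fun j _ => (hproj j).map (ContinuousLinearMap.mul ℝ ℝ (M l i j))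
    have s2 := (HasSeries.const (f i)).pow_smul N
    have := congrFun (s1.unique s2 (hsol.mono fun ε h => by simpa using h.1 i)) n
    rw [delay_single] at this
    rw [← this]
    refine Finset.sum_congr rfl fun l _ => ?_
    unfold delay
    split_ifs <;> simp
  · have s1 : HasSeries (fun ε => w ε + ∑ l : Fin 3,
        ε ^ (l : ℕ) • (K l (w ε) + ∑ j, ξ ε j • C l j))
        (fun n => W n + ∑ l : Fin 3, delay (fun n => K l (W n) + ∑ j, Ξ n j • C l j) l n) := by
      refine hW.add (HasSeries.sum _ fun l _ => HasSeries.pow_smul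
        (HasSeries.add (hW.map (K l)) ?_) _)
      exact HasSeries.sum _ fun j _ =>
        (hproj j).map (ContinuousLinearMap.smulRight (1 : ℝ →L[ℝ] ℝ) (C l j))
    have s2 := (HasSeries.const e).pow_smul N
    have := congrFun (s1.unique s2 (hsol.mono fun ε h => h.2)) n
    rw [delay_single] at this
    rw [← this]
    congr 1
    refine Finset.sum_congr rfl fun l _ => ?_
    unfold delay
    split_ifs <;> simp

end Fredholm

end WaveBlowup

end

/-! ### Recursive choice, regular linear equations, gluing and the maximum principle -/

noncomputable section

namespace WaveBlowup

open Set MeasureTheory Filter Topology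

/-- Construction of a sequence by strong recursion, from the existence of a next term. -/
lemma exists_seq_of_forall_exists {α : Type*} [Inhabited α] (P : ℕ → (ℕ → α) → α → Prop)
    (hcongr : ∀ n s s' a, (∀ k < n, s k = s' k) → P n s a → P n s' a)
    (hex : ∀ n s, (∀ k < n, P k s (s k)) → ∃ a, P n s a) : ∃ s, ∀ n, P n s (s n) := by
  classical
  -- A junk value is returned when no next term exists; the induction below shows that this never
  -- happens. The history is completed by `default` from `n` on, which `hcongr` makes harmless.
  let F : (n : ℕ) → ((k : ℕ) → k < n → α) → α := fun n prev =>
    if h : ∃ a, P n (fun k => if hk : k < n then prev k hk else default) a then h.choose else default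
  let s : ℕ → α := fun n => Nat.strongRec F n
  have hs : ∀ n, s n = F n fun k _ => s k := fun n => by
    simp only [s]
    rw [Nat.strongRec]
  refine ⟨s, fun n => ?_⟩
  induction n using Nat.strong_induction_on with
  | _ n ih =>
    have hcut : ∀ k < n, s k = if hk : k < n then s k else default := fun k hk => by rw [dif_pos hk]
    obtain ⟨a, ha⟩ := hex n s ih
    have h : ∃ a, P n (fun k => if hk : k < n then s k else default) a :=
      ⟨a, hcongr n s _ a hcut ha⟩
    have e : s n = h.choose := by
      rw [hs n]
      exact dif_pos h
    rw [e]
    exact hcongr n _ s _ (fun k hk => (hcut k hk).symm) h.choose_spec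

/-! ### Regular linear ordinary differential equations -/

open BoundedContinuousFunction in
/-- Global solvability of linear ordinary differential equations. -/
theorem exists_linear_ode {E : Type*} [NormedAddCommGroup E] [NormedSpace ℝ E] [CompleteSpace E]
    {A : ℝ → E →L[ℝ] E} {f : ℝ → E} (hA : Continuous A) (hf : Continuous f) (R : ℝ) (z₀ : E) :
    ∃ z : ℝ → E, z R = z₀ ∧ ∀ x ∈ Ici R, HasDerivWithinAt z (A x (z x) + f x) (Ici R) x := by
  -- Exponentially weighted norm: with `W = exp ∫ K`, the factor `2` in front of `‖A‖` gives the
  -- contraction constant `1 / 2` on the whole half-line, and the term `‖f‖` keeps the weighted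
  -- contribution of the source bounded.
  set K : ℝ → ℝ := fun x => 2 * ‖A x‖ + ‖f x‖ with hK
  have hKc : Continuous K := by fun_prop
  have hK0 : ∀ x, 0 ≤ K x := fun x => by positivity
  set W : ℝ → ℝ := fun x => Real.exp (∫ r in R..x, K r) with hW
  have hWd : ∀ x, HasDerivAt W (K x * W x) x := fun x => by
    have h := (intervalIntegral.integral_hasDerivAt_right (hKc.intervalIntegrable R x)
      (hKc.stronglyMeasurableAtFilter _ _) hKc.continuousAt).exp
    exact h.congr_deriv (mul_comm _ _)
  have hWc : Continuous W := continuous_iff_continuousAt.2 fun x => (hWd x).continuousAt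
  have hWpos : ∀ x, 0 < W x := fun x => Real.exp_pos _
  have hWR : W R = 1 := by simp [hW]
  have hW1 : ∀ x, R ≤ x → 1 ≤ W x := fun x hx =>
    Real.one_le_exp (intervalIntegral.integral_nonneg hx fun r _ => hK0 r)
  have hWint : ∀ x, ∫ r in R..x, K r * W r = W x - 1 := fun x => by
    rw [← hWR]
    exact intervalIntegral.integral_eq_sub_of_hasDerivAt (fun y _ => hWd y)
      ((hKc.mul hWc).intervalIntegrable _ _)
  have hmax : ∀ x : ℝ, R ≤ max x R := fun x => le_max_right _ _
  set I : (ℝ →ᵇ E) → ℝ → E := fun z r => W r • A r (z r) + f r with hI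
  have hIc : ∀ z, Continuous (I z) := fun z =>
    (hWc.smul (hA.clm_apply z.continuous)).add hf
  have hbound : ∀ (g : ℝ → E) (C x : ℝ), Continuous g → (∀ r, R ≤ r → ‖g r‖ ≤ C * (K r * W r)) →
      0 ≤ C → R ≤ x → ‖(W x)⁻¹ • ∫ r in R..x, g r‖ ≤ C := by
    intro g C x hg hgC hC hx
    have h1 : ‖∫ r in R..x, g r‖ ≤ ∫ r in R..x, C * (K r * W r) :=
      intervalIntegral.norm_integral_le_of_norm_le hx
        (Eventually.of_forall fun r hr => hgC r hr.1.le)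
        ((continuous_const.mul (hKc.mul hWc)).intervalIntegrable _ _)
    rw [intervalIntegral.integral_const_mul, hWint] at h1
    rw [norm_smul, norm_inv, Real.norm_of_nonneg (hWpos x).le, inv_mul_le_iff₀ (hWpos x)]
    nlinarith [hWpos x]
  have hInorm : ∀ (z : ℝ →ᵇ E) r, R ≤ r → ‖I z r‖ ≤ (‖z‖ + 1) * (K r * W r) := by
    intro z r hr
    have h1 : ‖A r (z r)‖ ≤ ‖A r‖ * ‖z‖ := (A r).le_of_opNorm_le_of_le le_rfl (z.norm_coe_le_norm r)
    have h2 : ‖I z r‖ ≤ W r * (‖A r‖ * ‖z‖) + ‖f r‖ := by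
      refine (norm_add_le _ _).trans (add_le_add_left ?_ _)
      rw [norm_smul, Real.norm_of_nonneg (hWpos r).le]
      exact mul_le_mul_of_nonneg_left h1 (hWpos r).le
    have h3 := hW1 r hr
    have h4 : ‖f r‖ ≤ ‖f r‖ * W r := le_mul_of_one_le_right (norm_nonneg _) h3
    have e : (‖z‖ + 1) * (K r * W r) = W r * (‖A r‖ * ‖z‖) + ‖f r‖ * W r
        + (W r * (‖A r‖ * ‖z‖) + 2 * (‖A r‖ * W r) + ‖z‖ * (‖f r‖ * W r)) := by
      simp only [hK]; ring
    have := hWpos r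
    have h5 : 0 ≤ W r * (‖A r‖ * ‖z‖) + 2 * (‖A r‖ * W r) + ‖z‖ * (‖f r‖ * W r) := by positivity
    linarith
  -- Integral equation for the solution divided by `W`. The clamp `max x R` makes it a map on
  -- bounded functions of the whole line.
  set T : (ℝ →ᵇ E) → ℝ → E := fun z x =>
    (W (max x R))⁻¹ • (z₀ + ∫ r in R..(max x R), I z r) with hT
  have hTc : ∀ z, Continuous (T z) := fun z => by
    have h1 : Continuous fun x : ℝ => max x R := by fun_prop
    have h2 : Continuous fun x => ∫ r in R..x, I z r :=
      intervalIntegral.continuous_primitive (fun a b => (hIc z).intervalIntegrable a b) R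
    exact ((hWc.comp h1).inv₀ fun x => (hWpos _).ne').smul (continuous_const.add (h2.comp h1))
  have hTb : ∀ z x, ‖T z x‖ ≤ ‖z₀‖ + (‖z‖ + 1) := fun z x => by
    rw [hT]
    simp only [smul_add]
    refine (norm_add_le _ _).trans (add_le_add ?_ ?_)
    · rw [norm_smul, norm_inv, Real.norm_of_nonneg (hWpos _).le]
      exact mul_le_of_le_one_left (norm_nonneg _) (inv_le_one_of_one_le₀ (hW1 _ (hmax x)))
    · exact hbound _ _ _ (hIc z) (hInorm z) (by positivity) (hmax x)
  set Φ : (ℝ →ᵇ E) → (ℝ →ᵇ E) := fun z => ofNormedAddCommGroup (T z) (hTc z) _ (hTb z) with hΦ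
  have hcontr : ContractingWith (1 / 2) Φ := by
    refine ⟨by rw [← NNReal.coe_lt_coe]; norm_num, LipschitzWith.of_dist_le_mul fun z z' => ?_⟩
    refine (dist_le (by positivity)).2 fun x => ?_
    have e : Φ z x - Φ z' x
        = (W (max x R))⁻¹ • ∫ r in R..(max x R), (I z r - I z' r) := by
      rw [intervalIntegral.integral_sub ((hIc z).intervalIntegrable _ _)
        ((hIc z').intervalIntegrable _ _)]
      simp only [hΦ, hT, coe_ofNormedAddCommGroup]
      rw [← smul_sub]
      congr 1
      abel
    rw [dist_eq_norm, e]
    refine (hbound _ (1 / 2 * dist z z') _ ((hIc z).sub (hIc z')) (fun r _ => ?_)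
      (by positivity) (hmax x)).trans (by simp)
    have e2 : I z r - I z' r = W r • A r (z r - z' r) := by
      simp only [hI, map_sub, smul_sub]; abel
    have h1 : ‖A r (z r - z' r)‖ ≤ ‖A r‖ * dist z z' :=
      (A r).le_of_opNorm_le_of_le le_rfl (by
        rw [← dist_eq_norm]; exact dist_coe_le_dist r)
    rw [Pi.sub_apply, e2, norm_smul, Real.norm_of_nonneg (hWpos r).le]
    have h2 := mul_le_mul_of_nonneg_left h1 (hWpos r).le
    refine h2.trans ?_
    have e3 : 1 / 2 * dist z z' * (K r * W r)
        = W r * (‖A r‖ * dist z z') + 1 / 2 * dist z z' * (‖f r‖ * W r) := by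
      simp only [hK]; ring
    rw [e3]
    have := hWpos r
    have : 0 ≤ 1 / 2 * dist z z' * (‖f r‖ * W r) := by positivity
    linarith
  set z := hcontr.fixedPoint with hz
  have hfix : ∀ x, R ≤ x → W x • z x = z₀ + ∫ r in R..x, I z r := fun x hx => by
    have h1 : Φ z = z := hcontr.fixedPoint_isFixedPt
    have h2 : T z x = z x := congrArg (fun y : ℝ →ᵇ E => y x) h1
    rw [← h2, hT]
    simp only [max_eq_left hx, smul_smul]
    rw [mul_inv_cancel₀ (hWpos x).ne', one_smul]
  refine ⟨fun x => W x • z x, ?_, fun x hx => ?_⟩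
  · simp [hfix R le_rfl]
  · have h1 : HasDerivAt (fun x => z₀ + ∫ r in R..x, I z r) (I z x) x :=
      (intervalIntegral.integral_hasDerivAt_right ((hIc z).intervalIntegrable R x)
        ((hIc z).stronglyMeasurableAtFilter _ _) (hIc z).continuousAt).const_add _
    have h2 : I z x = A x (W x • z x) + f x := by simp only [hI, map_smul]
    rw [← h2]
    exact h1.hasDerivWithinAt.congr (fun y hy => hfix y hy) (hfix x hx)

/-! ### Solutions of second order equations on subsets of the line -/

/-- `v` and `v'` are the first and second derivative of `u` within `S`. -/
def IsJet (S : Set ℝ) (u v v' : ℝ → ℝ) : Prop :=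
  ∀ x ∈ S, HasDerivWithinAt u (v x) S x ∧ HasDerivWithinAt v (v' x) S x

lemma IsJet.mono {S S' : Set ℝ} {u v v' : ℝ → ℝ} (h : IsJet S u v v') (hS : S' ⊆ S) :
    IsJet S' u v v' := fun x hx => ⟨(h x (hS hx)).1.mono hS, (h x (hS hx)).2.mono hS⟩

/-- Concatenation of two functions at `c`. -/
def glue (c : ℝ) (f g : ℝ → ℝ) (x : ℝ) : ℝ := if x ≤ c then f x else g x

lemma glue_of_le {c : ℝ} {f g : ℝ → ℝ} {x : ℝ} (h : x ≤ c) : glue c f g x = f x := if_pos h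

lemma glue_of_ge {c : ℝ} {f g : ℝ → ℝ} {x : ℝ} (h : c ≤ x) (hc : f c = g c) :
    glue c f g x = g x := by
  rcases h.eq_or_lt with rfl | h
  · rw [glue_of_le le_rfl, hc]
  · exact if_neg h.not_ge

/-- On the half that does not contain `x` there is nothing to prove, since `x` is not in its
closure; at `x = c` both one-sided derivatives are used. -/
lemma hasDerivWithinAt_glue {S : Set ℝ} {c : ℝ} {f g f' g' : ℝ → ℝ}
    (hf : ∀ x ∈ S ∩ Iic c, HasDerivWithinAt f (f' x) (S ∩ Iic c) x)
    (hg : ∀ x ∈ S ∩ Ici c, HasDerivWithinAt g (g' x) (S ∩ Ici c) x)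
    (h0 : f c = g c) (h1 : f' c = g' c) {x : ℝ} (hx : x ∈ S) :
    HasDerivWithinAt (glue c f g) (glue c f' g' x) S x := by
  have hS : S = (S ∩ Iic c) ∪ (S ∩ Ici c) := by
    rw [← inter_union_distrib_left, Iic_union_Ici, inter_univ]
  rw [hS]
  refine HasDerivWithinAt.union ?_ ?_
  · rcases le_or_gt x c with h | h
    · rw [glue_of_le h]
      exact (hf x ⟨hx, h⟩).congr (fun y hy => glue_of_le hy.2) (glue_of_le h)
    · refine HasFDerivWithinAt.of_notMem_closure fun hcl => ?_
      exact h.not_ge (closure_minimal inter_subset_right isClosed_Iic hcl)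
  · rcases le_or_gt c x with h | h
    · rw [glue_of_ge h h1]
      exact (hg x ⟨hx, h⟩).congr (fun y hy => glue_of_ge hy.2 h0) (glue_of_ge h h0)
    · refine HasFDerivWithinAt.of_notMem_closure fun hcl => ?_
      exact h.not_ge (closure_minimal inter_subset_right isClosed_Ici hcl)

lemma IsJet.glue {S : Set ℝ} {c : ℝ} {u₁ v₁ v₁' u₂ v₂ v₂' : ℝ → ℝ}
    (h₁ : IsJet (S ∩ Iic c) u₁ v₁ v₁') (h₂ : IsJet (S ∩ Ici c) u₂ v₂ v₂')
    (hu : u₁ c = u₂ c) (hv : v₁ c = v₂ c) (hv' : v₁' c = v₂' c) :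
    IsJet S (glue c u₁ u₂) (glue c v₁ v₂) (glue c v₁' v₂') := fun _ hx =>
  ⟨hasDerivWithinAt_glue (fun x hx => (h₁ x hx).1) (fun x hx => (h₂ x hx).1) hu hv hx,
    hasDerivWithinAt_glue (fun x hx => (h₁ x hx).2) (fun x hx => (h₂ x hx).2) hv hv' hx⟩

lemma contDiffOn_succ_of_hasDerivWithinAt {S : Set ℝ} (hS : UniqueDiffOn ℝ S) {n : ℕ}
    {f f' : ℝ → ℝ} (hf : ∀ x ∈ S, HasDerivWithinAt f (f' x) S x) (hf' : ContDiffOn ℝ n f' S) :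
    ContDiffOn ℝ (n + 1) f S := by
  rw [contDiffOn_succ_iff_derivWithin hS]
  refine ⟨fun x hx => (hf x hx).differentiableWithinAt, by simp, ?_⟩
  exact hf'.congr fun x hx => (hf x hx).derivWithin (hS x hx)

/-- Solutions of regular second order equations with smooth coefficients are smooth. -/
lemma IsJet.contDiffOn {S : Set ℝ} (hS : UniqueDiffOn ℝ S) {u v v' α b c F : ℝ → ℝ}
    (h : IsJet S u v v') (hα : ContDiffOn ℝ ∞ α S) (hb : ContDiffOn ℝ ∞ b S)
    (hc : ContDiffOn ℝ ∞ c S) (hF : ContDiffOn ℝ ∞ F S) (hα0 : ∀ x ∈ S, α x ≠ 0)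
    (heq : ∀ x ∈ S, α x * v' x + b x * v x + c x * u x = F x) : ContDiffOn ℝ ∞ u S := by
  have key : ∀ n : ℕ, ContDiffOn ℝ n u S ∧ ContDiffOn ℝ n v S := by
    intro n
    induction n with
    | zero =>
      exact ⟨contDiffOn_zero.2 fun x hx => (h x hx).1.continuousWithinAt,
        contDiffOn_zero.2 fun x hx => (h x hx).2.continuousWithinAt⟩
    | succ n ih =>
      have h' : ContDiffOn ℝ n v' S := by
        have : ContDiffOn ℝ n (fun x => (F x - b x * v x - c x * u x) / α x) S :=
          (((contDiffOn_infty.1 hF n).sub ((contDiffOn_infty.1 hb n).mul ih.2)).sub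
            ((contDiffOn_infty.1 hc n).mul ih.1)).div (contDiffOn_infty.1 hα n) hα0
        refine this.congr fun x hx => ?_
        rw [← heq x hx, eq_div_iff (hα0 x hx)]
        ring
      exact ⟨by exact_mod_cast contDiffOn_succ_of_hasDerivWithinAt hS (fun x hx => (h x hx).1) ih.2,
        by exact_mod_cast contDiffOn_succ_of_hasDerivWithinAt hS (fun x hx => (h x hx).2) h'⟩
  exact contDiffOn_infty.2 fun n => (key n).1

/-- Continuation of solutions of regular second order equations. -/
lemma exists_isJet_Ici {R u₀ v₀ : ℝ} {α b c F : ℝ → ℝ} (hα : ContinuousOn α (Ici R))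
    (hb : ContinuousOn b (Ici R)) (hc : ContinuousOn c (Ici R)) (hF : ContinuousOn F (Ici R))
    (hα0 : ∀ x ∈ Ici R, α x ≠ 0) :
    ∃ u v v' : ℝ → ℝ, IsJet (Ici R) u v v' ∧ u R = u₀ ∧ v R = v₀ ∧
      ∀ x ∈ Ici R, α x * v' x + b x * v x + c x * u x = F x := by
  -- The coefficients are continued by constants to the left of `R`, so that the system for `(u,
  -- u')` has coefficients continuous on the line.
  have hcont : ∀ {f : ℝ → ℝ}, ContinuousOn f (Ici R) → Continuous fun x => f (max x R) :=
    fun {f} hf => hf.comp_continuous (by fun_prop) fun x => mem_Ici.2 (le_max_right _ _)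
  have hp := hcont (hb.div hα hα0)
  have hq := hcont (hc.div hα hα0)
  have hf := hcont (hF.div hα hα0)
  set p := fun x => b x / α x
  set q := fun x => c x / α x
  set f := fun x => F x / α x
  let A : ℝ → (ℝ × ℝ) →L[ℝ] (ℝ × ℝ) := fun x =>
    (ContinuousLinearMap.inl ℝ ℝ ℝ).comp (ContinuousLinearMap.snd ℝ ℝ ℝ)
      - q (max x R) • (ContinuousLinearMap.inr ℝ ℝ ℝ).comp (ContinuousLinearMap.fst ℝ ℝ ℝ)
      - p (max x R) • (ContinuousLinearMap.inr ℝ ℝ ℝ).comp (ContinuousLinearMap.snd ℝ ℝ ℝ)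
  have hA : Continuous A :=
    (continuous_const.sub (hq.smul continuous_const)).sub (hp.smul continuous_const)
  obtain ⟨z, hz0, hz⟩ := exists_linear_ode hA (f := fun x => ((0 : ℝ), f (max x R)))
    (continuous_const.prodMk hf) R (u₀, v₀)
  refine ⟨fun x => (z x).1, fun x => (z x).2, fun x => f x - (q x * (z x).1 + p x * (z x).2),
    fun x hx => ?_, by simp [hz0], by simp [hz0], fun x hx => ?_⟩
  · have h := hz x hx
    have hx' : max x R = x := max_eq_left hx
    constructor
    · refine ((ContinuousLinearMap.fst ℝ ℝ ℝ).hasFDerivAt.comp_hasDerivWithinAt x h).congr_deriv ?_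
      simp [A]
    · refine ((ContinuousLinearMap.snd ℝ ℝ ℝ).hasFDerivAt.comp_hasDerivWithinAt x h).congr_deriv ?_
      simp [A, hx']
      ring
  · have := hα0 x hx
    simp only [f, p, q]
    field_simp
    ring

/-- The maximum principle for equations degenerating at both endpoints. -/
theorem IsJet.le_zero {y₁ : ℝ} (hy₁ : 0 < y₁) {u v v' α b c : ℝ → ℝ}
    (h : IsJet (Icc 0 y₁) u v v') (hα : ∀ x ∈ Ioo 0 y₁, 0 < α x) (hα0 : α 0 = 0) (hα1 : α y₁ = 0)
    (hb0 : 0 ≤ b 0) (hb1 : b y₁ ≤ 0) (hc : ∀ x ∈ Icc 0 y₁, c x < 0)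
    (heq : ∀ x ∈ Icc 0 y₁, α x * v' x + b x * v x + c x * u x = 0) :
    ∀ x ∈ Icc 0 y₁, u x ≤ 0 := by
  have hcont : ContinuousOn u (Icc 0 y₁) := fun x hx => (h x hx).1.continuousWithinAt
  obtain ⟨x, hx, hmax⟩ := isCompact_Icc.exists_isMaxOn (nonempty_Icc.2 hy₁.le) hcont
  suffices hux : u x ≤ 0 from fun y hy => (hmax hy).trans hux
  -- At a positive maximum the term `c u` is strictly negative, so the other two would have to add
  -- up to something positive. At an endpoint `α` vanishes and the signs of `b` and of the one-sided
  -- derivative are opposed; inside, `u' = 0` and `u''` would have to be positive.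
  by_contra! hpos
  have hcu : c x * u x < 0 := mul_neg_of_neg_of_pos (hc x hx) hpos
  have he := heq x hx
  rcases hx.1.eq_or_lt with rfl | hx0
  · have hv : v 0 ≤ 0 := by
      have h1 := (h 0 hx).1.mono (Icc_subset_Icc le_rfl le_rfl)
      have := (hmax.localize).hasFDerivWithinAt_nonpos (h1.hasFDerivWithinAt)
        (y := y₁) (mem_posTangentConeAt_of_segment_subset (by
          rw [zero_add, segment_eq_Icc hy₁.le]))
      simp at this
      nlinarith
    rw [hα0] at he
    nlinarith
  rcases hx.2.eq_or_lt with rfl | hx1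
  · have hv : 0 ≤ v x := by
      have h1 := (h x hx).1
      have := (hmax.localize).hasFDerivWithinAt_nonpos (h1.hasFDerivWithinAt)
        (y := -x) (mem_posTangentConeAt_of_segment_subset (by
          rw [add_neg_cancel, segment_symm, segment_eq_Icc hy₁.le]))
      simp at this
      nlinarith
    rw [hα1] at he
    nlinarith
  · have hnhds : Icc 0 y₁ ∈ 𝓝 x := Icc_mem_nhds hx0 hx1
    have hloc : IsLocalMax u x := hmax.isLocalMax hnhds
    have hd : ∀ᶠ y in 𝓝 x, HasDerivAt u (v y) y := by
      filter_upwards [isOpen_Ioo.mem_nhds (⟨hx0, hx1⟩ : x ∈ Ioo 0 y₁)] with y hy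
      exact (h y ⟨hy.1.le, hy.2.le⟩).1.hasDerivAt (Icc_mem_nhds hy.1 hy.2)
    have hv0 : v x = 0 := hloc.hasDerivAt_eq_zero hd.self_of_nhds
    have hv'd : HasDerivAt v (v' x) x := (h x hx).2.hasDerivAt hnhds
    have hderiv : deriv u =ᶠ[𝓝 x] v := hd.mono fun y hy => hy.deriv
    have hdd : deriv (deriv u) x = v' x := (hv'd.congr_of_eventuallyEq hderiv).deriv
    have hαx := hα x ⟨hx0, hx1⟩
    rw [hv0, mul_zero, add_zero] at he
    have hv'pos : 0 < v' x := by
      by_contra! hn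
      nlinarith
    -- A positive second derivative would make the maximum a local minimum as well; then `u` is
    -- locally constant and its second derivative vanishes.
    have hmin := isLocalMin_of_deriv_deriv_pos (f := u) (x₀ := x) (by rw [hdd]; exact hv'pos)
      (by rw [hderiv.self_of_nhds]; exact hv0) hd.self_of_nhds.continuousAt
    have hconst : u =ᶠ[𝓝 x] fun _ => u x := by
      filter_upwards [hmin, hloc] with y h1 h2
      exact le_antisymm h2 h1
    have hv_ev : v =ᶠ[𝓝 x] fun _ => 0 := by
      filter_upwards [hderiv, hconst.eventuallyEq_nhds] with y h1 h2
      rw [← h1, h2.deriv_eq]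
      simp
    have : v' x = 0 := hv'd.unique ((hasDerivAt_const x (0 : ℝ)).congr_of_eventuallyEq hv_ev)
    linarith

lemma IsJet.neg {S : Set ℝ} {u v v' : ℝ → ℝ} (h : IsJet S u v v') :
    IsJet S (fun x => -u x) (fun x => -v x) (fun x => -v' x) :=
  fun x hx => ⟨(h x hx).1.neg, (h x hx).2.neg⟩

theorem IsJet.eq_zero {y₁ : ℝ} (hy₁ : 0 < y₁) {u v v' α b c : ℝ → ℝ}
    (h : IsJet (Icc 0 y₁) u v v') (hα : ∀ x ∈ Ioo 0 y₁, 0 < α x) (hα0 : α 0 = 0) (hα1 : α y₁ = 0)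
    (hb0 : 0 ≤ b 0) (hb1 : b y₁ ≤ 0) (hc : ∀ x ∈ Icc 0 y₁, c x < 0)
    (heq : ∀ x ∈ Icc 0 y₁, α x * v' x + b x * v x + c x * u x = 0) :
    ∀ x ∈ Icc 0 y₁, u x = 0 := fun x hx =>
  le_antisymm (h.le_zero hy₁ hα hα0 hα1 hb0 hb1 hc heq x hx) (by
    have := h.neg.le_zero hy₁ hα hα0 hα1 hb0 hb1 hc
      (fun x hx => by linear_combination -heq x hx) x hx
    linarith)

end WaveBlowup

end

noncomputable section

namespace WaveBlowup

open Set MeasureTheory Filter Topology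

/-! ### Matching of two singular blocks -/

namespace SingularBlock

/-- The contribution of the remainder to the value of `u`. -/
def valU (D : SingularBlock) (x : D.J.set) : D.J.Fn →L[ℝ] ℝ :=
  (x : ℝ) ^ (D.m + 1) • (ContinuousMap.evalCLM ℝ x).comp D.avg1

/-- The contribution of the remainder to the value of `u'`. -/
def valV (D : SingularBlock) (x : D.J.set) : D.J.Fn →L[ℝ] ℝ :=
  (x : ℝ) ^ D.m • ContinuousMap.evalCLM ℝ x

lemma U_eq (D : SingularBlock) (x : D.J.set) (Y : D.Jet) :
    D.U Y x = ∑ i, Y.1 i * (x : ℝ) ^ (i : ℕ) + D.valU x Y.2 := rfl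

lemma V_eq (D : SingularBlock) (x : D.J.set) (Y : D.Jet) :
    D.V Y x = ∑ i, Y.1 i * ((i : ℕ) * (x : ℝ) ^ ((i : ℕ) - 1)) + D.valV x Y.2 := by
  rw [V, RayInterval.ext_of_mem _ _ x.2]; rfl

lemma U_smul (D : SingularBlock) (r : ℝ) (Y : D.Jet) (x : ℝ) : D.U (r • Y) x = r * D.U Y x := by
  simp only [U, Prod.smul_fst, Prod.smul_snd, Pi.smul_apply, smul_eq_mul, mul_add, Finset.mul_sum]
  congr 1
  · exact Finset.sum_congr rfl fun i _ => by ring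
  · have : rayAvg (D.m + 1) (D.J.ext (r • Y.2)) x = r * rayAvg (D.m + 1) (D.J.ext Y.2) x :=
      rayAvg_const_mul r (f := D.J.ext Y.2) x
    rw [this]; ring

lemma V_smul (D : SingularBlock) (r : ℝ) (Y : D.Jet) (x : ℝ) : D.V (r • Y) x = r * D.V Y x := by
  simp only [V, Prod.smul_fst, Prod.smul_snd, Pi.smul_apply, smul_eq_mul, mul_add, Finset.mul_sum,
    RayInterval.ext_smul]
  congr 1
  · exact Finset.sum_congr rfl fun i _ => by ring
  · ring

lemma U_zero (D : SingularBlock) (x : ℝ) : D.U 0 x = 0 := by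
  simpa using D.U_smul 0 0 x

lemma V_zero (D : SingularBlock) (x : ℝ) : D.V 0 x = 0 := by
  simpa using D.V_smul 0 0 x

end SingularBlock

lemma RayInterval.restr_zero (J : RayInterval) : J.restr 0 = 0 := by
  ext x
  have h := J.ext_restr (f := 0) continuousOn_const x.2
  rwa [RayInterval.ext_of_mem _ _ x.2] at h

section Matching

variable (D₁ D₂ : SingularBlock) (x₁ : D₁.J.set) (x₂ : D₂.J.set)

/-- The finite dimensional block of the matching problem. -/
def matchM (l : Fin 3) :
    Matrix (Fin (D₁.m + 1) ⊕ Fin (D₂.m + 1)) (Fin (D₁.m + 1) ⊕ Fin (D₂.m + 1)) ℝ :=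
  Matrix.of fun i j => Sum.elim
    (fun k : Fin (D₁.m + 1) => Sum.elim
      (fun j : Fin (D₁.m + 1) => if (k : ℕ) < D₁.m then (D₁.taylor (D₁.mono j l)).1 k
        else if l = 0 then (x₁ : ℝ) ^ (j : ℕ) else 0)
      (fun j : Fin (D₂.m + 1) => if (k : ℕ) < D₁.m then 0 else if l = 0 then -(x₂ : ℝ) ^ (j : ℕ) else 0) j)
    (fun k : Fin (D₂.m + 1) => Sum.elim
      (fun j : Fin (D₁.m + 1) => if (k : ℕ) < D₂.m then 0
        else if l = 0 then (j : ℕ) * (x₁ : ℝ) ^ ((j : ℕ) - 1) else 0)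
      (fun j : Fin (D₂.m + 1) => if (k : ℕ) < D₂.m then (D₂.taylor (D₂.mono j l)).1 k
        else if l = 0 then -((j : ℕ) * (x₂ : ℝ) ^ ((j : ℕ) - 1)) else 0) j) i

/-- The finite dimensional equations of the remainders. -/
def matchB (l : Fin 3) (i : Fin (D₁.m + 1) ⊕ Fin (D₂.m + 1)) : D₁.J.Fn × D₂.J.Fn →L[ℝ] ℝ :=
  Sum.elim
    (fun k : Fin (D₁.m + 1) => if (k : ℕ) < D₁.m then 0 else if l = 0 then
      (D₁.valU x₁).comp (ContinuousLinearMap.fst ℝ _ _)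
        - (D₂.valU x₂).comp (ContinuousLinearMap.snd ℝ _ _) else 0)
    (fun k : Fin (D₂.m + 1) => if (k : ℕ) < D₂.m then 0 else if l = 0 then
      (D₁.valV x₁).comp (ContinuousLinearMap.fst ℝ _ _)
        - (D₂.valV x₂).comp (ContinuousLinearMap.snd ℝ _ _) else 0) i

/-- The contribution of the Taylor coefficients to the equations of the remainders. -/
def matchC (l : Fin 3) (j : Fin (D₁.m + 1) ⊕ Fin (D₂.m + 1)) : D₁.J.Fn × D₂.J.Fn :=
  Sum.elim (fun j => (D₁.src j l, 0)) (fun j => (0, D₂.src j l)) j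

/-- The operator acting on the remainders. -/
def matchK (l : Fin 3) : D₁.J.Fn × D₂.J.Fn →L[ℝ] D₁.J.Fn × D₂.J.Fn :=
  (D₁.pert l).prodMap (D₂.pert l)

variable {D₁ D₂ x₁ x₂}

/-- The operator is block diagonal and the product carries the sup norm. -/
lemma norm_matchK_lt {ε : ℝ} (h₁ : ‖pencil D₁.pert ε‖ < 1) (h₂ : ‖pencil D₂.pert ε‖ < 1) :
    ‖pencil (matchK D₁ D₂) ε‖ < 1 := by
  have e : ∀ w, pencil (matchK D₁ D₂) ε w = (pencil D₁.pert ε w.1, pencil D₂.pert ε w.2) := by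
    intro w
    simp only [pencil, matchK, Fin.sum_univ_three]
    rfl
  have h0 : 0 ≤ max ‖pencil D₁.pert ε‖ ‖pencil D₂.pert ε‖ :=
    le_max_of_le_left (norm_nonneg (pencil D₁.pert ε))
  refine lt_of_le_of_lt (ContinuousLinearMap.opNorm_le_bound _ h0 fun w => ?_) (max_lt h₁ h₂)
  rw [e, Prod.norm_def]
  refine max_le ?_ ?_
  · exact ((pencil D₁.pert ε).le_opNorm _).trans
      (mul_le_mul (le_max_left _ _) (norm_fst_le w) (norm_nonneg _) h0)
  · exact ((pencil D₂.pert ε).le_opNorm _).trans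
      (mul_le_mul (le_max_right _ _) (norm_snd_le w) (norm_nonneg _) h0)

/-- The jet over the first block. -/
def jet₁ (ξ : Fin (D₁.m + 1) ⊕ Fin (D₂.m + 1) → ℝ) (w : D₁.J.Fn × D₂.J.Fn) : D₁.Jet :=
  (fun j => ξ (Sum.inl j), w.1)

/-- The jet over the second block. -/
def jet₂ (ξ : Fin (D₁.m + 1) ⊕ Fin (D₂.m + 1) → ℝ) (w : D₁.J.Fn × D₂.J.Fn) : D₂.Jet :=
  (fun j => ξ (Sum.inr j), w.2)

/-- The right hand side of the finite dimensional equations. -/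
def matchF (q₁ q₂ : (ℕ → ℝ) × (ℝ → ℝ)) (i : Fin (D₁.m + 1) ⊕ Fin (D₂.m + 1)) : ℝ :=
  Sum.elim (fun k : Fin (D₁.m + 1) => if (k : ℕ) < D₁.m then q₁.1 k else 0)
    (fun k : Fin (D₂.m + 1) => if (k : ℕ) < D₂.m then q₂.1 k else 0) i

/-- Each block has `m + 1` coefficients and only `m` coefficient equations. The spare last row of
the first block holds the matching of the values, and that of the second block the matching of the
derivatives, so that the system is square. -/
lemma jetEq_of_match {ξ : Fin 3 → Fin (D₁.m + 1) ⊕ Fin (D₂.m + 1) → ℝ}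
    {w : Fin 3 → D₁.J.Fn × D₂.J.Fn} {q₁ q₂ : (ℕ → ℝ) × (ℝ → ℝ)}
    (hf : ∀ i, ∑ l, (∑ j, matchM D₁ D₂ x₁ x₂ l i j * ξ l j + matchB D₁ D₂ x₁ x₂ l i (w l))
      = matchF q₁ q₂ i)
    (he : w 0 + ∑ l, (matchK D₁ D₂ l (w l) + ∑ j, ξ l j • matchC D₁ D₂ l j)
      = (D₁.avg0 (D₁.J.restr q₁.2), D₂.avg0 (D₂.J.restr q₂.2))) :
    D₁.JetEq (fun l => jet₁ (ξ l) (w l)) q₁ ∧ D₂.JetEq (fun l => jet₂ (ξ l) (w l)) q₂ ∧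
      D₁.U (jet₁ (ξ 0) (w 0)) x₁ = D₂.U (jet₂ (ξ 0) (w 0)) x₂ ∧
      D₁.V (jet₁ (ξ 0) (w 0)) x₁ = D₂.V (jet₂ (ξ 0) (w 0)) x₂ := by
  have he1 := congrArg Prod.fst he
  have he2 := congrArg Prod.snd he
  simp only [Prod.fst_add, Prod.fst_sum, Fintype.sum_sum_type, matchC, Sum.elim_inl, Sum.elim_inr,
    Prod.smul_mk, smul_zero, Finset.sum_const_zero, add_zero, Prod.snd_add, Prod.snd_sum,
    zero_add] at he1 he2
  refine ⟨⟨fun k hk => ?_, he1⟩, ⟨fun k hk => ?_, he2⟩, ?_, ?_⟩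
  · have := hf (Sum.inl ⟨k, by omega⟩)
    simp only [matchM, matchB, matchF, Matrix.of_apply, Sum.elim_inl, Fintype.sum_sum_type,
      Sum.elim_inr, hk, if_true, zero_mul, Finset.sum_const_zero, add_zero, zero_apply] at this
    rw [← this]
    exact Finset.sum_congr rfl fun l _ => Finset.sum_congr rfl fun j _ => mul_comm _ _
  · have := hf (Sum.inr ⟨k, by omega⟩)
    simp only [matchM, matchB, matchF, Matrix.of_apply, Sum.elim_inl, Fintype.sum_sum_type,
      Sum.elim_inr, hk, if_true, zero_mul, Finset.sum_const_zero, add_zero, zero_apply,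
      zero_add] at this
    rw [← this]
    exact Finset.sum_congr rfl fun l _ => Finset.sum_congr rfl fun j _ => mul_comm _ _
  · have := hf (Sum.inl (Fin.last _))
    simp only [matchM, matchB, matchF, Matrix.of_apply, Sum.elim_inl, Fintype.sum_sum_type,
      Sum.elim_inr, Fin.val_last, lt_irrefl, if_false, Fin.sum_univ_three, if_true, Fin.isValue,
      one_ne_zero, zero_mul, Finset.sum_const_zero, add_zero, zero_apply, sub_apply,
      show ¬ ((2 : Fin 3) = 0) by decide, ContinuousLinearMap.comp_apply,
      ContinuousLinearMap.coe_fst', ContinuousLinearMap.coe_snd', neg_mul,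
      Finset.sum_neg_distrib] at this
    rw [SingularBlock.U_eq, SingularBlock.U_eq]
    simp only [jet₁, jet₂, mul_comm (ξ 0 _)]
    linarith
  · have := hf (Sum.inr (Fin.last _))
    simp only [matchM, matchB, matchF, Matrix.of_apply, Sum.elim_inl, Fintype.sum_sum_type,
      Sum.elim_inr, Fin.val_last, lt_irrefl, if_false, Fin.sum_univ_three, if_true, Fin.isValue,
      one_ne_zero, zero_mul, Finset.sum_const_zero, add_zero, zero_apply, sub_apply,
      show ¬ ((2 : Fin 3) = 0) by decide, ContinuousLinearMap.comp_apply,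
      ContinuousLinearMap.coe_fst', ContinuousLinearMap.coe_snd', neg_mul,
      Finset.sum_neg_distrib] at this
    rw [SingularBlock.V_eq, SingularBlock.V_eq]
    simp only [jet₁, jet₂, mul_comm (ξ 0 _)]
    linarith

/-- Chains of jets over two blocks, matched at one point. -/
theorem exists_matched_chain {L ε₀ : ℝ} (hL : 0 < L) (hε₀ : |ε₀| < L)
    (h₁ : ∀ ε, |ε| < L → ‖pencil D₁.pert ε‖ < 1) (h₂ : ∀ ε, |ε| < L → ‖pencil D₂.pert ε‖ < 1)
    (hinj : ∀ (Y₁ : D₁.Jet) (Y₂ : D₂.Jet), D₁.JetEq (fun l => ε₀ ^ (l : ℕ) • Y₁) 0 →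
      D₂.JetEq (fun l => ε₀ ^ (l : ℕ) • Y₂) 0 → D₁.U Y₁ x₁ = D₂.U Y₂ x₂ →
      D₁.V Y₁ x₁ = D₂.V Y₂ x₂ → Y₁.1 = 0 ∧ Y₂.1 = 0) (q₁ q₂ : (ℕ → ℝ) × (ℝ → ℝ)) :
    ∃ (N : ℕ) (Y₁ : ℕ → D₁.Jet) (Y₂ : ℕ → D₂.Jet), ∀ n,
      D₁.JetEq (fun l => delay Y₁ l n) (if n = N then q₁ else 0) ∧
      D₂.JetEq (fun l => delay Y₂ l n) (if n = N then q₂ else 0) ∧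
      D₁.U (Y₁ n) x₁ = D₂.U (Y₂ n) x₂ ∧ D₁.V (Y₁ n) x₁ = D₂.V (Y₂ n) x₂ := by
  have hzero : ∀ i, matchF (D₁ := D₁) (D₂ := D₂) 0 0 i = 0 := by
    rintro (i | i) <;> simp [matchF]
  obtain ⟨N, Ξ, W, h⟩ := exists_chain_of_injective (matchM D₁ D₂ x₁ x₂) (matchB D₁ D₂ x₁ x₂)
    (matchC D₁ D₂) (matchK D₁ D₂) hL hε₀ (fun ε hε => norm_matchK_lt (h₁ ε hε) (h₂ ε hε))
    (by
      intro ξ w hf he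
      have key := jetEq_of_match (x₁ := x₁) (x₂ := x₂) (ξ := fun l => ε₀ ^ (l : ℕ) • ξ)
        (w := fun l => ε₀ ^ (l : ℕ) • w) (q₁ := 0) (q₂ := 0)
        (by
          intro i
          rw [hzero, ← hf i]
          refine Finset.sum_congr rfl fun l _ => ?_
          rw [mul_add, Finset.mul_sum, map_smul, smul_eq_mul]
          congr 1
          exact Finset.sum_congr rfl fun j _ => by
            simp only [Pi.smul_apply, smul_eq_mul]; ring)
        (by
          simp only [Prod.snd_zero, RayInterval.restr_zero, map_zero, Prod.mk_zero_zero]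
          rw [← he]
          simp only [Fin.isValue, Fin.val_zero, pow_zero, one_smul]
          congr 1
          refine Finset.sum_congr rfl fun l _ => ?_
          rw [smul_add, Finset.smul_sum, map_smul]
          congr 1
          exact Finset.sum_congr rfl fun j _ => by
            simp only [Pi.smul_apply, smul_eq_mul, mul_smul])
      simp only [Fin.isValue, Fin.val_zero, pow_zero, one_smul] at key
      obtain ⟨e1, e2⟩ := hinj (jet₁ ξ w) (jet₂ ξ w) key.1 key.2.1 key.2.2.1 key.2.2.2
      funext i
      rcases i with i | i
      · exact congrFun e1 i
      · exact congrFun e2 i)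
    (matchF q₁ q₂) (D₁.avg0 (D₁.J.restr q₁.2), D₂.avg0 (D₂.J.restr q₂.2))
  refine ⟨N, fun n => jet₁ (Ξ n) (W n), fun n => jet₂ (Ξ n) (W n), fun n => ?_⟩
  have key := jetEq_of_match (x₁ := x₁) (x₂ := x₂) (ξ := fun l => delay Ξ l n)
    (w := fun l => delay W l n) (q₁ := if n = N then q₁ else 0) (q₂ := if n = N then q₂ else 0)
    (by
      intro i
      rw [(h n).1 i]
      split_ifs
      · rfl
      · exact (hzero i).symm)
    (by
      have h0 : delay W ((0 : Fin 3) : ℕ) n = W n := by simp [delay]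
      rw [h0, (h n).2]
      split_ifs
      · rfl
      · simp only [Prod.snd_zero, RayInterval.restr_zero, map_zero, Prod.mk_zero_zero])
  have d1 : ∀ l, jet₁ (delay Ξ l n) (delay W l n) = delay (fun n => jet₁ (Ξ n) (W n)) l n := by
    intro l; unfold delay; split_ifs <;> rfl
  have d2 : ∀ l, jet₂ (delay Ξ l n) (delay W l n) = delay (fun n => jet₂ (Ξ n) (W n)) l n := by
    intro l; unfold delay; split_ifs <;> rfl
  have d0 : ∀ {V : Type} [Zero V] (s : ℕ → V), delay s ((0 : Fin 3) : ℕ) n = s n := by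
    intro V _ s; simp [delay]
  simp only [d1, d2, d0] at key
  exact key

end Matching

end WaveBlowup

end

/-! ### Pencils with two singular points: chains on a neighbourhood of both -/

noncomputable section

namespace WaveBlowup

open Set MeasureTheory Filter Topology

/-- A quadratic pencil of second order operators `y a u'' + b u' + c u` on `[0, ∞)`, degenerating
at `0` and at `y₁`, which obeys the maximum principle on `[0, y₁]` for the parameter `ε₀`. -/
structure TwoPointPencil where
  /-- the second singular point -/
  y₁ : ℝ
  /-- the principal coefficient -/
  a : ℝ → ℝ
  /-- the first order coefficients -/
  b : Fin 3 → ℝ → ℝ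
  /-- the zeroth order coefficients -/
  c : Fin 3 → ℝ → ℝ
  /-- the parameter at which the maximum principle holds -/
  ε₀ : ℝ
  y₁_pos : 0 < y₁
  smooth_a : ContDiffOn ℝ ∞ a (Ici 0)
  smooth_b : ∀ l, ContDiffOn ℝ ∞ (b l) (Ici 0)
  smooth_c : ∀ l, ContDiffOn ℝ ∞ (c l) (Ici 0)
  a_pos : ∀ y, 0 ≤ y → y < y₁ → 0 < a y
  a_neg : ∀ y, y₁ < y → a y < 0
  a_zero : a y₁ = 0
  a_deriv : derivWithin a (Ici 0) y₁ ≠ 0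
  b_left : 0 ≤ ∑ l : Fin 3, ε₀ ^ (l : ℕ) * b l 0
  b_right : ∑ l : Fin 3, ε₀ ^ (l : ℕ) * b l y₁ ≤ 0
  c_neg : ∀ y ∈ Icc 0 y₁, ∑ l : Fin 3, ε₀ ^ (l : ℕ) * c l y < 0

lemma norm_pencil_le {E : Type*} [NormedAddCommGroup E] [NormedSpace ℝ E] {A : Fin 3 → E}
    {C : Fin 3 → ℝ} {ε L : ℝ} (hε : |ε| ≤ L) (hA : ∀ l, ‖A l‖ ≤ C l) :
    ‖pencil A ε‖ ≤ ∑ l : Fin 3, L ^ (l : ℕ) * C l := by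
  unfold pencil
  refine (norm_sum_le _ _).trans (Finset.sum_le_sum fun l _ => ?_)
  rw [norm_smul, norm_pow, Real.norm_eq_abs]
  exact mul_le_mul (pow_le_pow_left₀ (abs_nonneg _) hε _) (hA l) (norm_nonneg _)
    (pow_nonneg ((abs_nonneg _).trans hε) _)

lemma SingularBlock.norm_pencil_pert_le (D : SingularBlock) {C : Fin 3 → ℝ} {ε L : ℝ}
    (hε : |ε| ≤ L) (hA : ∀ l, ‖D.pert l‖ ≤ C l) :
    ‖pencil D.pert ε‖ ≤ ∑ l : Fin 3, L ^ (l : ℕ) * C l :=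
  norm_pencil_le (E := D.J.Fn →L[ℝ] D.J.Fn) (A := D.pert) hε hA

/-- The coefficients are bounded on the compact interval, so the norm is `O(1 / m)` uniformly for
`|ε| < L`; the second bound is the one required by `JetEq.smooth`. -/
lemma SingularBlock.exists_norm_pencil_lt (J : RayInterval) (β γ : Fin 3 → ℝ → ℝ)
    (hβ : ∀ l, ContDiffOn ℝ ∞ (β l) J.set) (hγ : ∀ l, ContDiffOn ℝ ∞ (γ l) J.set) (L : ℝ) :
    ∃ m₀ : ℕ, ∀ m, m₀ ≤ m → ∀ hm : 2 ≤ m, |β 0 0| + 1 ≤ m ∧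
      ∀ ε, |ε| < L → ‖pencil (SingularBlock.mk J m β γ hβ hγ hm).pert ε‖ < 1 := by
  have hb : ∀ f : ℝ → ℝ, ContinuousOn f J.set → ∃ C, ∀ x ∈ J.set, |f x| ≤ C := fun f hf =>
    isCompact_Icc.exists_bound_of_continuousOn hf
  choose Cβ hCβ using fun l => hb (β l) (hβ l).continuousOn
  choose Cγ hCγ using fun l => hb (fun x => x * γ l x) (continuousOn_id.mul (hγ l).continuousOn)
  obtain ⟨m₀, hm₀⟩ := exists_nat_gt
    (max (∑ l : Fin 3, |L| ^ (l : ℕ) * (Cβ l + Cγ l)) (|β 0 0| + 1))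
  refine ⟨m₀, fun m hm hm2 => ?_⟩
  have hmR : (m₀ : ℝ) ≤ m := by exact_mod_cast hm
  have hm0 : (0 : ℝ) < m := by exact_mod_cast (by omega : 0 < m)
  refine ⟨(le_max_right _ _).trans (hm₀.le.trans hmR), fun ε hε => ?_⟩
  set D := SingularBlock.mk J m β γ hβ hγ hm2
  have hC0 : ∀ l, 0 ≤ Cβ l + Cγ l := fun l =>
    add_nonneg ((abs_nonneg _).trans (hCβ l 0 J.zero_mem)) ((abs_nonneg _).trans (hCγ l 0 J.zero_mem))
  have h1 : ‖pencil D.pert ε‖ ≤ ∑ l : Fin 3, |L| ^ (l : ℕ) * ((Cβ l + Cγ l) / m) := by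
    exact D.norm_pencil_pert_le (hε.le.trans (le_abs_self L)) fun l => D.norm_pert_le (hCβ l) (hCγ l)
  refine h1.trans_lt ?_
  have h2 : ∑ l : Fin 3, |L| ^ (l : ℕ) * ((Cβ l + Cγ l) / m)
      = (∑ l : Fin 3, |L| ^ (l : ℕ) * (Cβ l + Cγ l)) / m := by
    rw [Finset.sum_div]
    exact Finset.sum_congr rfl fun l _ => by ring
  rw [h2, div_lt_one hm0]
  exact (le_max_left _ _).trans_lt (hm₀.trans_le hmR)

lemma IsJet.shift {S : Set ℝ} {u v v' : ℝ → ℝ} (h : IsJet S u v v') (s : ℝ) :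
    IsJet ((fun y => y - s) ⁻¹' S) (fun y => u (y - s)) (fun y => v (y - s))
      (fun y => v' (y - s)) := by
  intro y hy
  have hd : HasDerivWithinAt (fun y : ℝ => y - s) 1 ((fun y => y - s) ⁻¹' S) y :=
    (hasDerivWithinAt_id y _).sub_const s
  have h1 := (h (y - s) hy).1.comp y hd (mapsTo_preimage _ _)
  have h2 := (h (y - s) hy).2.comp y hd (mapsTo_preimage _ _)
  rw [mul_one] at h1 h2
  exact ⟨h1, h2⟩

namespace TwoPointPencil

variable (P : TwoPointPencil)

/-- The interval at the left singular point. -/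
def leftInterval : RayInterval where
  lo := 0
  hi := P.y₁ / 2
  lt := by linarith [P.y₁_pos]
  lo_nonpos := le_rfl
  hi_nonneg := by linarith [P.y₁_pos]

/-- The interval at the right singular point, translated to the origin. -/
def rightInterval : RayInterval where
  lo := -(P.y₁ / 2)
  hi := 1
  lt := by linarith [P.y₁_pos]
  lo_nonpos := by linarith [P.y₁_pos]
  hi_nonneg := zero_le_one

lemma leftInterval_subset : P.leftInterval.set ⊆ Ici 0 := fun _ hx => hx.1

lemma mapsTo_right : MapsTo (fun x => P.y₁ + x) P.rightInterval.set (Ici 0) := fun x hx => by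
  have := hx.1
  simp only [rightInterval] at this
  simp only [mem_Ici]
  linarith [P.y₁_pos]

lemma smooth_right {f : ℝ → ℝ} (hf : ContDiffOn ℝ ∞ f (Ici 0)) :
    ContDiffOn ℝ ∞ (fun x => f (P.y₁ + x)) P.rightInterval.set :=
  hf.comp (by fun_prop) P.mapsTo_right

lemma exists_quotient : ∃ e : ℝ → ℝ, ContDiffOn ℝ ∞ e P.rightInterval.set ∧
    ∀ x ∈ P.rightInterval.set, P.a (P.y₁ + x) = x * e x := by
  obtain ⟨e, he, h⟩ := exists_hadamard P.rightInterval.lt P.rightInterval.lo_nonpos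
    P.rightInterval.hi_nonneg (P.smooth_right P.smooth_a)
  refine ⟨e, he, fun x hx => ?_⟩
  rw [h x hx, add_zero, P.a_zero, zero_add]

/-- The quotient of the principal coefficient by its vanishing factor at the right. -/
def e : ℝ → ℝ := P.exists_quotient.choose

lemma smooth_e : ContDiffOn ℝ ∞ P.e P.rightInterval.set := P.exists_quotient.choose_spec.1

lemma a_eq {x : ℝ} (hx : x ∈ P.rightInterval.set) : P.a (P.y₁ + x) = x * P.e x :=
  P.exists_quotient.choose_spec.2 x hx

lemma right_nhds : P.rightInterval.set ∈ 𝓝 (0 : ℝ) :=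
  Icc_mem_nhds (by simp only [rightInterval]; linarith [P.y₁_pos]) zero_lt_one

/-- Away from the origin this is the strict sign of `a` on either side of `y₁`; at the origin `e 0`
is the derivative of `a` at `y₁`, that is, the zero is simple. -/
lemma e_ne_zero {x : ℝ} (hx : x ∈ P.rightInterval.set) : P.e x ≠ 0 := by
  have hpos := P.y₁_pos
  rcases lt_trichotomy x 0 with h | rfl | h
  · have h1 := P.a_pos (P.y₁ + x) (P.mapsTo_right hx) (by linarith)
    rw [P.a_eq hx] at h1
    intro h0
    rw [h0, mul_zero] at h1
    exact lt_irrefl _ h1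
  · have h1 : HasDerivAt P.a (derivWithin P.a (Ici 0) P.y₁) P.y₁ :=
      ((P.smooth_a.differentiableOn (by simp)) P.y₁ hpos.le).hasDerivWithinAt.hasDerivAt
        (Ici_mem_nhds hpos)
    have h2 : HasDerivAt (fun x => P.a (P.y₁ + x)) (derivWithin P.a (Ici 0) P.y₁) 0 := by
      have h3 : HasDerivAt P.a (derivWithin P.a (Ici 0) P.y₁) (P.y₁ + 0) := by rwa [add_zero]
      exact h3.comp_const_add P.y₁ 0
    have h4 : DifferentiableAt ℝ P.e 0 :=
      (P.smooth_e.differentiableOn (by simp) 0 hx).differentiableAt P.right_nhds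
    have h5 : HasDerivAt (fun x => x * P.e x) (1 * P.e 0 + 0 * deriv P.e 0) 0 :=
      (hasDerivAt_id (0 : ℝ)).mul h4.hasDerivAt
    have h6 := h2.unique (h5.congr_of_eventuallyEq
      (by filter_upwards [P.right_nhds] with x hx using P.a_eq hx))
    intro h0
    rw [h0] at h6
    exact P.a_deriv (by linarith)
  · have h1 := P.a_neg (P.y₁ + x) (by linarith)
    rw [P.a_eq hx] at h1
    intro h0
    rw [h0, mul_zero] at h1
    exact lt_irrefl _ h1

lemma right_factor_ne_zero {x : ℝ} (hx : x ∈ P.rightInterval.set) : (P.y₁ + x) * P.e x ≠ 0 := by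
  refine mul_ne_zero ?_ (P.e_ne_zero hx)
  have := hx.1
  simp only [rightInterval] at this
  linarith [P.y₁_pos]

lemma left_factor_ne_zero {x : ℝ} (hx : x ∈ P.leftInterval.set) : P.a x ≠ 0 := by
  have := hx.2
  simp only [leftInterval] at this
  exact (P.a_pos x hx.1 (by linarith [P.y₁_pos])).ne'

/-- Division by the principal factor at the left. -/
def leftQ (f : ℝ → ℝ) (x : ℝ) : ℝ := f x / P.a x

/-- Division by the principal factor at the right. -/
def rightQ (f : ℝ → ℝ) (x : ℝ) : ℝ := f (P.y₁ + x) / ((P.y₁ + x) * P.e x)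

lemma smooth_leftQ {f : ℝ → ℝ} (hf : ContDiffOn ℝ ∞ f (Ici 0)) :
    ContDiffOn ℝ ∞ (P.leftQ f) P.leftInterval.set :=
  (hf.mono P.leftInterval_subset).div (P.smooth_a.mono P.leftInterval_subset)
    fun _ hx => P.left_factor_ne_zero hx

lemma smooth_rightQ {f : ℝ → ℝ} (hf : ContDiffOn ℝ ∞ f (Ici 0)) :
    ContDiffOn ℝ ∞ (P.rightQ f) P.rightInterval.set := by
  have h1 : ContDiffOn ℝ ∞ (fun x => P.y₁ + x) P.rightInterval.set := by fun_prop
  exact (P.smooth_right hf).div (h1.mul P.smooth_e) fun _ hx => P.right_factor_ne_zero hx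

/-- The block at the left singular point. -/
def left (m : ℕ) (hm : 2 ≤ m) : SingularBlock :=
  .mk P.leftInterval m (fun l => P.leftQ (P.b l)) (fun l => P.leftQ (P.c l))
    (fun l => P.smooth_leftQ (P.smooth_b l)) (fun l => P.smooth_leftQ (P.smooth_c l)) hm

/-- The block at the right singular point. -/
def right (m : ℕ) (hm : 2 ≤ m) : SingularBlock :=
  .mk P.rightInterval m (fun l => P.rightQ (P.b l)) (fun l => P.rightQ (P.c l))
    (fun l => P.smooth_rightQ (P.smooth_b l)) (fun l => P.smooth_rightQ (P.smooth_c l)) hm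

lemma mid_mem_left : P.y₁ / 2 ∈ P.leftInterval.set :=
  ⟨by simp only [leftInterval]; linarith [P.y₁_pos], le_rfl⟩

lemma mid_mem_right : P.y₁ / 2 - P.y₁ ∈ P.rightInterval.set :=
  ⟨by simp only [rightInterval]; linarith [P.y₁_pos],
    by simp only [rightInterval]; linarith [P.y₁_pos]⟩

variable {P} {m : ℕ} {hm : 2 ≤ m}

/-- Two jets glued at the midpoint, the values of `u`. -/
def gU (Y₁ : (P.left m hm).Jet) (Y₂ : (P.right m hm).Jet) : ℝ → ℝ :=
  glue (P.y₁ / 2) ((P.left m hm).U Y₁) (fun y => (P.right m hm).U Y₂ (y - P.y₁))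

/-- Two jets glued at the midpoint, the values of `u'`. -/
def gV (Y₁ : (P.left m hm).Jet) (Y₂ : (P.right m hm).Jet) : ℝ → ℝ :=
  glue (P.y₁ / 2) ((P.left m hm).V Y₁) (fun y => (P.right m hm).V Y₂ (y - P.y₁))

/-- Matched jets over the two blocks give solutions on an interval containing both singular
points. -/
theorem exists_isJet_of_jetEq {X₁ : Fin 3 → (P.left m hm).Jet} {X₂ : Fin 3 → (P.right m hm).Jet}
    {q₁ q₂ : (ℕ → ℝ) × (ℝ → ℝ)} {f : ℝ → ℝ} (h₁ : (P.left m hm).JetEq X₁ q₁)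
    (h₂ : (P.right m hm).JetEq X₂ q₂) (hq₁ : ContinuousOn q₁.2 P.leftInterval.set)
    (hq₂ : ContinuousOn q₂.2 P.rightInterval.set)
    (hf₁ : ∀ x ∈ P.leftInterval.set,
      ∑ k ∈ Finset.range m, q₁.1 k * x ^ k + x ^ m * q₁.2 x = P.leftQ f x)
    (hf₂ : ∀ x ∈ P.rightInterval.set,
      ∑ k ∈ Finset.range m, q₂.1 k * x ^ k + x ^ m * q₂.2 x = P.rightQ f x)
    (hU : ∀ l, (P.left m hm).U (X₁ l) (P.y₁ / 2) = (P.right m hm).U (X₂ l) (P.y₁ / 2 - P.y₁))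
    (hV : ∀ l, (P.left m hm).V (X₁ l) (P.y₁ / 2) = (P.right m hm).V (X₂ l) (P.y₁ / 2 - P.y₁)) :
    ∃ v' : ℝ → ℝ, IsJet (Icc 0 (P.y₁ + 1)) (gU (X₁ 0) (X₂ 0)) (gV (X₁ 0) (X₂ 0)) v' ∧
      ∀ y ∈ Icc 0 (P.y₁ + 1), y * P.a y * v' y
        + ∑ l, (P.b l y * gV (X₁ l) (X₂ l) y + P.c l y * gU (X₁ l) (X₂ l) y) = f y := by
  have hpos := P.y₁_pos
  obtain ⟨V₁, hV₁⟩ := h₁.solves hq₁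
  obtain ⟨V₂, hV₂⟩ := h₂.solves hq₂
  have E₁ : ∀ y ∈ P.leftInterval.set, y * P.a y * V₁ y + ∑ l, (P.b l y * (P.left m hm).V (X₁ l) y
      + P.c l y * (P.left m hm).U (X₁ l) y) = f y := by
    intro y hy
    have h := (hV₁ y hy).2.trans (hf₁ y hy)
    have ha := P.left_factor_ne_zero hy
    have h' := congrArg (P.a y * ·) h
    simp only [left, leftQ, mul_add, Finset.mul_sum] at h'
    rw [mul_div_cancel₀ _ ha] at h'
    rw [← h']
    congr 1
    · ring
    · refine Finset.sum_congr rfl fun l _ => ?_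
      field_simp
      rfl
  have E₂ : ∀ y, y - P.y₁ ∈ P.rightInterval.set → y * P.a y * V₂ (y - P.y₁)
      + ∑ l, (P.b l y * (P.right m hm).V (X₂ l) (y - P.y₁)
      + P.c l y * (P.right m hm).U (X₂ l) (y - P.y₁)) = f y := by
    intro y hy
    have h := (hV₂ _ hy).2.trans (hf₂ _ hy)
    have ha := P.right_factor_ne_zero hy
    have hay := P.a_eq hy
    have h' := congrArg ((P.y₁ + (y - P.y₁)) * P.e (y - P.y₁) * ·) h
    simp only [right, rightQ, mul_add, Finset.mul_sum] at h'
    rw [mul_div_cancel₀ _ ha] at h'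
    rw [add_sub_cancel] at h' ha hay
    rw [← h', hay]
    congr 1
    · ring
    · refine Finset.sum_congr rfl fun l _ => ?_
      have ha1 : y ≠ 0 := left_ne_zero_of_mul ha
      have ha2 : P.e (y - P.y₁) ≠ 0 := right_ne_zero_of_mul ha
      field_simp
      rfl
  -- The second derivatives need no matching condition: the equation holds on both sides of the
  -- midpoint and its leading coefficient does not vanish there.
  have hmid : V₁ (P.y₁ / 2) = V₂ (P.y₁ / 2 - P.y₁) := by
    have e1 := E₁ _ P.mid_mem_left
    have e2 := E₂ _ P.mid_mem_right
    simp only [hU, hV] at e1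
    have h0 : P.y₁ / 2 * P.a (P.y₁ / 2) ≠ 0 :=
      mul_ne_zero (by linarith) (P.a_pos _ (by linarith) (by linarith)).ne'
    exact mul_left_cancel₀ h0 (by linarith)
  have J₁ : IsJet P.leftInterval.set ((P.left m hm).U (X₁ 0)) ((P.left m hm).V (X₁ 0)) V₁ :=
    fun x hx => ⟨(SingularBlock.hasDerivAt_U _ x).hasDerivWithinAt, (hV₁ x hx).1⟩
  have J₂ : IsJet P.rightInterval.set ((P.right m hm).U (X₂ 0)) ((P.right m hm).V (X₂ 0)) V₂ :=
    fun x hx => ⟨(SingularBlock.hasDerivAt_U _ x).hasDerivWithinAt, (hV₂ x hx).1⟩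
  have hmemL : ∀ y ∈ Icc 0 (P.y₁ + 1), y ≤ P.y₁ / 2 → y ∈ P.leftInterval.set :=
    fun y hy h => ⟨hy.1, h⟩
  have hmemR : ∀ y ∈ Icc 0 (P.y₁ + 1), P.y₁ / 2 ≤ y → y - P.y₁ ∈ P.rightInterval.set :=
    fun y hy h => ⟨by simp only [rightInterval]; linarith,
      by simp only [rightInterval]; linarith [hy.2]⟩
  refine ⟨glue (P.y₁ / 2) V₁ (fun y => V₂ (y - P.y₁)), ?_, fun y hy => ?_⟩
  · exact IsJet.glue (J₁.mono fun y hy => hmemL y hy.1 hy.2)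
      ((J₂.shift P.y₁).mono fun y hy => hmemR y hy.1 hy.2) (hU 0) (hV 0) hmid
  · rcases le_total y (P.y₁ / 2) with h | h
    · simp only [gU, gV, glue_of_le h]
      exact E₁ y (hmemL y hy h)
    · have e1 : ∀ l, gU (X₁ l) (X₂ l) y = (P.right m hm).U (X₂ l) (y - P.y₁) :=
        fun l => glue_of_ge h (hU l)
      have e2 : ∀ l, gV (X₁ l) (X₂ l) y = (P.right m hm).V (X₂ l) (y - P.y₁) :=
        fun l => glue_of_ge h (hV l)
      have e3 : glue (P.y₁ / 2) V₁ (fun y => V₂ (y - P.y₁)) y = V₂ (y - P.y₁) :=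
        glue_of_ge (f := V₁) (g := fun y => V₂ (y - P.y₁)) h hmid
      simp only [e1, e2, e3]
      exact E₂ y (hmemR y hy h)

lemma gU_smul (r : ℝ) (Y₁ : (P.left m hm).Jet) (Y₂ : (P.right m hm).Jet) (y : ℝ) :
    gU (r • Y₁) (r • Y₂) y = r * gU Y₁ Y₂ y := by
  simp only [gU, glue, SingularBlock.U_smul]; split_ifs <;> rfl

lemma gV_smul (r : ℝ) (Y₁ : (P.left m hm).Jet) (Y₂ : (P.right m hm).Jet) (y : ℝ) :
    gV (r • Y₁) (r • Y₂) y = r * gV Y₁ Y₂ y := by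
  simp only [gV, glue, SingularBlock.V_smul]; split_ifs <;> rfl

lemma gU_delay (Y₁ : ℕ → (P.left m hm).Jet) (Y₂ : ℕ → (P.right m hm).Jet) (l n : ℕ) :
    gU (delay Y₁ l n) (delay Y₂ l n) = delay (fun n => gU (Y₁ n) (Y₂ n)) l n := by
  unfold delay
  split_ifs
  · rfl
  · funext y
    simpa using gU_smul 0 (0 : (P.left m hm).Jet) (0 : (P.right m hm).Jet) y

lemma gV_delay (Y₁ : ℕ → (P.left m hm).Jet) (Y₂ : ℕ → (P.right m hm).Jet) (l n : ℕ) :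
    gV (delay Y₁ l n) (delay Y₂ l n) = delay (fun n => gV (Y₁ n) (Y₂ n)) l n := by
  unfold delay
  split_ifs
  · rfl
  · funext y
    simpa using gV_smul 0 (0 : (P.left m hm).Jet) (0 : (P.right m hm).Jet) y

/-- Injectivity at the parameter where the maximum principle holds. -/
theorem jet_eq_zero {Y₁ : (P.left m hm).Jet} {Y₂ : (P.right m hm).Jet}
    (h₁ : (P.left m hm).JetEq (fun l => P.ε₀ ^ (l : ℕ) • Y₁) 0)
    (h₂ : (P.right m hm).JetEq (fun l => P.ε₀ ^ (l : ℕ) • Y₂) 0)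
    (hU : (P.left m hm).U Y₁ (P.y₁ / 2) = (P.right m hm).U Y₂ (P.y₁ / 2 - P.y₁))
    (hV : (P.left m hm).V Y₁ (P.y₁ / 2) = (P.right m hm).V Y₂ (P.y₁ / 2 - P.y₁)) :
    Y₁.1 = 0 ∧ Y₂.1 = 0 := by
  have hpos := P.y₁_pos
  obtain ⟨v', hJ, hE⟩ := exists_isJet_of_jetEq (f := 0) h₁ h₂ continuousOn_const continuousOn_const
    (fun x _ => by simp [leftQ]) (fun x _ => by simp [rightQ])
    (fun l => by simp only [SingularBlock.U_smul, hU])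
    (fun l => by simp only [SingularBlock.V_smul, hV])
  simp only [gU_smul, gV_smul, Fin.isValue, Fin.val_zero, pow_zero, one_smul] at hJ hE
  have hsub : Icc 0 P.y₁ ⊆ Icc 0 (P.y₁ + 1) := Icc_subset_Icc le_rfl (by linarith)
  have hz := (hJ.mono hsub).eq_zero (α := fun y => y * P.a y)
    (b := fun y => ∑ l : Fin 3, P.ε₀ ^ (l : ℕ) * P.b l y)
    (c := fun y => ∑ l : Fin 3, P.ε₀ ^ (l : ℕ) * P.c l y) hpos
    (fun x hx => mul_pos hx.1 (P.a_pos x hx.1.le hx.2)) (by simp) (by simp [P.a_zero])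
    P.b_left P.b_right P.c_neg (fun y hy => by
      rw [add_assoc, Finset.sum_mul, Finset.sum_mul, ← Finset.sum_add_distrib]
      refine Eq.trans ?_ (hE y (hsub hy))
      congr 1
      exact Finset.sum_congr rfl fun l _ => by ring)
  -- The glued function vanishes on `[0, y₁]`, that is, to the right of the first singular point and
  -- to the left of the second; a one-sided neighbourhood already forces the Taylor coefficients to
  -- vanish.
  constructor
  · refine SingularBlock.coeff_eq_zero _ ?_
    have : ∀ᶠ x in 𝓝[>] (0 : ℝ), (P.left m hm).U Y₁ x = 0 := by
      filter_upwards [Ioo_mem_nhdsGT (by linarith : (0 : ℝ) < P.y₁ / 2)] with x hx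
      have := hz x ⟨hx.1.le, by linarith [hx.2]⟩
      rwa [gU, glue_of_le hx.2.le] at this
    exact this.frequently.filter_mono (nhdsWithin_mono _ fun x hx => ne_of_gt hx)
  · refine SingularBlock.coeff_eq_zero _ ?_
    have : ∀ᶠ x in 𝓝[<] (0 : ℝ), (P.right m hm).U Y₂ x = 0 := by
      filter_upwards [Ioo_mem_nhdsLT (by linarith : -(P.y₁ / 2) < (0 : ℝ))] with x hx
      have := hz (P.y₁ + x) ⟨by linarith [hx.1], by linarith [hx.2]⟩
      rwa [gU, glue_of_ge (by linarith [hx.1]) hU, add_sub_cancel_left] at this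
    exact this.frequently.filter_mono (nhdsWithin_mono _ fun x hx => ne_of_lt hx)

/-- The jets of a chain with smooth data are smooth. -/
lemma smooth_chain {D : SingularBlock} (hD : |D.β 0 0| + 1 ≤ D.m) {Y : ℕ → D.Jet}
    {q : ℕ → (ℕ → ℝ) × (ℝ → ℝ)} (hq : ∀ n, ContDiffOn ℝ ∞ (q n).2 D.J.set)
    (h : ∀ n, D.JetEq (fun l => delay Y l n) (q n)) (n : ℕ) : ContDiffOn ℝ ∞ (D.U (Y n)) D.J.set := by
  refine SingularBlock.contDiffOn_U ?_
  induction n using Nat.strong_induction_on with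
  | _ n ih =>
    have h0 : delay Y ((0 : Fin 3) : ℕ) n = Y n := by simp [delay]
    -- Only the terms with `l = 0` involve the jet of index `n`; the others have smaller index and
    -- are smooth by induction.
    have key := (h n).smooth (hq n) hD fun l hl => by
      have hl' : 0 < (l : ℕ) := Fin.pos_iff_ne_zero.2 hl
      unfold delay
      split_ifs with hln
      · exact ih _ (by omega)
      · exact contDiffOn_const
    rwa [h0] at key

/-- Local form of the chain of solutions, on an interval containing both singular points. -/
theorem exists_local_chain (P : TwoPointPencil) {g : ℝ → ℝ} (hg : ContDiffOn ℝ ∞ g (Ici 0)) :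
    ∃ (N : ℕ) (u v v' : ℕ → ℝ → ℝ), ∀ n, IsJet (Icc 0 (P.y₁ + 1)) (u n) (v n) (v' n) ∧
      ContDiffOn ℝ ∞ (u n) (Icc 0 (P.y₁ / 2)) ∧ ContDiffOn ℝ ∞ (u n) (Icc (P.y₁ / 2) (P.y₁ + 1)) ∧
      ∀ y ∈ Icc 0 (P.y₁ + 1), y * P.a y * v' n y
        + ∑ l : Fin 3, (P.b l y * delay v l n y + P.c l y * delay u l n y)
        = if n = N then g y else 0 := by
  have hpos := P.y₁_pos
  -- The radius `|ε₀| + 1` covers both `0` and `ε₀`, and a common order `m` is then chosen for the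
  -- two blocks.
  have hL : 0 < |P.ε₀| + 1 := by positivity
  obtain ⟨m₁, hm₁⟩ := SingularBlock.exists_norm_pencil_lt P.leftInterval _ _
    (fun l => P.smooth_leftQ (P.smooth_b l)) (fun l => P.smooth_leftQ (P.smooth_c l)) (|P.ε₀| + 1)
  obtain ⟨m₂, hm₂⟩ := SingularBlock.exists_norm_pencil_lt P.rightInterval _ _
    (fun l => P.smooth_rightQ (P.smooth_b l)) (fun l => P.smooth_rightQ (P.smooth_c l)) (|P.ε₀| + 1)
  set m := max 2 (max m₁ m₂)
  have hm : 2 ≤ m := le_max_left _ _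
  obtain ⟨hβ₁, hK₁⟩ := hm₁ m ((le_max_left _ _).trans (le_max_right _ _)) hm
  obtain ⟨hβ₂, hK₂⟩ := hm₂ m ((le_max_right _ _).trans (le_max_right _ _)) hm
  have hg₁ := P.smooth_leftQ hg
  have hg₂ := P.smooth_rightQ hg
  obtain ⟨N, Y₁, Y₂, hY⟩ := exists_matched_chain (D₁ := P.left m hm) (D₂ := P.right m hm)
    (x₁ := ⟨_, P.mid_mem_left⟩) (x₂ := ⟨_, P.mid_mem_right⟩) hL (lt_add_one |P.ε₀|) hK₁ hK₂
    (fun Y₁ Y₂ h1 h2 h3 h4 => jet_eq_zero h1 h2 h3 h4)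
    ((P.left m hm).taylor (P.leftQ g)) ((P.right m hm).taylor (P.rightQ g))
  have hs₁ : ∀ n, ContDiffOn ℝ ∞
      (if n = N then (P.left m hm).taylor (P.leftQ g) else 0).2 P.leftInterval.set := fun n => by
    split_ifs
    · exact (P.left m hm).taylor_smooth hg₁
    · exact contDiffOn_const
  have hs₂ : ∀ n, ContDiffOn ℝ ∞
      (if n = N then (P.right m hm).taylor (P.rightQ g) else 0).2 P.rightInterval.set := fun n => by
    split_ifs
    · exact (P.right m hm).taylor_smooth hg₂
    · exact contDiffOn_const
  have hsol : ∀ n, ∃ v' : ℝ → ℝ, IsJet (Icc 0 (P.y₁ + 1)) (gU (Y₁ n) (Y₂ n)) (gV (Y₁ n) (Y₂ n)) v' ∧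
      ∀ y ∈ Icc 0 (P.y₁ + 1), y * P.a y * v' y
        + ∑ l : Fin 3, (P.b l y * delay (fun n => gV (Y₁ n) (Y₂ n)) l n y
          + P.c l y * delay (fun n => gU (Y₁ n) (Y₂ n)) l n y) = if n = N then g y else 0 := by
    intro n
    obtain ⟨h1, h2, h3, h4⟩ := hY n
    have key := exists_isJet_of_jetEq (f := if n = N then g else 0) h1 h2 (hs₁ n).continuousOn
      (hs₂ n).continuousOn
      (fun x hx => by
        split_ifs
        · exact ((P.left m hm).taylor_eq hg₁ hx).symm
        · simp [leftQ])
      (fun x hx => by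
        split_ifs
        · exact ((P.right m hm).taylor_eq hg₂ hx).symm
        · simp [rightQ])
      (fun l => by
        unfold delay
        split_ifs
        · exact (hY _).2.2.1
        · rw [SingularBlock.U_zero, SingularBlock.U_zero])
      (fun l => by
        unfold delay
        split_ifs
        · exact (hY _).2.2.2
        · rw [SingularBlock.V_zero, SingularBlock.V_zero])
    simp only [gU_delay, gV_delay] at key
    obtain ⟨v', hv1, hv2⟩ := key
    refine ⟨v', by simpa [delay] using hv1, fun y hy => ?_⟩
    rw [hv2 y hy]
    split_ifs <;> rfl
  choose v' hv' using hsol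
  refine ⟨N, fun n => gU (Y₁ n) (Y₂ n), fun n => gV (Y₁ n) (Y₂ n), v', fun n =>
    ⟨(hv' n).1, ?_, ?_, (hv' n).2⟩⟩
  · have h1 : ContDiffOn ℝ ∞ ((P.left m hm).U (Y₁ n)) (Icc 0 (P.y₁ / 2)) :=
      smooth_chain hβ₁ hs₁ (fun n => (hY n).1) n
    exact h1.congr fun y hy => glue_of_le hy.2
  · have h1 : ContDiffOn ℝ ∞ ((P.right m hm).U (Y₂ n)) P.rightInterval.set :=
      smooth_chain hβ₂ hs₂ (fun n => (hY n).2.1) n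
    have h2 : ContDiffOn ℝ ∞ (fun y => (P.right m hm).U (Y₂ n) (y - P.y₁))
        (Icc (P.y₁ / 2) (P.y₁ + 1)) :=
      h1.comp (by fun_prop) fun y hy => ⟨by simp only [rightInterval]; linarith [hy.1],
        by simp only [rightInterval]; linarith [hy.2]⟩
    exact h2.congr fun y hy => glue_of_ge hy.1 (hY n).2.2.1

end TwoPointPencil

end WaveBlowup

end

/-! ### Chains of smooth solutions on the half-line -/

noncomputable section

namespace WaveBlowup

open Set MeasureTheory Filter Topology

/-- The one-sided derivative on `[0, ∞)`. -/
def dHalf (f : ℝ → ℝ) : ℝ → ℝ := derivWithin f (Ici 0)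

lemma dHalf_smooth {f : ℝ → ℝ} (hf : ContDiffOn ℝ ∞ f (Ici 0)) : ContDiffOn ℝ ∞ (dHalf f) (Ici 0) :=
  hf.derivWithin (uniqueDiffOn_Ici 0) (by simp)

lemma hasDerivWithinAt_dHalf {f : ℝ → ℝ} (hf : ContDiffOn ℝ ∞ f (Ici 0)) {y : ℝ} (hy : 0 ≤ y) :
    HasDerivWithinAt f (dHalf f y) (Ici 0) y :=
  (hf.differentiableOn (by simp) y hy).hasDerivWithinAt

lemma dHalf_eq {f : ℝ → ℝ} {f' y : ℝ} (hy : 0 ≤ y) (h : HasDerivWithinAt f f' (Ici 0) y) :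
    dHalf f y = f' := h.derivWithin (uniqueDiffOn_Ici 0 y hy)

lemma IsJet.dHalf_eq {u v v' : ℝ → ℝ} (h : IsJet (Ici 0) u v v') {y : ℝ} (hy : 0 ≤ y) :
    dHalf u y = v y ∧ dHalf (dHalf u) y = v' y := by
  have h1 : ∀ y, 0 ≤ y → dHalf u y = v y := fun y hy => WaveBlowup.dHalf_eq hy (h y hy).1
  refine ⟨h1 y hy, WaveBlowup.dHalf_eq hy ((h y hy).2.congr (fun x hx => h1 x hx) (h1 y hy))⟩

namespace TwoPointPencil

/-- Smoothness of a solution across both singular points. -/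
lemma contDiffOn_of_isJet (P : TwoPointPencil) {u v v' F : ℝ → ℝ} (h : IsJet (Ici 0) u v v')
    (h₁ : ContDiffOn ℝ ∞ u (Icc 0 (P.y₁ / 2)))
    (h₂ : ContDiffOn ℝ ∞ u (Icc (P.y₁ / 2) (P.y₁ + 1))) (hF : ContDiffOn ℝ ∞ F (Ici 0))
    (hE : ∀ y ∈ Ici (0 : ℝ), y * P.a y * v' y + P.b 0 y * v y + P.c 0 y * u y = F y) :
    ContDiffOn ℝ ∞ u (Ici 0) := by
  have hpos := P.y₁_pos
  -- Away from `0` and `y₁` the equation is regular, so the solution is smooth there, in particular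
  -- at the points where pieces were glued; `h₁` covers `0` and `h₂` covers `y₁`.
  have key : ∀ S : Set ℝ, IsOpen S → S ⊆ Ioi 0 → (∀ y ∈ S, P.a y ≠ 0) → ContDiffOn ℝ ∞ u S := by
    intro S hS hS0 ha
    have hS' : S ⊆ Ici 0 := hS0.trans Ioi_subset_Ici_self
    exact (h.mono hS').contDiffOn hS.uniqueDiffOn
      (contDiffOn_id.mul (P.smooth_a.mono hS')) ((P.smooth_b 0).mono hS')
      ((P.smooth_c 0).mono hS') (hF.mono hS') (fun y hy => mul_ne_zero (ne_of_gt (hS0 hy)) (ha y hy))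
      fun y hy => hE y (hS' hy)
  intro x hx
  rcases lt_or_ge x (P.y₁ / 2) with h1 | h1
  · refine (h₁ x ⟨hx, h1.le⟩).mono_of_mem_nhdsWithin ?_
    filter_upwards [self_mem_nhdsWithin, mem_nhdsWithin_of_mem_nhds (Iio_mem_nhds h1)] with y hy hy'
    exact ⟨hy, le_of_lt hy'⟩
  rcases lt_trichotomy x P.y₁ with h2 | rfl | h2
  · have hx' : x ∈ Ioo 0 P.y₁ := ⟨by linarith, h2⟩
    exact ((key (Ioo 0 P.y₁) isOpen_Ioo (fun y hy => hy.1)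
      fun y hy => (P.a_pos y hy.1.le hy.2).ne').contDiffAt (isOpen_Ioo.mem_nhds hx')).contDiffWithinAt
  · exact (h₂.contDiffAt (Icc_mem_nhds (by linarith) (by linarith))).contDiffWithinAt
  · exact ((key (Ioi P.y₁) isOpen_Ioi (fun y hy => hpos.trans hy)
      fun y hy => (P.a_neg y hy).ne).contDiffAt (isOpen_Ioi.mem_nhds h2)).contDiffWithinAt

/-- A chain of smooth solutions on `[0, ∞)`: the coefficients of a power series in `ε` solving the
pencil equation with right-hand side `ε ^ N g`. -/
theorem exists_chain (P : TwoPointPencil) {g : ℝ → ℝ} (hg : ContDiffOn ℝ ∞ g (Ici 0)) :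
    ∃ (N : ℕ) (u : ℕ → ℝ → ℝ), ∀ n, ContDiffOn ℝ ∞ (u n) (Ici 0) ∧
      ∀ y ∈ Ici (0 : ℝ), y * P.a y * dHalf (dHalf (u n)) y
        + ∑ l : Fin 3, (P.b l y * dHalf (delay u l n) y + P.c l y * delay u l n y)
        = if n = N then g y else 0 := by
  have hpos := P.y₁_pos
  obtain ⟨N, u₀, v₀, v₀', h₀⟩ := P.exists_local_chain hg
  set R := P.y₁ + 1 with hR
  have hR0 : 0 ≤ R := by linarith
  -- The terms with `l ≥ 1` involve only earlier members of the chain and count as a source.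
  set rest : (ℕ → ℝ → ℝ) → ℕ → ℝ → ℝ := fun s n y =>
    ∑ l : Fin 2, (P.b l.succ y * dHalf (delay s l.succ n) y + P.c l.succ y * delay s l.succ n y)
    with hrest
  have hdelay : ∀ (s s' : ℕ → ℝ → ℝ) (n : ℕ), (∀ k < n, s k = s' k) → ∀ l : Fin 2,
      delay s l.succ n = delay s' l.succ n := by
    intro s s' n hs l
    unfold delay
    split_ifs with hl
    · refine hs _ ?_
      have : 0 < (l.succ : ℕ) := by simp
      omega
    · rfl
  -- The local chain is continued beyond `R` one index at a time, because the source of index `n`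
  -- uses the earlier members on the whole half-line. Agreement with `u₀` on `[0, R]` is carried
  -- along so that the equation remains consistent there.
  obtain ⟨u, hu⟩ := exists_seq_of_forall_exists
    (fun n s w => ContDiffOn ℝ ∞ w (Ici 0) ∧ EqOn w (u₀ n) (Icc 0 R) ∧
      ∀ y ∈ Ici (0 : ℝ), y * P.a y * dHalf (dHalf w) y + P.b 0 y * dHalf w y + P.c 0 y * w y
        = (if n = N then g y else 0) - rest s n y)
    (fun n s s' w hs ⟨h1, h2, h3⟩ => ⟨h1, h2, fun y hy => by
      rw [h3 y hy]
      simp only [hrest, hdelay s s' n hs]⟩)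
    (fun n s hs => by
      have hds : ∀ l : Fin 2, ContDiffOn ℝ ∞ (delay s l.succ n) (Ici 0) := fun l => by
        unfold delay
        split_ifs with hl
        · refine (hs _ ?_).1
          have : 0 < (l.succ : ℕ) := by simp
          omega
        · exact contDiffOn_const
      have hF : ContDiffOn ℝ ∞ (fun y => (if n = N then g y else 0) - rest s n y) (Ici 0) := by
        refine ContDiffOn.sub ?_ (ContDiffOn.sum fun l _ => ?_)
        · split_ifs
          · exact hg
          · exact contDiffOn_const
        · exact ((P.smooth_b _).mul (dHalf_smooth (hds l))).add ((P.smooth_c _).mul (hds l))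
      have hds₀ : ∀ l : Fin 2, ∀ y ∈ Icc 0 R, dHalf (delay s l.succ n) y = delay v₀ l.succ n y ∧
          delay s l.succ n y = delay u₀ l.succ n y := by
        intro l y hy
        have hD := hasDerivWithinAt_dHalf (hds l) hy.1
        revert hD
        unfold delay
        split_ifs with hl
        · intro hD
          have hlt : n - (l.succ : ℕ) < n := by
            have : 0 < (l.succ : ℕ) := by simp
            omega
          have he := (hs _ hlt).2.1
          refine ⟨?_, he hy⟩
          have h1 := ((hD.mono Icc_subset_Ici_self).congr (fun x hx => (he hx).symm) (he hy).symm)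
          exact (uniqueDiffOn_Icc (by linarith : (0 : ℝ) < R) y hy).eq_deriv _ h1
            ((h₀ _).1 y hy).1
        · intro _
          exact ⟨WaveBlowup.dHalf_eq hy.1 (hasDerivWithinAt_const _ _ _), rfl⟩
      have hE₀ : ∀ y ∈ Icc 0 R, y * P.a y * v₀' n y + P.b 0 y * v₀ n y + P.c 0 y * u₀ n y
          = (if n = N then g y else 0) - rest s n y := by
        intro y hy
        have h1 := (h₀ n).2.2.2 y hy
        rw [Fin.sum_univ_succ] at h1
        have h2 : rest s n y = ∑ l : Fin 2, (P.b l.succ y * delay v₀ l.succ n y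
            + P.c l.succ y * delay u₀ l.succ n y) :=
          Finset.sum_congr rfl fun l _ => by rw [(hds₀ l y hy).1, (hds₀ l y hy).2]
        rw [← h1, h2]
        simp only [delay, Fin.val_zero, zero_le, if_true, Nat.sub_zero]
        ring
      have hsub : Ici R ⊆ Ici 0 := Ici_subset_Ici.2 hR0
      have hne : ∀ x ∈ Ici R, x * P.a x ≠ 0 := fun x hx =>
        mul_ne_zero (by have := mem_Ici.1 hx; linarith)
          (P.a_neg x (by have := mem_Ici.1 hx; linarith)).ne
      obtain ⟨u₂, v₂, v₂', hJ₂, hu₂, hv₂, hE₂⟩ := exists_isJet_Ici (u₀ := u₀ n R) (v₀ := v₀ n R)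
        (continuousOn_id.mul (P.smooth_a.continuousOn.mono hsub))
        ((P.smooth_b 0).continuousOn.mono hsub) ((P.smooth_c 0).continuousOn.mono hsub)
        (hF.continuousOn.mono hsub) hne
      have hRR : R ∈ Icc 0 R := ⟨hR0, le_rfl⟩
      -- The equation at `R`, where the leading coefficient is nonzero, determines the second
      -- derivative from the common values of `u` and `u'`.
      have hv' : v₀' n R = v₂' R := by
        have e1 := hE₀ R hRR
        have e2 : R * P.a R * v₂' R + P.b 0 R * v₂ R + P.c 0 R * u₂ R = _ := hE₂ R self_mem_Ici
        rw [hu₂, hv₂] at e2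
        exact mul_left_cancel₀ (hne R self_mem_Ici) (by linarith)
      have hJ : IsJet (Ici 0) (glue R (u₀ n) u₂) (glue R (v₀ n) v₂) (glue R (v₀' n) v₂') :=
        IsJet.glue ((h₀ n).1.mono fun y hy => ⟨hy.1, hy.2⟩) (hJ₂.mono inter_subset_right)
          hu₂.symm hv₂.symm hv'
      have hE : ∀ y ∈ Ici (0 : ℝ), y * P.a y * glue R (v₀' n) v₂' y
          + P.b 0 y * glue R (v₀ n) v₂ y + P.c 0 y * glue R (u₀ n) u₂ y
          = (if n = N then g y else 0) - rest s n y := by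
        intro y hy
        rcases le_total y R with h | h
        · rw [glue_of_le h, glue_of_le h, glue_of_le h]
          exact hE₀ y ⟨hy, h⟩
        · rw [glue_of_ge h hv', glue_of_ge h hv₂.symm, glue_of_ge h hu₂.symm]
          exact hE₂ y h
      refine ⟨glue R (u₀ n) u₂, P.contDiffOn_of_isJet hJ ?_ ?_ hF hE, fun y hy => glue_of_le hy.2,
        fun y hy => ?_⟩
      · exact (h₀ n).2.1.congr fun y hy => glue_of_le (by linarith [hy.2])
      · exact (h₀ n).2.2.1.congr fun y hy => glue_of_le hy.2
      · rw [(hJ.dHalf_eq hy).1, (hJ.dHalf_eq hy).2]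
        exact hE y hy)
  refine ⟨N, u, fun n => ⟨(hu n).1, fun y hy => ?_⟩⟩
  have h1 := (hu n).2.2 y hy
  rw [Fin.sum_univ_succ]
  have h2 : delay u ((0 : Fin 3) : ℕ) n = u n := by simp [delay]
  rw [h2]
  simp only [hrest] at h1
  linarith

end TwoPointPencil

end WaveBlowup

end

/-! ### The profile in the variable `y = Z²` and the algebra of the sonic point -/

noncomputable section

namespace WaveBlowup

open Set MeasureTheory Filter Topology

/-- The leading-order profile in the variable `y = Z ^ 2`: the velocity is `v = Z q (y)`, the phase
is `Φ (y)` and the modulus is `R (y)`. -/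
structure RadialProfile (d p : ℕ) (β : ℝ) where
  /-- the velocity divided by `Z` -/
  q : ℝ → ℝ
  /-- the phase -/
  Φ : ℝ → ℝ
  /-- the modulus -/
  R : ℝ → ℝ
  /-- the sonic point -/
  y₁ : ℝ
  smooth_q : ContDiffOn ℝ ∞ q (Ici 0)
  smooth_Φ : ContDiffOn ℝ ∞ Φ (Ici 0)
  smooth_R : ContDiffOn ℝ ∞ R (Ici 0)
  e_pos : ∀ y, 0 ≤ y → 0 < 1 - y * q y
  w_pos : ∀ y, 0 ≤ y → 0 < 1 - y * q y ^ 2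
  Φ_pos : ∀ y, 0 ≤ y → 0 < Φ y
  R_pos : ∀ y, 0 ≤ y → 0 < R y
  Φ_deriv : ∀ y, 0 ≤ y → dHalf Φ y = (β - 1) * Φ y / (1 - y * q y) * q y / 2
  R_pow : ∀ y, 0 ≤ y → R y ^ (p - 1) = ((β - 1) * Φ y / (1 - y * q y)) ^ 2 * (1 - y * q y ^ 2)
  ode : ∀ y, 0 ≤ y → ((1 - y * q y) ^ 2 - ell p * (y * (1 - q y) ^ 2)) * (q y + 2 * y * dHalf q y)
    = (1 - y * q y ^ 2) * (β * ell p * (1 - y * q y ^ 2) - ((d : ℝ) - 1) * q y * (1 - y * q y))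
  y₁_pos : 0 < y₁
  one_sub_q_pos : 0 < 1 - q y₁
  disc_pos : ∀ y, 0 ≤ y → y < y₁ → 0 < (1 - y * q y) ^ 2 - ell p * (y * (1 - q y) ^ 2)
  disc_neg : ∀ y, y₁ < y → (1 - y * q y) ^ 2 - ell p * (y * (1 - q y) ^ 2) < 0
  disc_zero : (1 - y₁ * q y₁) ^ 2 - ell p * (y₁ * (1 - q y₁) ^ 2) = 0
  disc_deriv : dHalf (fun y => (1 - y * q y) ^ 2 - ell p * (y * (1 - q y) ^ 2)) y₁ ≠ 0

lemma pos_of_ne_zero_of_isPreconnected {s : Set ℝ} (hs : IsPreconnected s) {f : ℝ → ℝ}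
    (hf : ContinuousOn f s) (h0 : ∀ x ∈ s, f x ≠ 0) {a : ℝ} (ha : a ∈ s) (hfa : 0 < f a) {x : ℝ}
    (hx : x ∈ s) : 0 < f x := by
  by_contra! h
  obtain ⟨z, hz, hz0⟩ := hs.intermediate_value hx ha hf ⟨h, hfa.le⟩
  exact h0 z hz hz0

lemma one_lt_ell {p : ℕ} (hp : 3 ≤ p) : 1 < ell p := by
  have : (3 : ℝ) ≤ p := by exact_mod_cast hp
  have h : 0 < 4 / ((p : ℝ) - 1) := div_pos (by norm_num) (by linarith)
  unfold ell
  linarith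

/-- A solution of the profile equation never reaches the line `Z v = 1`. -/
lemma IsProfile.mul_lt_one {d p : ℕ} {β : ℝ} {v : ℝ → ℝ} (hβ : 1 < β) (hp : 3 ≤ p)
    (hv : IsProfile d p β v) {Z : ℝ} (hZ : 0 ≤ Z) : Z * v Z < 1 := by
  have hd : ∀ x, 0 ≤ x → HasDerivWithinAt (fun x => x * v x) (1 * v x + x * dHalf v x) (Ici 0) x :=
    fun x hx => (hasDerivWithinAt_id x _).mul (hasDerivWithinAt_dHalf hv.odd.1 hx)
  -- Where `x v = 1`, the equation reduces to `v' = -β / x²`, so `(x v)' = (1 - β) / x` is negative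
  -- and the line `x v = 1` can only be crossed downwards.
  have key : ∀ x, 0 ≤ x → x * v x = 1 → 1 * v x + x * dHalf v x < 0 := by
    intro x hx h1
    have hx0 : x ≠ 0 := by rintro rfl; simp at h1
    have hxp : 0 < x := lt_of_le_of_ne hx (Ne.symm hx0)
    obtain ⟨hl, hr⟩ := hv.mem_Ioo x hx
    have hode := hv.ode x hx
    have hl1 := one_lt_ell hp
    have hvx : v x = 1 / x := by field_simp; linarith
    -- If `x = 1` then `v = 1`, which is excluded by `v < 1`; hence the common factor can be
    -- cancelled.
    have hne : 1 - x ^ 2 ≠ 0 := by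
      intro h
      have : x = 1 := by nlinarith
      rw [this] at h1 hr
      linarith
    change DeltaZ p x (v x) * dHalf v x = _ at hode
    unfold DeltaZ DeltaV at hode
    rw [hvx] at hode ⊢
    set D := dHalf v x
    have e1 : x * ((1 - x * (1 / x)) ^ 2 - ell p * (1 / x - x) ^ 2) * D
        = (1 - x ^ 2) ^ 2 * ell p * (-D / x) := by field_simp; ring
    have e2 : (1 - (1 / x) ^ 2) * (β * ell p * (1 - (1 / x) ^ 2) * x
        - ((d : ℝ) - 1) * (1 / x) * (1 - x * (1 / x))) = (1 - x ^ 2) ^ 2 * ell p * (β / x ^ 3) := by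
      field_simp; ring
    rw [e1, e2] at hode
    have h3 := mul_left_cancel₀ (mul_ne_zero (pow_ne_zero 2 hne) (by linarith : ell p ≠ 0)) hode
    have h4 : D = -β / x ^ 2 := by field_simp at h3 ⊢; linarith
    rw [h4]
    have : 1 * (1 / x) + x * (-β / x ^ 2) = (1 - β) / x := by field_simp; ring
    rw [this]
    exact div_neg_of_neg_of_pos (by linarith) hxp
  have hle : ∀ x, 0 ≤ x → x * v x ≤ 1 := fun x hx =>
    image_le_of_deriv_right_lt_deriv_boundary (a := 0) (b := x) (B := fun _ => 1) (B' := fun _ => 0)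
      (fun y hy => (hd y hy.1).continuousWithinAt.mono Icc_subset_Ici_self)
      (fun y hy => (hd y hy.1).mono (Ici_subset_Ici.2 hy.1)) (by simp)
      (fun y => hasDerivAt_const _ _) (fun y hy h => key y hy.1 h) ⟨hx, le_rfl⟩
  -- Equality would be attained at an interior maximum of `x v`, where the derivative is zero
  -- instead of negative.
  refine lt_of_le_of_ne (hle Z hZ) fun h => ?_
  have hZ0 : 0 < Z := lt_of_le_of_ne hZ (by rintro rfl; simp at h)
  have h1 : IsLocalMax (fun x => x * v x) Z := by
    filter_upwards [Ici_mem_nhds hZ0] with x hx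
    rw [h]
    exact hle x hx
  have h2 := h1.hasDerivAt_eq_zero ((hd Z hZ).hasDerivAt (Ici_mem_nhds hZ0))
  exact (key Z hZ h).ne h2

/-- The algebra behind the transversality at the sonic point. -/
lemma sonic_algebra {β l k y e X e' X' : ℝ} (hk : k ≠ 0) (hl : l ≠ 0) (he : 0 < e) (hX : X ≠ 0)
    (h1 : e ^ 2 = l * (y * X ^ 2)) (h2 : 2 * e * e' = l * (X ^ 2 + 2 * y * X * X'))
    (h3 : β * l * (e ^ 2 - y * X ^ 2) = k * e * (e - X))
    (h4 : β * l * (2 * e * e' - (X ^ 2 + 2 * y * X * X'))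
      = k * (e' * (e - X) + e * (e' - X'))) : False := by
  -- Here `h1`, `h2` express a double zero of `e² - l y X²`, and `h3`, `h4` the vanishing of the
  -- numerator and of its derivative. Substituting the first pair into the second gives `e' X = e
  -- X'`, after which `h2` collapses to `l X² e = 0`.
  have h5 : β * (l - 1) * e = k * (e - X) := by
    refine mul_left_cancel₀ he.ne' ?_
    linear_combination h3 - β * h1
  have h6 : β * (l - 1) * (2 * e * e') = k * (e' * (e - X) + e * (e' - X')) := by
    linear_combination h4 - β * h2
  have h7 : e' * X = e * X' := by
    refine mul_left_cancel₀ hk ?_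
    linear_combination -h6 + 2 * e' * h5
  have h8 : l * (X ^ 2 * e) = 0 := by
    linear_combination -e * h2 + 2 * e' * h1 + 2 * l * y * X * h7
  exact mul_ne_zero hl (mul_ne_zero (pow_ne_zero 2 hX) he.ne') h8

/-- The algebra locating the sonic point. -/
lemma sonic_location {β l k r s Z v : ℝ} (hl : r ^ 2 = l) (hs : s ^ 2 = 1)
    (he : 0 < 1 - Z * v) (h1 : 1 - Z * v = s * r * (Z - v))
    (h2 : β * l * (1 - v ^ 2) * Z = k * v * (1 - Z * v)) :
    l * (Z * (k - β * (l - 1))) = k * s * r := by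
  have hX : Z - v ≠ 0 := by
    intro h
    rw [h, mul_zero] at h1
    exact he.ne' h1
  refine mul_left_cancel₀ (pow_ne_zero 2 hX) ?_
  set X := Z - v
  -- This rests on the identity `(1 - Z v)² - (Z - v)² = (1 - Z²)(1 - v²)`.
  have h3 : (l - 1) * X ^ 2 = (1 - Z ^ 2) * (1 - v ^ 2) := by
    have : (1 - Z * v) ^ 2 = l * X ^ 2 := by rw [h1, ← hl]; linear_combination r ^ 2 * X ^ 2 * hs
    simp only [X] at this ⊢
    linear_combination -this
  have h4 : (1 - Z ^ 2) * v = Z * (1 - Z * v) - X := by simp only [X]; ring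
  have h5 : β * l * Z * ((l - 1) * X ^ 2) = k * (1 - Z * v) * (Z * (1 - Z * v) - X) := by
    rw [h3, ← h4]; linear_combination (1 - Z ^ 2) * h2
  rw [h1] at h5
  linear_combination -h5 - k * Z * X ^ 2 * r ^ 2 * hs - k * Z * X ^ 2 * hl

end WaveBlowup

end

/-! ### Passage to `y = Z²`, existence, uniqueness and simplicity of the sonic point -/

noncomputable section

namespace WaveBlowup

open Set MeasureTheory Filter Topology

lemma contDiffOn_of_hasDerivWithinAt {f f' : ℝ → ℝ} (hf' : ContDiffOn ℝ ∞ f' (Ici 0))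
    (h : ∀ y ∈ Ici (0 : ℝ), HasDerivWithinAt f (f' y) (Ici 0) y) : ContDiffOn ℝ ∞ f (Ici 0) := by
  rw [contDiffOn_infty_iff_derivWithin (uniqueDiffOn_Ici 0)]
  exact ⟨fun y hy => (h y hy).differentiableWithinAt,
    hf'.congr fun y hy => dHalf_eq hy (h y hy)⟩

/-- A smooth function on `[0, ∞)` has a smooth primitive. -/
lemma exists_primitive {f : ℝ → ℝ} (hf : ContDiffOn ℝ ∞ f (Ici 0)) :
    ∃ F : ℝ → ℝ, ContDiffOn ℝ ∞ F (Ici 0) ∧ F 0 = 0 ∧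
      ∀ Z, 0 ≤ Z → ∫ s in (0 : ℝ)..Z, 2 * s * f (s ^ 2) = F (Z ^ 2) ∧
      ∀ y ∈ Ici (0 : ℝ), HasDerivWithinAt F (f y) (Ici 0) y := by
  set g : ℝ → ℝ := fun r => f (max r 0) with hg
  have hgc : Continuous g := hf.continuousOn.comp_continuous (by fun_prop) fun x => mem_Ici.2 (le_max_right _ _)
  have hgf : ∀ r, 0 ≤ r → g r = f r := fun r hr => by simp only [hg, max_eq_left hr]
  have hD : ∀ y, HasDerivAt (fun x => ∫ r in (0 : ℝ)..x, g r) (g y) y := hasDerivAt_primitive hgc 0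
  have hD' : ∀ y ∈ Ici (0 : ℝ), HasDerivWithinAt (fun x => ∫ r in (0 : ℝ)..x, g r) (f y) (Ici 0) y :=
    fun y hy => by
      rw [← hgf y hy]
      exact (hD y).hasDerivWithinAt
  refine ⟨_, contDiffOn_of_hasDerivWithinAt hf hD', by simp, fun Z hZ => ⟨?_, hD'⟩⟩
  have h1 : ∀ s : ℝ, HasDerivAt (fun s => ∫ r in (0 : ℝ)..s ^ 2, g r) (2 * s * g (s ^ 2)) s := by
    intro s
    have := (hD (s ^ 2)).comp s (hasDerivAt_pow 2 s)
    refine this.congr_deriv ?_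
    push_cast
    ring
  have h2 := intervalIntegral.integral_eq_sub_of_hasDerivAt (a := 0) (b := Z) (fun s _ => h1 s)
    ((by fun_prop : Continuous fun s => 2 * s * g (s ^ 2)).intervalIntegrable _ _)
  rw [show ∫ s in (0 : ℝ)..Z, 2 * s * f (s ^ 2) = ∫ s in (0 : ℝ)..Z, 2 * s * g (s ^ 2) from
    intervalIntegral.integral_congr fun s _ => by rw [hgf _ (sq_nonneg s)], h2]
  simp

/-- The velocity in the variable `y = Z ^ 2`. -/
theorem exists_velocity {d p : ℕ} {β : ℝ} (hβ : 1 < β) (hp : 3 ≤ p) {v : ℝ → ℝ}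
    (hv : IsProfile d p β v) : ∃ q : ℝ → ℝ, ContDiffOn ℝ ∞ q (Ici 0) ∧
      (∀ Z, 0 ≤ Z → v Z = Z * q (Z ^ 2)) ∧ (∀ y, 0 ≤ y → 0 < 1 - y * q y) ∧
      (∀ y, 0 ≤ y → 0 < 1 - y * q y ^ 2) ∧
      ∀ y, 0 ≤ y →
        ((1 - y * q y) ^ 2 - ell p * (y * (1 - q y) ^ 2)) * (q y + 2 * y * dHalf q y)
        = (1 - y * q y ^ 2) *
          (β * ell p * (1 - y * q y ^ 2) - ((d : ℝ) - 1) * q y * (1 - y * q y)) := by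
  obtain ⟨q, hq, hvq⟩ := hv.odd.2
  simp only [smul_eq_mul] at hvq
  have hsq : ∀ y, 0 ≤ y → √y ^ 2 = y := fun y hy => Real.sq_sqrt hy
  refine ⟨q, hq, hvq, fun y hy => ?_, fun y hy => ?_, ?_⟩
  · have h1 := hv.mul_lt_one hβ hp (Real.sqrt_nonneg y)
    rw [hvq _ (Real.sqrt_nonneg y), ← mul_assoc, ← sq, hsq y hy] at h1
    linarith
  · obtain ⟨h1, h2⟩ := hv.mem_Ioo _ (Real.sqrt_nonneg y)
    have h3 : v √y ^ 2 < 1 := by nlinarith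
    rw [hvq _ (Real.sqrt_nonneg y), mul_pow, hsq y hy] at h3
    linarith
  -- For `y > 0` the profile equation is divided by `Z = √y`; the case `y = 0` follows by
  -- continuity.
  · have hpos : EqOn (fun y => ((1 - y * q y) ^ 2 - ell p * (y * (1 - q y) ^ 2))
          * (q y + 2 * y * dHalf q y))
        (fun y => (1 - y * q y ^ 2) *
          (β * ell p * (1 - y * q y ^ 2) - ((d : ℝ) - 1) * q y * (1 - y * q y))) (Ioi 0) := by
      intro y hy
      have hy0 : (0 : ℝ) < y := hy
      have hZ : 0 < √y := Real.sqrt_pos.2 hy0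
      have hode := hv.ode _ hZ.le
      have hder : dHalf v √y = q y + 2 * y * dHalf q y := by
        have h1 : HasDerivWithinAt q (dHalf q y) (Ici 0) (√y ^ 2) := by
          rw [hsq y hy0.le]; exact hasDerivWithinAt_dHalf hq hy0.le
        have h2 : HasDerivWithinAt (fun Z : ℝ => Z ^ 2) (2 * √y) (Ici 0) √y := by
          simpa using (hasDerivAt_pow 2 √y).hasDerivWithinAt
        have h2' : HasDerivWithinAt (fun Z : ℝ => q (Z ^ 2)) (dHalf q y * (2 * √y)) (Ici 0) √y :=
          HasDerivWithinAt.comp (h := fun Z : ℝ => Z ^ 2) √y h1 h2 fun Z _ => sq_nonneg Z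
        have h3 := (hasDerivWithinAt_id √y (Ici 0)).mul h2'
        have h4 := h3.congr (f₁ := v) (fun Z hZ => hvq Z hZ) (hvq _ hZ.le)
        rw [dHalf_eq hZ.le h4]
        simp only [id, hsq y hy0.le]
        have := hsq y hy0.le
        linear_combination 2 * dHalf q y * this
      change DeltaZ p √y (v √y) * dHalf v √y = _ at hode
      rw [hder, hvq _ hZ.le, hsq y hy0.le] at hode
      unfold DeltaZ DeltaV at hode
      refine mul_left_cancel₀ hZ.ne' ?_
      have h5 := hsq y hy0.le
      generalize √y = Z at *
      subst h5
      linear_combination hode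
    have hc := hq.continuousOn
    have hc' := (dHalf_smooth hq).continuousOn
    intro y hy
    exact hpos.of_subset_closure (t := Ici 0) (by fun_prop) (by fun_prop) Ioi_subset_Ici_self
      (by rw [closure_Ioi]) hy

/-- The unique sonic point. -/
theorem exists_sonic_point {d p : ℕ} {β : ℝ} (hβ : 1 < β) (hp : 3 ≤ p)
    (hk : β * (ell p + √(ell p)) < (d : ℝ) - 1) {q : ℝ → ℝ} (hq : ContDiffOn ℝ ∞ q (Ici 0))
    (he : ∀ y, 0 ≤ y → 0 < 1 - y * q y) (hw : ∀ y, 0 ≤ y → 0 < 1 - y * q y ^ 2)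
    (hode : ∀ y, 0 ≤ y →
        ((1 - y * q y) ^ 2 - ell p * (y * (1 - q y) ^ 2)) * (q y + 2 * y * dHalf q y)
        = (1 - y * q y ^ 2) *
          (β * ell p * (1 - y * q y ^ 2) - ((d : ℝ) - 1) * q y * (1 - y * q y))) :
    ∃ y₁, 0 < y₁ ∧ 0 < 1 - q y₁ ∧
      (∀ y, 0 ≤ y → y < y₁ → 0 < (1 - y * q y) ^ 2 - ell p * (y * (1 - q y) ^ 2)) ∧
      (∀ y, y₁ < y → (1 - y * q y) ^ 2 - ell p * (y * (1 - q y) ^ 2) < 0) ∧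
      (1 - y₁ * q y₁) ^ 2 - ell p * (y₁ * (1 - q y₁) ^ 2) = 0 ∧
      dHalf (fun y => (1 - y * q y) ^ 2 - ell p * (y * (1 - q y) ^ 2)) y₁ ≠ 0 := by
  have hl1 := one_lt_ell hp
  set l := ell p
  set r := √l
  set k := (d : ℝ) - 1
  have hr2 : r ^ 2 = l := Real.sq_sqrt (by linarith)
  have hr0 : 0 < r := Real.sqrt_pos.2 (by linarith)
  have hr1 : 1 < r := by nlinarith
  have hkpos : 0 < k := lt_trans (by positivity) hk
  have hkl : 0 < k - β * (l - 1) := by nlinarith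
  have hc := hq.continuousOn
  set D : ℝ → ℝ := fun y => (1 - y * q y) ^ 2 - l * (y * (1 - q y) ^ 2) with hD
  have hDc : ContinuousOn D (Ici 0) := by fun_prop
  set Z₁ := k * r / (l * (k - β * (l - 1))) with hZ₁
  have hZ₁pos : 0 < Z₁ := by positivity
  -- At a zero of `D` the right side of the equation vanishes too; these two conditions determine
  -- `Z`, which gives uniqueness.
  have hloc : ∀ y, 0 ≤ y → D y = 0 → y = Z₁ ^ 2 ∧ 1 - y * q y = r * (√y * (1 - q y)) := by
    intro y hy h0
    have hZ := Real.sqrt_nonneg y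
    have hs := Real.sq_sqrt hy
    have hb : β * l * (1 - y * q y ^ 2) = k * q y * (1 - y * q y) := by
      have := hode y hy
      change D y * _ = _ at this
      rw [h0, zero_mul] at this
      rcases mul_eq_zero.1 this.symm with h | h
      · exact absurd h (hw y hy).ne'
      · linarith
    have hfac : (1 - y * q y - r * (√y * (1 - q y))) * (1 - y * q y + r * (√y * (1 - q y))) = 0 := by
      have : D y = (1 - y * q y) ^ 2 - l * (y * (1 - q y) ^ 2) := rfl
      rw [h0] at this
      linear_combination -this - r ^ 2 * (1 - q y) ^ 2 * hs - y * (1 - q y) ^ 2 * hr2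
    have hpos : 0 < 1 - √y * (√y * q y) := by
      rw [← mul_assoc, ← sq, hs]; exact he y hy
    have hode' : β * l * (1 - (√y * q y) ^ 2) * √y = k * (√y * q y) * (1 - √y * (√y * q y)) := by
      have e1 : (√y * q y) ^ 2 = y * q y ^ 2 := by rw [mul_pow, hs]
      have e2 : √y * (√y * q y) = y * q y := by rw [← mul_assoc, ← sq, hs]
      rw [e1, e2]
      linear_combination √y * hb
    have e2 : √y * (√y * q y) = y * q y := by rw [← mul_assoc, ← sq, hs]
    rcases mul_eq_zero.1 hfac with h | h
    · have h1 := sonic_location (s := 1) hr2 (by norm_num) hpos (by rw [e2]; linear_combination h) hode'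
      refine ⟨?_, by linarith⟩
      have : √y = Z₁ := by
        rw [hZ₁, eq_div_iff (by positivity)]
        linarith
      rw [← this, hs]
    -- The other sign would make a nonnegative quantity equal to `-k r < 0`.
    · have h1 := sonic_location (s := -1) hr2 (by norm_num) hpos (by rw [e2]; linear_combination h)
        hode'
      have h2 : 0 ≤ l * (√y * (k - β * (l - 1))) := by positivity
      nlinarith [mul_pos hkpos hr0]
  have hD0 : 0 < D 0 := by simp [hD]
  -- At `y = 1` the discriminant is `(1 - ℓ)(1 - q)²`, and `1 - q` is positive there.
  have hD1 : D 1 < 0 := by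
    have h1 := he 1 zero_le_one
    simp only [hD, one_mul] at h1 ⊢
    nlinarith [mul_pos h1 h1]
  obtain ⟨y₁, ⟨hy0, hy1⟩, hy₁⟩ : ∃ y ∈ Icc (0 : ℝ) 1, D y = 0 :=
    intermediate_value_Icc' zero_le_one (hDc.mono Icc_subset_Ici_self) ⟨hD1.le, hD0.le⟩
  have hy1' : y₁ < 1 := lt_of_le_of_ne hy1 (by rintro rfl; exact hD1.ne hy₁)
  have hy0' : 0 < y₁ := lt_of_le_of_ne hy0 (by rintro rfl; exact hD0.ne' hy₁)
  have huniq : ∀ y, 0 ≤ y → D y = 0 → y = y₁ := fun y hy h => by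
    rw [(hloc y hy h).1, ← (hloc y₁ hy0 hy₁).1]
  have hX : 0 < 1 - q y₁ := by
    have h1 := (hloc y₁ hy0 hy₁).2
    have h2 := he y₁ hy0
    rw [h1] at h2
    have h3 := (mul_pos_iff_of_pos_left hr0).1 h2
    exact (mul_pos_iff_of_pos_left (Real.sqrt_pos.2 hy0')).1 h3
  refine ⟨y₁, hy0', hX, fun y hy hlt => ?_, fun y hlt => ?_, hy₁, fun hder => ?_⟩
  · exact pos_of_ne_zero_of_isPreconnected (s := Ico 0 y₁) isPreconnected_Ico
      (hDc.mono fun x hx => hx.1) (fun x hx h => hx.2.ne (huniq x hx.1 h)) ⟨le_rfl, hy0'⟩ hD0 ⟨hy, hlt⟩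
  · have h1 := pos_of_ne_zero_of_isPreconnected (s := Ioi y₁) (f := fun y => -D y) isPreconnected_Ioi
      (hDc.neg.mono fun x hx => hy0.trans (le_of_lt hx))
      (fun x hx h => (ne_of_gt hx) (huniq x (hy0.trans (le_of_lt hx)) (neg_eq_zero.1 h)))
      (a := 1) hy1' (by simpa using hD1) hlt
    have h1' : 0 < -D y := h1
    change D y < 0
    linarith
  -- Simplicity of the zero: if the derivative of `D` vanished as well, differentiating the equation
  -- `D * (…) = w * B` at `y₁` would give `B = 0` and `B' = 0`, which `sonic_algebra` excludes.
  · have hnh := Ici_mem_nhds hy0'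
    have hqd : HasDerivAt q (dHalf q y₁) y₁ := (hasDerivWithinAt_dHalf hq hy0).hasDerivAt hnh
    set q' := dHalf q y₁
    have hed : HasDerivAt (fun y => 1 - y * q y) (-(1 * q y₁ + y₁ * q')) y₁ :=
      ((hasDerivAt_id y₁).mul hqd).const_sub 1
    have hXd : HasDerivAt (fun y => y * (1 - q y) ^ 2)
        (1 * (1 - q y₁) ^ 2 + y₁ * (2 * (1 - q y₁) * (-q'))) y₁ := by
      have := (hasDerivAt_id y₁).mul ((hqd.const_sub 1).pow 2)
      refine this.congr_deriv ?_
      simp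
    have hDd : HasDerivAt D (2 * (1 - y₁ * q y₁) * (-(1 * q y₁ + y₁ * q'))
        - l * (1 * (1 - q y₁) ^ 2 + y₁ * (2 * (1 - q y₁) * (-q')))) y₁ := by
      have := (hed.pow 2).sub (hXd.const_mul l)
      refine this.congr_deriv ?_
      simp
    have hD'0 := dHalf_eq hy0 hDd.hasDerivWithinAt
    have hder' : dHalf D y₁ = 0 := hder
    rw [hder'] at hD'0
    have hwd : HasDerivAt (fun y => 1 - y * q y ^ 2) (-(1 * q y₁ ^ 2 + y₁ * (2 * q y₁ * q'))) y₁ := by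
      have := ((hasDerivAt_id y₁).mul (hqd.pow 2)).const_sub 1
      refine this.congr_deriv ?_
      simp
    have hBd : HasDerivAt (fun y => β * l * (1 - y * q y ^ 2) - k * q y * (1 - y * q y))
        (β * l * (-(1 * q y₁ ^ 2 + y₁ * (2 * q y₁ * q')))
          - (k * q' * (1 - y₁ * q y₁) + k * q y₁ * (-(1 * q y₁ + y₁ * q')))) y₁ :=
      (hwd.const_mul (β * l)).sub ((hqd.const_mul k).mul hed)
    have hqq : DifferentiableAt ℝ (fun y => q y + 2 * y * dHalf q y) y₁ := by
      have h1 : DifferentiableAt ℝ (dHalf q) y₁ :=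
        ((dHalf_smooth hq).differentiableOn (by simp) y₁ hy0).differentiableAt hnh
      have h2 := hqd.differentiableAt
      fun_prop
    have hL := hDd.mul hqq.hasDerivAt
    have hR := hwd.mul hBd
    have hLR := hL.unique (hR.congr_of_eventuallyEq (by
      filter_upwards [hnh] with y hy using hode y hy))
    have hy₁' : D y₁ = 0 := hy₁
    rw [← hD'0, hy₁', zero_mul, zero_mul, add_zero] at hLR
    have hB : β * l * (1 - y₁ * q y₁ ^ 2) - k * q y₁ * (1 - y₁ * q y₁) = 0 := by
      have := hode y₁ hy0
      change D y₁ * _ = _ at this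
      rw [hy₁', zero_mul] at this
      exact (mul_eq_zero.1 this.symm).resolve_left (hw y₁ hy0).ne'
    simp only [hB, mul_zero, zero_add] at hLR
    have hB' := (mul_eq_zero.1 hLR.symm).resolve_left (hw y₁ hy0).ne'
    have hDe : (1 - y₁ * q y₁) ^ 2 - l * (y₁ * (1 - q y₁) ^ 2) = 0 := hy₁
    -- The factor `1 - y` comes from `(1 - y) w = e² - y X²` and `(1 - y) q = e - X`, where `w = 1 -
    -- y q²`.
    exact sonic_algebra (β := β) (l := l) (k := k) (y := y₁) (e := 1 - y₁ * q y₁) (X := 1 - q y₁)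
      (e' := -(1 * q y₁ + y₁ * q')) (X' := -q') hkpos.ne' (by linarith) (he y₁ hy0) hX.ne'
      (by linear_combination hDe) (by linear_combination -hD'0)
      (by linear_combination (1 - y₁) * hB) (by linear_combination (1 - y₁) * hB' - hB)

end WaveBlowup

end

/-! ### Construction of the radial profile -/

noncomputable section

namespace WaveBlowup

open Set MeasureTheory Filter Topology

/-- The leading-order profile, in the variable `y = Z ^ 2`. -/
theorem exists_radialProfile {d p : ℕ} {β : ℝ} (hβ : 1 < β) (hp : 3 ≤ p)
    (hk : β * (ell p + √(ell p)) < (d : ℝ) - 1) {v : ℝ → ℝ} (hv : IsProfile d p β v) :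
    ∃ P : RadialProfile d p β, ∀ Z, 0 ≤ Z →
      phiHat β v Z = P.Φ (Z ^ 2) ∧ rhoHat p β v Z = P.R (Z ^ 2) := by
  obtain ⟨q, hq, hvq, he, hw, hode⟩ := exists_velocity hβ hp hv
  obtain ⟨y₁, hy₁, hX, hpos, hneg, hzero, hder⟩ := exists_sonic_point hβ hp hk hq he hw hode
  have hes : ContDiffOn ℝ ∞ (fun y => 1 - y * q y) (Ici 0) := contDiffOn_const.sub (contDiffOn_id.mul hq)
  have hws : ContDiffOn ℝ ∞ (fun y => 1 - y * q y ^ 2) (Ici 0) :=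
    contDiffOn_const.sub (contDiffOn_id.mul (hq.pow 2))
  -- With `v = s q(s²)`, the integrand of `phiHat` is `2 s f(s²)` for this `f`; hence the factor
  -- `2`.
  have hfs : ContDiffOn ℝ ∞ (fun y => q y / (2 * (1 - y * q y))) (Ici 0) :=
    hq.div (contDiffOn_const.mul hes) fun y hy => mul_ne_zero two_ne_zero (he y hy).ne'
  obtain ⟨F, hF, -, hF'⟩ := exists_primitive hfs
  set Φ : ℝ → ℝ := fun y => 1 / (β - 1) * Real.exp ((β - 1) * F y) with hΦ
  have hΦs : ContDiffOn ℝ ∞ Φ (Ici 0) := contDiffOn_const.mul (contDiffOn_const.mul hF).exp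
  have hΦpos : ∀ y, 0 < Φ y := fun y =>
    mul_pos (one_div_pos.2 (by linarith)) (Real.exp_pos _)
  have hβ1 : 0 < β - 1 := by linarith
  have hpR : (3 : ℝ) ≤ p := by exact_mod_cast hp
  have hp1 : (p : ℝ) - 1 ≠ 0 := by linarith
  have hcast : ((p - 1 : ℕ) : ℝ) = (p : ℝ) - 1 := by
    rw [Nat.cast_sub (by omega)]; simp
  set R : ℝ → ℝ := fun y => (β - 1) ^ (2 / ((p : ℝ) - 1)) * Φ y ^ (2 / ((p : ℝ) - 1)) *
      (1 - y * q y ^ 2) ^ (1 / ((p : ℝ) - 1)) / (1 - y * q y) ^ (2 / ((p : ℝ) - 1)) with hR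
  have hpow2 : ∀ x : ℝ, 0 ≤ x → (x ^ (2 / ((p : ℝ) - 1))) ^ (p - 1) = x ^ 2 := fun x hx => by
    rw [← Real.rpow_natCast, ← Real.rpow_mul hx, hcast, div_mul_cancel₀ _ hp1]
    exact_mod_cast Real.rpow_natCast x 2
  have hpow1 : ∀ x : ℝ, 0 ≤ x → (x ^ (1 / ((p : ℝ) - 1))) ^ (p - 1) = x := fun x hx => by
    rw [← Real.rpow_natCast, ← Real.rpow_mul hx, hcast, div_mul_cancel₀ _ hp1, Real.rpow_one]
  have hΦv : ∀ Z, 0 ≤ Z → phiHat β v Z = Φ (Z ^ 2) := fun Z hZ => by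
    have : ∫ s in (0 : ℝ)..Z, v s / (1 - s * v s) = F (Z ^ 2) := by
      rw [← (hF' Z hZ).1]
      refine intervalIntegral.integral_congr fun s hs => ?_
      rw [uIcc_of_le hZ] at hs
      have h1 := (he (s ^ 2) (sq_nonneg s)).ne'
      have h2 : 1 - s * (s * q (s ^ 2)) = 1 - s ^ 2 * q (s ^ 2) := by ring
      simp only [hvq s hs.1, h2]
      field_simp
    simp only [phiHat, this, hΦ]
  refine ⟨⟨q, Φ, R, y₁, hq, hΦs, ?_, he, hw, fun y _ => hΦpos y, fun y hy => ?_, fun y hy => ?_,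
    fun y hy => ?_, hode, hy₁, hX, hpos, hneg, hzero, hder⟩, fun Z hZ => ⟨hΦv Z hZ, ?_⟩⟩
  · exact ((contDiffOn_const.mul (hΦs.rpow_const_of_ne fun y _ => (hΦpos y).ne')).mul
      (hws.rpow_const_of_ne fun y hy => (hw y hy).ne')).div
      (hes.rpow_const_of_ne fun y hy => (he y hy).ne')
      fun y hy => (Real.rpow_pos_of_pos (he y hy) _).ne'
  · have h1 := he y hy
    have h2 := hw y hy
    have h3 := hΦpos y
    positivity
  · have h1 := ((((hF' 0 le_rfl).2 y hy).const_mul (β - 1)).exp).const_mul (1 / (β - 1))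
    rw [dHalf_eq hy h1]
    have := (he y hy).ne'
    simp only [hΦ]
    field_simp
  · simp only [hR, div_pow, mul_pow]
    rw [hpow2 _ hβ1.le, hpow2 _ (hΦpos y).le, hpow2 _ (he y hy).le, hpow1 _ (hw y hy).le]
    ring
  · simp only [rhoHat, hR, hΦv Z hZ, hvq Z hZ]
    rw [show 1 - (Z * q (Z ^ 2)) ^ 2 = 1 - Z ^ 2 * q (Z ^ 2) ^ 2 by ring,
      show 1 - Z * (Z * q (Z ^ 2)) = 1 - Z ^ 2 * q (Z ^ 2) by ring]

end WaveBlowup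

end

/-! ### Polynomials in `τ` with smooth coefficients on the half-line -/

noncomputable section

namespace WaveBlowup

open Set MeasureTheory Filter Topology

/-- Polynomials in `τ` with coefficients which are smooth functions of `y ∈ [0, ∞)`. -/
inductive TauPoly : (ℝ → ℝ → ℝ) → Prop
  | monomial (c : ℝ → ℝ) (hc : ContDiffOn ℝ ∞ c (Ici 0)) (j : ℕ) : TauPoly fun y τ => c y * τ ^ j
  | add {F G : ℝ → ℝ → ℝ} (hF : TauPoly F) (hG : TauPoly G) : TauPoly fun y τ => F y τ + G y τ
  | congr {F G : ℝ → ℝ → ℝ} (hF : TauPoly F) (h : ∀ y, 0 ≤ y → ∀ τ, G y τ = F y τ) : TauPoly G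

/-- The partial derivative in `y`. -/
def dY (G : ℝ → ℝ → ℝ) : ℝ → ℝ → ℝ := fun y τ => dHalf (fun r => G r τ) y

/-- The partial derivative in `τ`. -/
def dT (G : ℝ → ℝ → ℝ) : ℝ → ℝ → ℝ := fun y τ => deriv (fun r => G y r) τ

lemma dY_congr {F G : ℝ → ℝ → ℝ} (h : ∀ y, 0 ≤ y → ∀ τ, G y τ = F y τ) {y : ℝ} (hy : 0 ≤ y)
    (τ : ℝ) : dY G y τ = dY F y τ :=
  derivWithin_congr (fun r hr => h r hr τ) (h y hy τ)

lemma dT_congr {F G : ℝ → ℝ → ℝ} (h : ∀ y, 0 ≤ y → ∀ τ, G y τ = F y τ) {y : ℝ} (hy : 0 ≤ y)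
    (τ : ℝ) : dT G y τ = dT F y τ := by
  unfold dT
  rw [show (fun r => G y r) = fun r => F y r from funext fun r => h y hy r]

namespace TauPoly

variable {F G : ℝ → ℝ → ℝ}

lemma coeff {c : ℝ → ℝ} (hc : ContDiffOn ℝ ∞ c (Ici 0)) : TauPoly fun y _ => c y :=
  (monomial c hc 0).congr fun y _ τ => by simp

lemma const (c : ℝ) : TauPoly fun _ _ => c := coeff contDiffOn_const

lemma id : TauPoly fun y _ => y := coeff contDiffOn_id

lemma mul (hF : TauPoly F) (hG : TauPoly G) : TauPoly fun y τ => F y τ * G y τ := by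
  induction hF with
  | monomial c hc j =>
    induction hG with
    | monomial d hd i => exact (monomial _ (hc.mul hd) (j + i)).congr fun y _ τ => by ring
    | add _ _ h1 h2 => exact (h1.add h2).congr fun y _ τ => by ring
    | congr _ h ih => exact ih.congr fun y hy τ => by rw [h y hy τ]
  | add _ _ h1 h2 => exact (h1.add h2).congr fun y _ τ => by ring
  | congr _ h ih => exact ih.congr fun y hy τ => by rw [h y hy τ]

lemma neg (hG : TauPoly G) : TauPoly fun y τ => -G y τ :=
  ((const (-1)).mul hG).congr fun y _ τ => by ring

lemma sub (hF : TauPoly F) (hG : TauPoly G) : TauPoly fun y τ => F y τ - G y τ :=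
  (hF.add hG.neg).congr fun y _ τ => by ring

lemma const_mul (c : ℝ) (hG : TauPoly G) : TauPoly fun y τ => c * G y τ := (const c).mul hG

lemma sum {ι : Type*} (s : Finset ι) {H : ι → ℝ → ℝ → ℝ} (h : ∀ i ∈ s, TauPoly (H i)) :
    TauPoly fun y τ => ∑ i ∈ s, H i y τ := by
  classical
  induction s using Finset.induction_on with
  | empty => simpa using const 0
  | insert a s ha ih =>
    exact ((h a (Finset.mem_insert_self a s)).add
      (ih fun i hi => h i (Finset.mem_insert_of_mem hi))).congr fun y _ τ => by
        rw [Finset.sum_insert ha]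

/-- Joint differentiability is required because a time derivative moves `y` and `τ` at once; it is
taken within `y ≥ 0`, since the coefficients are only controlled there. -/
theorem exists_hasFDerivWithinAt (hG : TauPoly G) : ∃ Gy Gt : ℝ → ℝ → ℝ, TauPoly Gy ∧ TauPoly Gt ∧
    ∀ y, 0 ≤ y → ∀ τ, HasFDerivWithinAt (fun z : ℝ × ℝ => G z.1 z.2)
      (Gy y τ • ContinuousLinearMap.fst ℝ ℝ ℝ + Gt y τ • ContinuousLinearMap.snd ℝ ℝ ℝ)
      (Ici 0 ×ˢ univ) (y, τ) := by
  induction hG with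
  | monomial c hc j =>
    refine ⟨_, _, monomial _ (dHalf_smooth hc) j,
      ((const j).mul (monomial c hc (j - 1))), fun y hy τ => ?_⟩
    have h1 : HasFDerivWithinAt (fun z : ℝ × ℝ => c z.1)
        (dHalf c y • ContinuousLinearMap.fst ℝ ℝ ℝ) (Ici 0 ×ˢ univ) (y, τ) :=
      HasDerivWithinAt.comp_hasFDerivWithinAt (f := Prod.fst) (y, τ) (hasDerivWithinAt_dHalf hc hy)
        hasFDerivWithinAt_fst fun z hz => hz.1
    have h2 : HasFDerivWithinAt (fun z : ℝ × ℝ => z.2 ^ j)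
        ((j * τ ^ (j - 1)) • ContinuousLinearMap.snd ℝ ℝ ℝ) (Ici 0 ×ˢ univ) (y, τ) :=
      HasDerivAt.comp_hasFDerivWithinAt (f := Prod.snd) (y, τ) (hasDerivAt_pow j τ)
        hasFDerivWithinAt_snd
    refine (h1.mul h2).congr_fderiv ?_
    ext <;> simp <;> ring
  | add _ _ h1 h2 =>
    obtain ⟨A, B, hA, hB, h⟩ := h1
    obtain ⟨A', B', hA', hB', h'⟩ := h2
    refine ⟨_, _, hA.add hA', hB.add hB', fun y hy τ => ?_⟩
    refine ((h y hy τ).add (h' y hy τ)).congr_fderiv ?_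
    ext <;> simp
  | congr _ h ih =>
    obtain ⟨A, B, hA, hB, h'⟩ := ih
    exact ⟨A, B, hA, hB, fun y hy τ => (h' y hy τ).congr (fun z hz => h _ hz.1 _) (h y hy τ)⟩

lemma hasY_of {Gy Gt : ℝ} {y τ : ℝ} (h : HasFDerivWithinAt (fun z : ℝ × ℝ => G z.1 z.2)
      (Gy • ContinuousLinearMap.fst ℝ ℝ ℝ + Gt • ContinuousLinearMap.snd ℝ ℝ ℝ)
      (Ici 0 ×ˢ univ) (y, τ)) : HasDerivWithinAt (fun r => G r τ) Gy (Ici 0) y := by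
  have h1 : HasDerivWithinAt (fun r : ℝ => (r, τ)) ((1 : ℝ), (0 : ℝ)) (Ici 0) y :=
    (hasDerivWithinAt_id y _).prodMk (hasDerivWithinAt_const _ _ _)
  have hm : MapsTo (fun r : ℝ => (r, τ)) (Ici 0) (Ici 0 ×ˢ univ) := fun r hr => ⟨hr, mem_univ _⟩
  refine (h.comp_hasDerivWithinAt y h1 hm).congr_deriv ?_
  simp

lemma hasT_of {Gy Gt : ℝ} {y τ : ℝ} (hy : 0 ≤ y) (h : HasFDerivWithinAt (fun z : ℝ × ℝ => G z.1 z.2)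
      (Gy • ContinuousLinearMap.fst ℝ ℝ ℝ + Gt • ContinuousLinearMap.snd ℝ ℝ ℝ)
      (Ici 0 ×ˢ univ) (y, τ)) : HasDerivAt (fun r => G y r) Gt τ := by
  have h1 : HasDerivWithinAt (fun r : ℝ => (y, r)) ((0 : ℝ), (1 : ℝ)) univ τ :=
    (hasDerivWithinAt_const _ _ _).prodMk (hasDerivWithinAt_id τ _)
  have hm : MapsTo (fun r : ℝ => (y, r)) univ (Ici 0 ×ˢ univ) := fun r _ => ⟨hy, mem_univ _⟩
  refine ((h.comp_hasDerivWithinAt τ h1 hm).congr_deriv ?_).hasDerivAt univ_mem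
  simp

theorem hasFDerivWithinAt (hG : TauPoly G) {y : ℝ} (hy : 0 ≤ y) (τ : ℝ) :
    HasFDerivWithinAt (fun z : ℝ × ℝ => G z.1 z.2)
      (WaveBlowup.dY G y τ • ContinuousLinearMap.fst ℝ ℝ ℝ
        + WaveBlowup.dT G y τ • ContinuousLinearMap.snd ℝ ℝ ℝ) (Ici 0 ×ˢ univ) (y, τ) := by
  obtain ⟨A, B, -, -, h⟩ := hG.exists_hasFDerivWithinAt
  have e1 : WaveBlowup.dY G y τ = A y τ := dHalf_eq hy (hasY_of (h y hy τ))
  have e2 : WaveBlowup.dT G y τ = B y τ := (hasT_of hy (h y hy τ)).deriv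
  rw [e1, e2]
  exact h y hy τ

lemma hasY (hG : TauPoly G) {y : ℝ} (hy : 0 ≤ y) (τ : ℝ) :
    HasDerivWithinAt (fun r => G r τ) (WaveBlowup.dY G y τ) (Ici 0) y :=
  hasY_of (hG.hasFDerivWithinAt hy τ)

lemma hasT (hG : TauPoly G) {y : ℝ} (hy : 0 ≤ y) (τ : ℝ) :
    HasDerivAt (fun r => G y r) (WaveBlowup.dT G y τ) τ :=
  hasT_of hy (hG.hasFDerivWithinAt hy τ)

lemma dY (hG : TauPoly G) : TauPoly (dY G) := by
  obtain ⟨A, B, hA, -, h⟩ := hG.exists_hasFDerivWithinAt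
  exact hA.congr fun y hy τ => dHalf_eq hy (hasY_of (h y hy τ))

lemma dT (hG : TauPoly G) : TauPoly (dT G) := by
  obtain ⟨A, B, -, hB, h⟩ := hG.exists_hasFDerivWithinAt
  exact hB.congr fun y hy τ => (hasT_of hy (h y hy τ)).deriv

end TauPoly

section Rules

variable {F G : ℝ → ℝ → ℝ} {y : ℝ}

lemma dY_add (hF : TauPoly F) (hG : TauPoly G) (hy : 0 ≤ y) (τ : ℝ) :
    dY (fun y τ => F y τ + G y τ) y τ = dY F y τ + dY G y τ :=
  dHalf_eq hy ((hF.hasY hy τ).add (hG.hasY hy τ))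

lemma dT_add (hF : TauPoly F) (hG : TauPoly G) (hy : 0 ≤ y) (τ : ℝ) :
    dT (fun y τ => F y τ + G y τ) y τ = dT F y τ + dT G y τ :=
  ((hF.hasT hy τ).add (hG.hasT hy τ)).deriv

lemma dY_coeff {c : ℝ → ℝ} (τ : ℝ) : dY (fun y _ => c y) y τ = dHalf c y := rfl

lemma dT_coeff {c : ℝ → ℝ} (τ : ℝ) : dT (fun y _ => c y) y τ = 0 := deriv_const _ _

lemma dY_monomial {c : ℝ → ℝ} (hc : ContDiffOn ℝ ∞ c (Ici 0)) (j : ℕ) (hy : 0 ≤ y) (τ : ℝ) :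
    dY (fun y τ => c y * τ ^ j) y τ = dHalf c y * τ ^ j :=
  dHalf_eq hy ((hasDerivWithinAt_dHalf hc hy).mul_const _)

lemma dT_monomial {c : ℝ → ℝ} (j : ℕ) (τ : ℝ) :
    dT (fun y τ => c y * τ ^ j) y τ = c y * (j * τ ^ (j - 1)) :=
  ((hasDerivAt_pow j τ).const_mul _).deriv

lemma dT_dY (hG : TauPoly G) (hy : 0 ≤ y) (τ : ℝ) : dT (dY G) y τ = dY (dT G) y τ := by
  induction hG with
  | monomial c hc j =>
    rw [dT_congr (fun y hy τ => dY_monomial hc j hy τ) hy, dT_monomial,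
      dY_congr (F := fun y τ => (fun y => c y * j) y * τ ^ (j - 1))
        (fun y hy τ => by rw [dT_monomial]; ring) hy,
      dY_monomial (hc.mul contDiffOn_const) _ hy,
      dHalf_eq hy ((hasDerivWithinAt_dHalf hc hy).mul_const _)]
    ring
  | add h1 h2 ih1 ih2 =>
    rw [dT_congr (fun y hy τ => dY_add h1 h2 hy τ) hy, dT_add h1.dY h2.dY hy,
      dY_congr (fun y hy τ => dT_add h1 h2 hy τ) hy, dY_add h1.dT h2.dT hy, ih1, ih2]
  | congr _ h ih =>
    rw [dT_congr (fun y hy τ => dY_congr h hy τ) hy, ih, dY_congr (fun y hy τ => dT_congr h hy τ) hy]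

end Rules

/-- Normal form. -/
lemma TauPoly.exists_coeff {G : ℝ → ℝ → ℝ} (hG : TauPoly G) : ∃ (m : ℕ) (c : ℕ → ℝ → ℝ),
    (∀ j, ContDiffOn ℝ ∞ (c j) (Ici 0)) ∧ (∀ j, m < j → c j = 0) ∧
    ∀ y, 0 ≤ y → ∀ τ, G y τ = ∑ j ∈ Finset.range (m + 1), c j y * τ ^ j := by
  induction hG with
  | monomial c hc j =>
    refine ⟨j, fun i => if i = j then c else 0, fun i => ?_, fun i hi => if_neg hi.ne',
      fun y _ τ => ?_⟩
    · beta_reduce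
      split_ifs
      · exact hc
      · exact contDiffOn_const
    · rw [Finset.sum_eq_single j (fun i _ hi => by simp [hi]) (fun h => by simp at h)]
      simp
  | add _ _ h1 h2 =>
    obtain ⟨m, c, hc, hc0, h⟩ := h1
    obtain ⟨m', c', hc', hc0', h'⟩ := h2
    have key : ∀ (m M : ℕ) (c : ℕ → ℝ → ℝ), m ≤ M → (∀ j, m < j → c j = 0) → ∀ y τ : ℝ,
        ∑ j ∈ Finset.range (m + 1), c j y * τ ^ j = ∑ j ∈ Finset.range (M + 1), c j y * τ ^ j := by
      intro m M c hmM h0 y τ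
      refine Finset.sum_subset (Finset.range_mono (by omega)) fun j _ hj => ?_
      rw [h0 j (by simpa using hj)]
      simp
    refine ⟨max m m', fun j => c j + c' j, fun j => (hc j).add (hc' j), fun j hj => ?_,
      fun y hy τ => ?_⟩
    · beta_reduce
      rw [hc0 j (by omega), hc0' j (by omega), add_zero]
    · beta_reduce
      rw [h y hy τ, h' y hy τ, key m _ c (le_max_left m m') hc0, key m' _ c' (le_max_right m m') hc0',
        ← Finset.sum_add_distrib]
      exact Finset.sum_congr rfl fun j _ => by simp [add_mul]
  | congr _ h ih =>
    obtain ⟨m, c, hc, hc0, h'⟩ := ih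
    exact ⟨m, c, hc, hc0, fun y hy τ => (h y hy τ).trans (h' y hy τ)⟩

end WaveBlowup

end

noncomputable section

namespace WaveBlowup

open Set MeasureTheory Filter Topology

/-! ### Self-similar fields -/

section Fields

variable {d : ℕ} {T : ℝ}

/-- The field `(T - t) ^ lam G (y, τ)` with `y = |x|² / (T - t)²` and `τ = - log (T - t)`. -/
def fld (T lam : ℝ) (G : ℝ → ℝ → ℝ) : STFun d ℝ := fun t x =>
  (T - t) ^ lam * G (‖x‖ ^ 2 / (T - t) ^ 2) (-Real.log (T - t))

/-- Equality on the slab `[0, T) × ℝ^d`. -/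
def SlabEq (T : ℝ) (f g : STFun d ℝ) : Prop := ∀ t ∈ Ico 0 T, ∀ x, f t x = g t x

lemma pd_succ (j : Fin d) (f : STFun d ℝ) (t : ℝ) (x : EuclideanSpace ℝ (Fin d)) :
    pd T j.succ f t x = fderiv ℝ (f t) x (EuclideanSpace.single j 1) := rfl

lemma SlabEq.pd {f g : STFun d ℝ} (h : SlabEq T f g) (α : Fin (d + 1)) :
    SlabEq T (pd T α f) (pd T α g) := by
  intro t ht x
  refine Fin.cases ?_ (fun j => ?_) α
  · exact derivWithin_congr (fun s hs => h s hs x) (h t ht x)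
  · rw [pd_succ, pd_succ, show f t = g t from funext (h t ht)]

lemma SlabEq.div {V W : Fin (d + 1) → STFun d ℝ} (h : ∀ α, SlabEq T (V α) (W α)) :
    SlabEq T (div T V) (div T W) := fun t ht x =>
  Finset.sum_congr rfl fun α _ => by rw [(h α).pd α t ht x]

lemma SlabEq.box {f g : STFun d ℝ} (h : SlabEq T f g) : SlabEq T (box T f) (box T g) :=
  SlabEq.div fun α => h.pd α

lemma SlabEq.mform {f f' g g' : STFun d ℝ} (h : SlabEq T f f') (h' : SlabEq T g g') :
    SlabEq T (mform T f g) (mform T f' g') := fun t ht x =>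
  Finset.sum_congr rfl fun α _ => by rw [h.pd α t ht x, h'.pd α t ht x]

lemma mform_eq (f g : STFun d ℝ) (t : ℝ) (x : EuclideanSpace ℝ (Fin d)) :
    mform T f g t x = -(pd T 0 f t x * pd T 0 g t x)
      + ∑ j : Fin d, pd T j.succ f t x * pd T j.succ g t x := by
  simp [mform, Fin.sum_univ_succ, mink]

lemma div_eq (V : Fin (d + 1) → STFun d ℝ) (t : ℝ) (x : EuclideanSpace ℝ (Fin d)) :
    div T V t x = -pd T 0 (V 0) t x + ∑ j : Fin d, pd T j.succ (V j.succ) t x := by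
  simp [div, Fin.sum_univ_succ, mink]

lemma rpow_sub_two {s : ℝ} (hs : 0 < s) (lam : ℝ) : s ^ (lam - 2) = s ^ lam / s ^ 2 := by
  rw [Real.rpow_sub hs, Real.rpow_two]

variable {G : ℝ → ℝ → ℝ}

/-- Chain rule with `∂_t y = 2 y / (T - t)` and `∂_t τ = 1 / (T - t)`. -/
theorem hasDerivWithinAt_fld (hG : TauPoly G) (lam : ℝ) {t : ℝ} (ht : t ∈ Ico 0 T)
    (x : EuclideanSpace ℝ (Fin d)) : HasDerivWithinAt (fun s => fld T lam G s x)
      (fld T (lam - 1) (fun y τ => 2 * y * dY G y τ + dT G y τ - lam * G y τ) t x) (Ico 0 T) t := by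
  have hs : 0 < T - t := by linarith [ht.2]
  set s := T - t with hsdef
  have h0 : HasDerivAt (fun r => T - r) (-1) t := by simpa using (hasDerivAt_id t).const_sub T
  have h1 : HasDerivAt (fun r => (T - r) ^ lam) (-1 * lam * s ^ (lam - 1)) t :=
    h0.rpow_const (Or.inl hs.ne')
  have h2 : HasDerivAt (fun r => ‖x‖ ^ 2 / (T - r) ^ 2) (2 * (‖x‖ ^ 2 / s ^ 2) / s) t := by
    have := (hasDerivAt_const t (‖x‖ ^ 2)).div (h0.pow 2) (pow_ne_zero 2 hs.ne')
    refine this.congr_deriv ?_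
    simp only [Pi.pow_apply, ← hsdef]
    field_simp
    ring
  have h3 : HasDerivAt (fun r => -Real.log (T - r)) (1 / s) t := by
    have := (h0.log hs.ne').neg
    refine this.congr_deriv ?_
    rw [← hsdef]
    field_simp
  have h4 : HasDerivWithinAt (fun r => (‖x‖ ^ 2 / (T - r) ^ 2, -Real.log (T - r)))
      (2 * (‖x‖ ^ 2 / s ^ 2) / s, 1 / s) (Ico 0 T) t :=
    h2.hasDerivWithinAt.prodMk h3.hasDerivWithinAt
  have hm : MapsTo (fun r => (‖x‖ ^ 2 / (T - r) ^ 2, -Real.log (T - r))) (Ico 0 T)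
      (Ici 0 ×ˢ univ) := fun r _ => ⟨mem_Ici.2 (by positivity), mem_univ _⟩
  have h5 := (hG.hasFDerivWithinAt (y := ‖x‖ ^ 2 / s ^ 2) (by positivity) (-Real.log s))
    |>.comp_hasDerivWithinAt t h4 hm
  refine (h1.hasDerivWithinAt.mul h5).congr_deriv ?_
  have h6 : s ^ lam = s ^ (lam - 1) * s := by
    rw [Real.rpow_sub_one hs.ne', div_mul_cancel₀ _ hs.ne']
  simp only [fld, add_apply, smul_apply,
    ContinuousLinearMap.coe_fst', ContinuousLinearMap.coe_snd', smul_eq_mul, Function.comp,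
    ← hsdef, h6]
  field_simp
  ring

lemma pd_zero_fld (hG : TauPoly G) (lam : ℝ) {t : ℝ} (ht : t ∈ Ico 0 T)
    (x : EuclideanSpace ℝ (Fin d)) : pd T 0 (fld T lam G) t x
      = fld T (lam - 1) (fun y τ => 2 * y * dY G y τ + dT G y τ - lam * G y τ) t x :=
  (hasDerivWithinAt_fld hG lam ht x).derivWithin (uniqueDiffOn_Ico 0 T t ht)

/-- Working with `|x|²` instead of `|x|` avoids any singularity at the spatial origin. -/
theorem hasFDerivAt_fld (hG : TauPoly G) (lam : ℝ) {t : ℝ} (ht : t ∈ Ico 0 T)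
    (x : EuclideanSpace ℝ (Fin d)) : HasFDerivAt (fld T lam G t)
      (fld T (lam - 2) (fun y τ => 2 * dY G y τ) t x • innerSL ℝ x) x := by
  have hs : 0 < T - t := by linarith [ht.2]
  set s := T - t with hsdef
  have h1 : HasFDerivAt (fun x : EuclideanSpace ℝ (Fin d) => ‖x‖ ^ 2 / s ^ 2)
      ((2 / s ^ 2) • innerSL ℝ x) x := by
    have := (hasStrictFDerivAt_norm_sq x).hasFDerivAt.const_mul (1 / s ^ 2)
    refine (this.congr_fderiv ?_).congr_of_eventuallyEq (Eventually.of_forall fun z => ?_)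
    · ext z
      simp
      ring
    · ring
  have h2 : HasFDerivWithinAt
      (fun x : EuclideanSpace ℝ (Fin d) => (‖x‖ ^ 2 / s ^ 2, -Real.log s))
      (((2 / s ^ 2) • innerSL ℝ x).prod 0) univ x :=
    (h1.prodMk (hasFDerivAt_const (-Real.log s) x)).hasFDerivWithinAt
  have hm : MapsTo (fun x : EuclideanSpace ℝ (Fin d) => (‖x‖ ^ 2 / s ^ 2, -Real.log s)) univ
      (Ici 0 ×ˢ univ) := fun r _ => ⟨mem_Ici.2 (by positivity), mem_univ _⟩
  have h3 := ((hG.hasFDerivWithinAt (y := ‖x‖ ^ 2 / s ^ 2) (by positivity) (-Real.log s)).comp x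
    h2 hm).hasFDerivAt univ_mem
  refine (h3.const_mul (s ^ lam)).congr_fderiv ?_
  have h6 : s ^ lam = s ^ (lam - 2) * s ^ 2 := by
    rw [rpow_sub_two hs, div_mul_cancel₀ _ (pow_ne_zero 2 hs.ne')]
  ext z
  simp only [fld, ← hsdef, h6, smul_apply, ContinuousLinearMap.comp_apply,
    add_apply, ContinuousLinearMap.prod_apply, ContinuousLinearMap.coe_fst',
    ContinuousLinearMap.coe_snd', zero_apply, smul_eq_mul]
  field_simp
  ring

lemma innerSL_single (x : EuclideanSpace ℝ (Fin d)) (j : Fin d) :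
    innerSL ℝ x (EuclideanSpace.single j 1) = x j := by
  simp [innerSL_apply_apply, EuclideanSpace.inner_single_right]

lemma pd_succ_fld (hG : TauPoly G) (lam : ℝ) {t : ℝ} (ht : t ∈ Ico 0 T)
    (x : EuclideanSpace ℝ (Fin d)) (j : Fin d) : pd T j.succ (fld T lam G) t x
      = x j * fld T (lam - 2) (fun y τ => 2 * dY G y τ) t x := by
  rw [pd_succ, (hasFDerivAt_fld hG lam ht x).fderiv, smul_apply, innerSL_single,
    smul_eq_mul, mul_comm]

lemma pd_succ_coord_mul_fld (hG : TauPoly G) (lam : ℝ) {t : ℝ} (ht : t ∈ Ico 0 T)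
    (x : EuclideanSpace ℝ (Fin d)) (j : Fin d) :
    pd T j.succ (fun t x => x j * fld T lam G t x) t x
      = fld T lam G t x + x j ^ 2 * fld T (lam - 2) (fun y τ => 2 * dY G y τ) t x := by
  have h1 : HasFDerivAt (fun x : EuclideanSpace ℝ (Fin d) => x j)
      (EuclideanSpace.proj j : EuclideanSpace ℝ (Fin d) →L[ℝ] ℝ) x :=
    (EuclideanSpace.proj j : EuclideanSpace ℝ (Fin d) →L[ℝ] ℝ).hasFDerivAt
  have h2 : HasFDerivAt (fun x : EuclideanSpace ℝ (Fin d) => x j * fld T lam G t x) _ x :=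
    h1.mul (hasFDerivAt_fld hG lam ht x)
  rw [pd_succ, h2.fderiv]
  simp only [add_apply, smul_apply, innerSL_single,
    smul_eq_mul]
  simp
  ring

lemma fld_mul_fld (lam lam' : ℝ) (F G : ℝ → ℝ → ℝ) {t : ℝ} (ht : t ∈ Ico 0 T)
    (x : EuclideanSpace ℝ (Fin d)) : fld T lam F t x * fld T lam' G t x
      = fld T (lam + lam') (fun y τ => F y τ * G y τ) t x := by
  simp only [fld, Real.rpow_add (by linarith [ht.2] : 0 < T - t)]
  ring

lemma norm_sq_mul_fld (lam : ℝ) (G : ℝ → ℝ → ℝ) {t : ℝ} (ht : t ∈ Ico 0 T)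
    (x : EuclideanSpace ℝ (Fin d)) :
    ‖x‖ ^ 2 * fld T (lam - 2) G t x = fld T lam (fun y τ => y * G y τ) t x := by
  have hs : 0 < T - t := by linarith [ht.2]
  simp only [fld, rpow_sub_two hs]
  field_simp

/-- The divergence of a self-similar vector field. -/
theorem div_fld {B₀ B₁ : ℝ → ℝ → ℝ} (h₀ : TauPoly B₀) (h₁ : TauPoly B₁) (κ : ℝ)
    {V : Fin (d + 1) → STFun d ℝ} (hV₀ : SlabEq T (V 0) (fld T (κ - 1) B₀))
    (hV₁ : ∀ j : Fin d, SlabEq T (V j.succ) fun t x => x j * fld T (κ - 2) B₁ t x) :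
    SlabEq T (div T V) (fld T (κ - 2) fun y τ =>
      -(2 * y * dY B₀ y τ + dT B₀ y τ - (κ - 1) * B₀ y τ) + d * B₁ y τ + 2 * y * dY B₁ y τ) := by
  intro t ht x
  have e1 : ∀ j : Fin d, pd T j.succ (V j.succ) t x = fld T (κ - 2) B₁ t x
      + x j ^ 2 * fld T (κ - 2 - 2) (fun y τ => 2 * dY B₁ y τ) t x := fun j => by
    rw [(hV₁ j).pd j.succ t ht x, pd_succ_coord_mul_fld h₁ _ ht]
  rw [div_eq, hV₀.pd 0 t ht x, pd_zero_fld h₀ _ ht, Finset.sum_congr rfl fun j _ => e1 j,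
    Finset.sum_add_distrib, ← Finset.sum_mul, ← EuclideanSpace.real_norm_sq_eq,
    norm_sq_mul_fld _ _ ht, show κ - 1 - 1 = κ - 2 by ring]
  simp only [fld, Finset.sum_const, Finset.card_univ, Fintype.card_fin, nsmul_eq_mul]
  ring

theorem mform_fld {F : ℝ → ℝ → ℝ} (hF : TauPoly F) (hG : TauPoly G) (lam lam' : ℝ) :
    SlabEq (d := d) T (mform T (fld T lam F) (fld T lam' G)) (fld T (lam + lam' - 2) fun y τ =>
      -((2 * y * dY F y τ + dT F y τ - lam * F y τ) * (2 * y * dY G y τ + dT G y τ - lam' * G y τ))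
        + 4 * y * (dY F y τ * dY G y τ)) := by
  intro t ht x
  have e1 : ∀ j : Fin d, pd T j.succ (fld T lam F) t x * pd T j.succ (fld T lam' G) t x
      = x j ^ 2 * fld T (lam + lam' - 2 - 2) (fun y τ => 2 * dY F y τ * (2 * dY G y τ)) t x := by
    intro j
    rw [pd_succ_fld hF _ ht, pd_succ_fld hG _ ht,
      show lam + lam' - 2 - 2 = (lam - 2) + (lam' - 2) by ring, ← fld_mul_fld _ _ _ _ ht]
    ring
  rw [mform_eq, pd_zero_fld hF _ ht, pd_zero_fld hG _ ht, fld_mul_fld _ _ _ _ ht,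
    Finset.sum_congr rfl fun j _ => e1 j, ← Finset.sum_mul, ← EuclideanSpace.real_norm_sq_eq,
    norm_sq_mul_fld _ _ ht, show lam - 1 + (lam' - 1) = lam + lam' - 2 by ring]
  simp only [fld]
  ring

theorem box_fld (hG : TauPoly G) (lam : ℝ) :
    SlabEq (d := d) T (box T (fld T lam G)) (fld T (lam - 2) fun y τ =>
      -(2 * y * dY (fun y τ => 2 * y * dY G y τ + dT G y τ - lam * G y τ) y τ
        + dT (fun y τ => 2 * y * dY G y τ + dT G y τ - lam * G y τ) y τ
        - (lam - 1) * (2 * y * dY G y τ + dT G y τ - lam * G y τ))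
      + d * (2 * dY G y τ) + 2 * y * dY (fun y τ => 2 * dY G y τ) y τ) :=
  div_fld ((((TauPoly.id.const_mul 2).mul hG.dY).add hG.dT).sub (hG.const_mul lam))
    (hG.dY.const_mul 2) lam (fun _ ht x => pd_zero_fld hG lam ht x)
    fun j _ ht x => pd_succ_fld hG lam ht x j

end Fields

/-! ### The function spaces -/

/-- The real-valued part of `X d T lam`. -/
def InX {d : ℕ} (T lam : ℝ) (f : STFun d ℝ) : Prop :=
  ∃ G, TauPoly G ∧ SlabEq T f (fld T lam G)

namespace InX

variable {d : ℕ} {T lam lam' : ℝ} {f g : STFun d ℝ}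

lemma add (hf : InX T lam f) (hg : InX T lam g) : InX T lam fun t x => f t x + g t x := by
  obtain ⟨F, hF, h⟩ := hf
  obtain ⟨G, hG, h'⟩ := hg
  exact ⟨_, hF.add hG, fun t ht x => by beta_reduce; rw [h t ht x, h' t ht x]; simp only [fld]; ring⟩

lemma const_mul (c : ℝ) (hf : InX T lam f) : InX T lam fun t x => c * f t x := by
  obtain ⟨F, hF, h⟩ := hf
  exact ⟨_, hF.const_mul c, fun t ht x => by beta_reduce; rw [h t ht x]; simp only [fld]; ring⟩

lemma sub (hf : InX T lam f) (hg : InX T lam g) : InX T lam fun t x => f t x - g t x := by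
  obtain ⟨F, hF, h⟩ := hf
  obtain ⟨G, hG, h'⟩ := hg
  exact ⟨_, hF.sub hG, fun t ht x => by beta_reduce; rw [h t ht x, h' t ht x]; simp only [fld]; ring⟩

lemma mul (hf : InX T lam f) (hg : InX T lam' g) : InX T (lam + lam') fun t x => f t x * g t x := by
  obtain ⟨F, hF, h⟩ := hf
  obtain ⟨G, hG, h'⟩ := hg
  exact ⟨_, hF.mul hG, fun t ht x => by beta_reduce; rw [h t ht x, h' t ht x, fld_mul_fld _ _ _ _ ht]⟩

lemma zero : InX (d := d) T lam fun _ _ => 0 :=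
  ⟨_, TauPoly.const 0, fun t _ x => by simp [fld]⟩

lemma sum {ι : Type*} (s : Finset ι) {H : ι → STFun d ℝ} (h : ∀ i ∈ s, InX T lam (H i)) :
    InX T lam fun t x => ∑ i ∈ s, H i t x := by
  classical
  induction s using Finset.induction_on with
  | empty => simpa using zero
  | insert a s ha ih =>
    simp only [Finset.sum_insert ha]
    exact (h a (Finset.mem_insert_self a s)).add (ih fun i hi => h i (Finset.mem_insert_of_mem hi))

lemma prod {ι : Type*} (s : Finset ι) {H : ι → STFun d ℝ} {l : ι → ℝ}
    (h : ∀ i ∈ s, InX T (l i) (H i)) : InX T (∑ i ∈ s, l i) fun t x => ∏ i ∈ s, H i t x := by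
  classical
  induction s using Finset.induction_on with
  | empty => exact ⟨_, TauPoly.const 1, fun t _ x => by simp [fld]⟩
  | insert a s ha ih =>
    simp only [Finset.prod_insert ha, Finset.sum_insert ha]
    exact (h a (Finset.mem_insert_self a s)).mul (ih fun i hi => h i (Finset.mem_insert_of_mem hi))

lemma mform (hf : InX T lam f) (hg : InX T lam' g) : InX T (lam + lam' - 2) (mform T f g) := by
  obtain ⟨F, hF, h⟩ := hf
  obtain ⟨G, hG, h'⟩ := hg
  have hD : ∀ {G lam}, TauPoly G → TauPoly fun y τ => 2 * y * dY G y τ + dT G y τ - lam * G y τ :=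
    fun hG => (((TauPoly.id.const_mul 2).mul hG.dY).add hG.dT).sub (hG.const_mul _)
  exact ⟨_, ((hD hF).mul (hD hG)).neg.add ((TauPoly.id.const_mul 4).mul (hF.dY.mul hG.dY)),
    fun t ht x => (h.mform h' t ht x).trans (mform_fld hF hG lam lam' t ht x)⟩

lemma box (hf : InX T lam f) : InX T (lam - 2) (box T f) := by
  obtain ⟨F, hF, h⟩ := hf
  have hD := (((TauPoly.id.const_mul 2).mul hF.dY).add hF.dT).sub (hF.const_mul lam)
  exact ⟨_, ((((TauPoly.id.const_mul 2).mul hD.dY).add hD.dT).sub (hD.const_mul (lam - 1))).neg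
    |>.add ((hF.dY.const_mul 2).const_mul d) |>.add
      ((TauPoly.id.const_mul 2).mul (hF.dY.const_mul 2).dY),
    fun t ht x => (h.box t ht x).trans (box_fld hF lam t ht x)⟩

theorem mem_X (hf : InX T lam f) : (fun t x => (f t x : ℂ)) ∈ X d T (lam : ℂ) := by
  obtain ⟨G, hG, h⟩ := hf
  obtain ⟨m, c, hc, -, hGc⟩ := hG.exists_coeff
  refine ⟨fun t x => (G (‖x‖ ^ 2 / (T - t) ^ 2) (-Real.log (T - t)) : ℂ),
    ⟨m, fun j Z => (c j (Z ^ 2) : ℂ), fun j _ => ⟨?_, fun y => (c j y : ℂ), ?_, fun _ _ => rfl⟩,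
      fun t ht x => ?_⟩, fun t ht x => ?_⟩
  · exact Complex.ofRealCLM.contDiff.comp_contDiffOn
      ((hc j).comp (contDiff_id.pow 2).contDiffOn fun Z _ => sq_nonneg Z)
  · exact Complex.ofRealCLM.contDiff.comp_contDiffOn (hc j)
  · beta_reduce
    rw [hGc _ (by positivity), div_pow]
    push_cast
    rfl
  · have hs : 0 ≤ T - t := by linarith [ht.2]
    simp only [h t ht x, fld]
    rw [Complex.ofReal_mul, Complex.ofReal_cpow hs]

end InX

end WaveBlowup

end

noncomputable section

namespace WaveBlowup

open Set MeasureTheory Filter Topology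

/-! ### Solving the pencil equation for polynomials in `τ` -/

section ChainSum

variable {K : ℕ} {u : ℕ → ℝ → ℝ} {y : ℝ}

/-- The polynomial in `τ` on which `-∂_τ` acts by shifting the coefficient sequence. -/
def chainSum (K : ℕ) (u : ℕ → ℝ → ℝ) (y τ : ℝ) : ℝ :=
  ∑ j ∈ Finset.range (K + 1), u (K - j) y * ((-τ) ^ j / (j.factorial : ℝ))

lemma chainSum_tauPoly (K : ℕ) (hu : ∀ n, ContDiffOn ℝ ∞ (u n) (Ici 0)) : TauPoly (chainSum K u) :=
  TauPoly.sum _ fun j _ =>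
    (TauPoly.monomial (fun y => u (K - j) y * ((-1) ^ j / (j.factorial : ℝ)))
      ((hu _).mul contDiffOn_const) j).congr fun y _ τ => by
        rw [neg_pow]; ring

lemma dY_chainSum (hu : ∀ n, ContDiffOn ℝ ∞ (u n) (Ici 0)) (hy : 0 ≤ y) (τ : ℝ) :
    dY (chainSum K u) y τ = chainSum K (fun n => dHalf (u n)) y τ :=
  dHalf_eq hy (HasDerivWithinAt.fun_sum fun j _ =>
    (hasDerivWithinAt_dHalf (hu (K - j)) hy).mul_const _)

/-- Differentiation lowers the power of `-τ` by one and thereby the index of `u` by one relative to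
it. The top power disappears, in agreement with the delayed sequence being zero at index `0`. -/
lemma dT_chainSum (τ : ℝ) : dT (chainSum K u) y τ = -chainSum K (delay u 1) y τ := by
  have h1 : ∀ j : ℕ, HasDerivAt (fun τ : ℝ => u (K - j) y * ((-τ) ^ j / (j.factorial : ℝ)))
      (u (K - j) y * ((j * (-τ) ^ (j - 1) * -1) / (j.factorial : ℝ))) τ := fun j =>
    (((hasDerivAt_neg τ).pow j).div_const _).const_mul _
  have h2 : dT (chainSum K u) y τ = _ := (HasDerivAt.fun_sum fun j (_ : j ∈ Finset.range (K + 1)) =>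
    h1 j).deriv
  rw [h2, Finset.sum_range_succ', chainSum, Finset.sum_range_succ]
  have h3 : delay u 1 (K - K) y = 0 := by simp [delay]
  rw [h3, zero_mul, add_zero, ← Finset.sum_neg_distrib]
  simp only [Nat.cast_zero, zero_mul, zero_div, mul_zero, add_zero]
  refine Finset.sum_congr rfl fun j hj => ?_
  have hj' : j < K := Finset.mem_range.1 hj
  have h4 : delay u 1 (K - j) = u (K - (j + 1)) := by
    rw [delay, if_pos (by omega)]
    congr 1
  rw [h4, Nat.factorial_succ]
  have h5 : (j.factorial : ℝ) ≠ 0 := by exact_mod_cast j.factorial_ne_zero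
  push_cast
  field_simp

lemma delay_delay (u : ℕ → ℝ → ℝ) : delay (delay u 1) 1 = delay u 2 := by
  funext n
  unfold delay
  split_ifs <;> first | rfl | omega

end ChainSum

namespace TwoPointPencil

/-- The operator of the pencil acting on polynomials in `τ`, with `ε` replaced by `-∂_τ`. -/
def op (P : TwoPointPencil) (g : ℝ → ℝ → ℝ) (y τ : ℝ) : ℝ :=
  y * P.a y * dY (dY g) y τ
    + (P.b 0 y * dY g y τ - P.b 1 y * dT (dY g) y τ + P.b 2 y * dT (dT (dY g)) y τ)
    + (P.c 0 y * g y τ - P.c 1 y * dT g y τ + P.c 2 y * dT (dT g) y τ)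

/-- Since `-∂_τ` acts on `chainSum` as the delay of the sequence, the coefficient identities of the
chain become a single equation for a polynomial in `τ`. Monomials suffice by linearity. -/
theorem exists_op_eq (P : TwoPointPencil) {h : ℝ → ℝ → ℝ} (hh : TauPoly h) :
    ∃ g, TauPoly g ∧ ∀ y, 0 ≤ y → ∀ τ, P.op g y τ = h y τ := by
  induction hh with
  | monomial c hc M =>
    obtain ⟨N, u, hu⟩ := P.exists_chain (g := fun y => (-1) ^ M * (M.factorial : ℝ) * c y)
      (contDiffOn_const.mul hc)
    have hs : ∀ n, ContDiffOn ℝ ∞ (u n) (Ici 0) := fun n => (hu n).1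
    have hds : ∀ n, ContDiffOn ℝ ∞ (dHalf (u n)) (Ici 0) := fun n => dHalf_smooth (hs n)
    have hdelay : ∀ l n, dHalf (delay u l n) = delay (fun n => dHalf (u n)) l n := by
      intro l n
      unfold delay
      split_ifs
      · rfl
      · funext y
        exact congrFun (derivWithin_const _ _) y
    -- The chain has a source only at index `N`; with this `K` it is met exactly by `j = M`, that
    -- is, by the power `τ ^ M`. The factor `(-1) ^ M * M!` put into the source cancels the
    -- normalisation of that power.
    set K := N + M
    refine ⟨chainSum K u, chainSum_tauPoly K hs, fun y hy τ => ?_⟩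
    have e1 : ∀ y, 0 ≤ y → ∀ τ, dY (chainSum K u) y τ = chainSum K (fun n => dHalf (u n)) y τ :=
      fun y hy τ => dY_chainSum hs hy τ
    have e2 : dY (dY (chainSum K u)) y τ = chainSum K (fun n => dHalf (dHalf (u n))) y τ := by
      rw [dY_congr e1 hy, dY_chainSum hds hy]
    have e3 : ∀ y, 0 ≤ y → ∀ τ, dT (dY (chainSum K u)) y τ
        = -chainSum K (fun n => dHalf (delay u 1 n)) y τ := fun y hy τ => by
      rw [dT_congr e1 hy, dT_chainSum, funext (hdelay 1)]
    have hneg : ∀ (G : ℝ → ℝ → ℝ) y τ, dT (fun y τ => -G y τ) y τ = -dT G y τ := fun G y τ =>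
      deriv.fun_neg
    have e4 : dT (dT (dY (chainSum K u))) y τ = chainSum K (fun n => dHalf (delay u 2 n)) y τ := by
      rw [dT_congr e3 hy, hneg, dT_chainSum, neg_neg, ← delay_delay, funext (hdelay 1)]
      congr 1
      funext n
      simp only [delay]
      split_ifs <;> first | rfl | exact (derivWithin_const _ _).symm
    have e5 : ∀ y, 0 ≤ y → ∀ τ, dT (chainSum K u) y τ = -chainSum K (delay u 1) y τ :=
      fun y _ τ => dT_chainSum τ
    have e6 : dT (dT (chainSum K u)) y τ = chainSum K (delay u 2) y τ := by
      rw [dT_congr e5 hy, hneg, dT_chainSum, neg_neg, delay_delay]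
    have h0 : ∀ n, delay u 0 n = u n := fun n => by simp [delay]
    rw [op, e2, e1 y hy, e3 y hy, e4, e5 y hy, e6]
    have key : ∀ n, y * P.a y * dHalf (dHalf (u n)) y
        + (P.b 0 y * dHalf (u n) y + P.b 1 y * dHalf (delay u 1 n) y
          + P.b 2 y * dHalf (delay u 2 n) y)
        + (P.c 0 y * u n y + P.c 1 y * delay u 1 n y + P.c 2 y * delay u 2 n y)
        = if n = N then (-1) ^ M * (M.factorial : ℝ) * c y else 0 := fun n => by
      have := (hu n).2 y hy
      rw [Fin.sum_univ_three] at this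
      simp only [Fin.val_zero, Fin.val_one, Fin.val_two, h0] at this
      linarith
    have hsum : y * P.a y * chainSum K (fun n => dHalf (dHalf (u n))) y τ
        + (P.b 0 y * chainSum K (fun n => dHalf (u n)) y τ
          - P.b 1 y * -chainSum K (fun n => dHalf (delay u 1 n)) y τ
          + P.b 2 y * chainSum K (fun n => dHalf (delay u 2 n)) y τ)
        + (P.c 0 y * chainSum K u y τ - P.c 1 y * -chainSum K (delay u 1) y τ
          + P.c 2 y * chainSum K (delay u 2) y τ)
        = ∑ j ∈ Finset.range (K + 1), (if K - j = N then (-1) ^ M * (M.factorial : ℝ) * c y else 0)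
          * ((-τ) ^ j / (j.factorial : ℝ)) := by
      simp only [chainSum, mul_neg, sub_neg_eq_add, Finset.mul_sum, ← Finset.sum_add_distrib]
      refine Finset.sum_congr rfl fun j _ => ?_
      rw [← key (K - j)]
      ring
    rw [hsum, Finset.sum_eq_single M]
    · have h5 : (M.factorial : ℝ) ≠ 0 := by exact_mod_cast M.factorial_ne_zero
      have h6 : ((-1 : ℝ) ^ M) * (-1) ^ M = 1 := by rw [← mul_pow]; simp
      rw [if_pos (by omega), neg_pow τ]
      field_simp
      linear_combination c y * τ ^ M * h6
    · intro j hj hjM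
      have := Finset.mem_range.1 hj
      rw [if_neg (by omega), zero_mul]
    · intro h
      exact absurd (Finset.mem_range.2 (by omega)) h
  | add h1 h2 ih1 ih2 =>
    obtain ⟨g, hg, e⟩ := ih1
    obtain ⟨g', hg', e'⟩ := ih2
    refine ⟨_, hg.add hg', fun y hy τ => ?_⟩
    have a1 : ∀ y, 0 ≤ y → ∀ τ, dY (fun y τ => g y τ + g' y τ) y τ = dY g y τ + dY g' y τ :=
      fun y hy τ => dY_add hg hg' hy τ
    have a2 : ∀ y, 0 ≤ y → ∀ τ, dT (fun y τ => g y τ + g' y τ) y τ = dT g y τ + dT g' y τ :=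
      fun y hy τ => dT_add hg hg' hy τ
    have a3 : ∀ y, 0 ≤ y → ∀ τ, dT (dY (fun y τ => g y τ + g' y τ)) y τ
        = dT (dY g) y τ + dT (dY g') y τ :=
      fun y hy τ => (dT_congr a1 hy τ).trans (dT_add hg.dY hg'.dY hy τ)
    simp only [op]
    rw [dY_congr a1 hy, dY_add hg.dY hg'.dY hy, dT_congr a3 hy, dT_add hg.dY.dT hg'.dY.dT hy,
      dT_congr a2 hy, dT_add hg.dT hg'.dT hy, a1 y hy, a2 y hy, a3 y hy, ← e y hy τ, ← e' y hy τ]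
    simp only [op]
    ring
  | congr _ h ih =>
    obtain ⟨g, hg, e⟩ := ih
    exact ⟨g, hg, fun y hy τ => (e y hy τ).trans (h y hy τ).symm⟩

end TwoPointPencil

end WaveBlowup

end

/-! ### The linearized operator in divergence form and as a pencil -/

noncomputable section

namespace WaveBlowup

open Set MeasureTheory Filter Topology

/-- The profile of the divergence of a self-similar vector field. -/
def dv (d : ℕ) (κ : ℝ) (B₀ B₁ : ℝ → ℝ → ℝ) (y τ : ℝ) : ℝ :=
  -(2 * y * dY B₀ y τ + dT B₀ y τ - (κ - 1) * B₀ y τ) + d * B₁ y τ + 2 * y * dY B₁ y τ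

lemma TauPoly.dv {B₀ B₁ : ℝ → ℝ → ℝ} (h₀ : TauPoly B₀) (h₁ : TauPoly B₁) (d : ℕ) (κ : ℝ) :
    TauPoly (dv d κ B₀ B₁) :=
  ((((TauPoly.id.const_mul 2).mul h₀.dY).add h₀.dT).sub (h₀.const_mul (κ - 1))).neg
    |>.add (h₁.const_mul d) |>.add ((TauPoly.id.const_mul 2).mul h₁.dY)

lemma dv_congr {B₀ B₁ B₀' B₁' : ℝ → ℝ → ℝ} {d : ℕ} {κ : ℝ}
    (h₀ : ∀ y, 0 ≤ y → ∀ τ, B₀ y τ = B₀' y τ) (h₁ : ∀ y, 0 ≤ y → ∀ τ, B₁ y τ = B₁' y τ) {y : ℝ}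
    (hy : 0 ≤ y) (τ : ℝ) : dv d κ B₀ B₁ y τ = dv d κ B₀' B₁' y τ := by
  rw [dv, dv, dY_congr h₀ hy, dT_congr h₀ hy, dY_congr h₁ hy, h₀ y hy, h₁ y hy]

lemma dv_add {B₀ B₁ B₀' B₁' : ℝ → ℝ → ℝ} {d : ℕ} {κ : ℝ} (h₀ : TauPoly B₀) (h₁ : TauPoly B₁)
    (h₀' : TauPoly B₀') (h₁' : TauPoly B₁') {y : ℝ} (hy : 0 ≤ y) (τ : ℝ) :
    dv d κ (fun y τ => B₀ y τ + B₀' y τ) (fun y τ => B₁ y τ + B₁' y τ) y τ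
      = dv d κ B₀ B₁ y τ + dv d κ B₀' B₁' y τ := by
  rw [dv, dv, dv, dY_add h₀ h₀' hy, dT_add h₀ h₀' hy, dY_add h₁ h₁' hy]
  ring

/-- Expansion of a second order operator in divergence form. -/
theorem dv_eq {E C H N : ℝ → ℝ} (hE : ContDiffOn ℝ ∞ E (Ici 0)) (hC : ContDiffOn ℝ ∞ C (Ici 0))
    (hH : ContDiffOn ℝ ∞ H (Ici 0)) (hN : ContDiffOn ℝ ∞ N (Ici 0)) {g : ℝ → ℝ → ℝ}
    (hg : TauPoly g) (d : ℕ) (μ lam : ℝ) {y : ℝ} (hy : 0 ≤ y) (τ : ℝ) :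
    dv d (2 * μ + lam)
      (fun y τ => 2 * y * E y * dY g y τ - C y * (lam * g y τ - dT g y τ))
      (fun y τ => 2 * H y * dY g y τ - N y * (lam * g y τ - dT g y τ)) y τ
    = y * (4 * (H y - y * E y)) * dY (dY g) y τ
      + ((-4 * y * (E y + y * dHalf E y) + (2 * μ - 1) * (2 * y * E y) + 2 * d * H y
          + 4 * y * dHalf H y) + lam * (2 * y * (E y + C y - N y))) * dY g y τ
      - 2 * y * (E y + C y - N y) * dT (dY g) y τ
      + (lam * (2 * y * dHalf C y - (2 * μ - 1) * C y - d * N y - 2 * y * dHalf N y)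
          + lam ^ 2 * -C y) * g y τ
      - ((2 * y * dHalf C y - (2 * μ - 1) * C y - d * N y - 2 * y * dHalf N y)
          + 2 * lam * -C y) * dT g y τ
      + -C y * dT (dT g) y τ := by
  have hy' := hasDerivWithinAt_id y (Ici 0)
  have hM : HasDerivWithinAt (fun r => lam * g r τ - dT g r τ)
      (lam * dY g y τ - dT (dY g) y τ) (Ici 0) y := by
    rw [dT_dY hg hy]
    exact ((hg.hasY hy τ).const_mul lam).sub (hg.dT.hasY hy τ)
  have hMt : HasDerivAt (fun r => lam * g y r - dT g y r)
      (lam * dT g y τ - dT (dT g) y τ) τ :=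
    ((hg.hasT hy τ).const_mul lam).sub (hg.dT.hasT hy τ)
  have e1 : dY (fun y τ => 2 * y * E y * dY g y τ - C y * (lam * g y τ - dT g y τ)) y τ
      = (2 * E y + 2 * y * dHalf E y) * dY g y τ + 2 * y * E y * dY (dY g) y τ
        - (dHalf C y * (lam * g y τ - dT g y τ) + C y * (lam * dY g y τ - dT (dY g) y τ)) := by
    have := (((hy'.const_mul 2).mul (hasDerivWithinAt_dHalf hE hy)).mul (hg.dY.hasY hy τ)).sub
      ((hasDerivWithinAt_dHalf hC hy).mul hM)
    refine dHalf_eq hy (this.congr_deriv ?_)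
    simp
  have e2 : dY (fun y τ => 2 * H y * dY g y τ - N y * (lam * g y τ - dT g y τ)) y τ
      = 2 * dHalf H y * dY g y τ + 2 * H y * dY (dY g) y τ
        - (dHalf N y * (lam * g y τ - dT g y τ) + N y * (lam * dY g y τ - dT (dY g) y τ)) :=
    dHalf_eq hy ((((hasDerivWithinAt_dHalf hH hy).const_mul 2).mul (hg.dY.hasY hy τ)).sub
      ((hasDerivWithinAt_dHalf hN hy).mul hM))
  have e3 : dT (fun y τ => 2 * y * E y * dY g y τ - C y * (lam * g y τ - dT g y τ)) y τ
      = 2 * y * E y * dT (dY g) y τ - C y * (lam * dT g y τ - dT (dT g) y τ) :=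
    (((hg.dY.hasT hy τ).const_mul _).sub (hMt.const_mul _)).deriv
  rw [dv, e1, e2, e3]
  ring

namespace RadialProfile

variable {d p : ℕ} {β : ℝ} (P : RadialProfile d p β)

/-- `1 - v²`. -/
def w (y : ℝ) : ℝ := 1 - y * P.q y ^ 2

/-- `(ℓ - 1) R² / (1 - v²)`. -/
def om (y : ℝ) : ℝ := (ell p - 1) * P.R y ^ 2 / P.w y

lemma smooth_w : ContDiffOn ℝ ∞ P.w (Ici 0) :=
  contDiffOn_const.sub (contDiffOn_id.mul (P.smooth_q.pow 2))

lemma smooth_om : ContDiffOn ℝ ∞ P.om (Ici 0) :=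
  (contDiffOn_const.mul (P.smooth_R.pow 2)).div P.smooth_w fun y hy => (P.w_pos y hy).ne'

/-- Coefficient of the linearized operator. -/
def cE (y : ℝ) : ℝ := P.R y ^ 2 + (1 - P.q y) * P.om y

/-- Coefficient of the linearized operator. -/
def cC (y : ℝ) : ℝ := P.R y ^ 2 + P.om y

/-- Coefficient of the linearized operator. -/
def cH (y : ℝ) : ℝ := P.R y ^ 2 + y * P.q y * (1 - P.q y) * P.om y

/-- Coefficient of the linearized operator. -/
def cN (y : ℝ) : ℝ := P.q y * P.om y

lemma smooth_E : ContDiffOn ℝ ∞ P.cE (Ici 0) :=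
  (P.smooth_R.pow 2).add ((contDiffOn_const.sub P.smooth_q).mul P.smooth_om)

lemma smooth_C : ContDiffOn ℝ ∞ P.cC (Ici 0) := (P.smooth_R.pow 2).add P.smooth_om

lemma smooth_H : ContDiffOn ℝ ∞ P.cH (Ici 0) :=
  (P.smooth_R.pow 2).add (((contDiffOn_id.mul P.smooth_q).mul
    (contDiffOn_const.sub P.smooth_q)).mul P.smooth_om)

lemma smooth_N : ContDiffOn ℝ ∞ P.cN (Ici 0) := P.smooth_q.mul P.smooth_om

lemma om_pos (hp : 3 ≤ p) {y : ℝ} (hy : 0 ≤ y) : 0 < P.om y :=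
  div_pos (mul_pos (by linarith [one_lt_ell hp]) (pow_pos (P.R_pos y hy) 2)) (P.w_pos y hy)

lemma cC_pos (hp : 3 ≤ p) {y : ℝ} (hy : 0 ≤ y) : 0 < P.cC y :=
  add_pos (pow_pos (P.R_pos y hy) 2) (P.om_pos hp hy)

/-- The principal coefficient. -/
lemma principal_eq {y : ℝ} (hy : 0 ≤ y) : 4 * (P.cH y - y * P.cE y)
    = 4 * P.R y ^ 2 / P.w y * ((1 - y * P.q y) ^ 2 - ell p * (y * (1 - P.q y) ^ 2)) := by
  have hw : 1 - y * P.q y ^ 2 ≠ 0 := (P.w_pos y hy).ne'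
  -- The discriminant appears through `(1 - y)(1 - y q²) = (1 - y q)² - y (1 - q)²`.
  simp only [cH, cE, om, w]
  field_simp
  ring

/-- The first order coefficient at `Λ = 0`. -/
def cb0 (μ : ℝ) (y : ℝ) : ℝ :=
  -4 * y * (P.cE y + y * dHalf P.cE y) + (2 * μ - 1) * (2 * y * P.cE y) + 2 * d * P.cH y
    + 4 * y * dHalf P.cH y

/-- The first order coefficient of `Λ`. -/
def cb1 (y : ℝ) : ℝ := 2 * y * (P.cE y + P.cC y - P.cN y)

/-- The zeroth order coefficient of `Λ`. -/
def cc1 (μ : ℝ) (y : ℝ) : ℝ :=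
  2 * y * dHalf P.cC y - (2 * μ - 1) * P.cC y - d * P.cN y - 2 * y * dHalf P.cN y

lemma smooth_cb0 (μ : ℝ) : ContDiffOn ℝ ∞ (P.cb0 μ) (Ici 0) := by
  have h1 := P.smooth_E
  have h2 := dHalf_smooth P.smooth_E
  have h3 := P.smooth_H
  have h4 := dHalf_smooth P.smooth_H
  unfold cb0
  fun_prop

lemma smooth_cb1 : ContDiffOn ℝ ∞ P.cb1 (Ici 0) := by
  have h1 := P.smooth_E
  have h2 := P.smooth_C
  have h3 := P.smooth_N
  unfold cb1
  fun_prop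

lemma smooth_cc1 (μ : ℝ) : ContDiffOn ℝ ∞ (P.cc1 μ) (Ici 0) := by
  have h1 := P.smooth_C
  have h2 := dHalf_smooth P.smooth_C
  have h3 := P.smooth_N
  have h4 := dHalf_smooth P.smooth_N
  unfold cc1
  fun_prop

/-- The sign comes from `1 - q > 0` at the sonic point; it lets a negative `Λ` make the first order
coefficient nonpositive there. -/
lemma cb1_pos (hp : 3 ≤ p) : 0 < P.cb1 P.y₁ := by
  have h1 := P.y₁_pos
  have h2 := P.one_sub_q_pos
  have h3 := P.om_pos hp h1.le
  have h4 := P.R_pos P.y₁ h1.le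
  have : P.cb1 P.y₁ = 2 * P.y₁ * (2 * P.R P.y₁ ^ 2 + 2 * ((1 - P.q P.y₁) * P.om P.y₁)) := by
    simp only [cb1, cE, cC, cN]; ring
  rw [this]
  positivity

/-- The maximum principle holds for very negative `Λ`. -/
lemma exists_shift (hp : 3 ≤ p) (μ : ℝ) : ∃ L : ℝ, P.cb0 μ P.y₁ + L * P.cb1 P.y₁ ≤ 0 ∧
    ∀ y ∈ Icc 0 P.y₁, L * P.cc1 μ y + L ^ 2 * -P.cC y < 0 := by
  obtain ⟨K, hK⟩ := isCompact_Icc.exists_bound_of_continuousOn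
    (((P.smooth_cc1 μ).continuousOn.div P.smooth_C.continuousOn
      fun y hy => (P.cC_pos hp hy).ne').mono (show Icc 0 P.y₁ ⊆ Ici 0 from Icc_subset_Ici_self))
  have hb := P.cb1_pos hp
  -- For `Λ = -m`, the bound `K` on `|cc1 / cC|` makes `-Λ² cC` dominate `Λ cc1`, and the last entry
  -- of the maximum gives the sign of the first order coefficient at `y₁`.
  set m := max (max (K + 1) 1) (P.cb0 μ P.y₁ / P.cb1 P.y₁) with hm
  have m1 : K + 1 ≤ m := (le_max_left _ _).trans (le_max_left _ _)
  have m2 : 1 ≤ m := (le_max_right _ _).trans (le_max_left _ _)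
  have m3 : P.cb0 μ P.y₁ / P.cb1 P.y₁ ≤ m := le_max_right _ _
  refine ⟨-m, ?_, fun y hy => ?_⟩
  · rw [div_le_iff₀ hb] at m3
    linarith
  · have hC := P.cC_pos hp hy.1
    have h1 := (abs_le.1 (hK y hy)).1
    rw [Pi.div_apply, le_div_iff₀ hC] at h1
    have h2 : 0 < P.cc1 μ y + m * P.cC y := by nlinarith
    nlinarith

/-- The linearized operator as a pencil. -/
theorem exists_pencil (hp : 3 ≤ p) (μ lam : ℝ) : ∃ Q : TwoPointPencil,
    (Q.a = fun y => 4 * (P.cH y - y * P.cE y)) ∧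
    Q.b = ![fun y => P.cb0 μ y + lam * P.cb1 y, P.cb1, 0] ∧
    Q.c = ![fun y => lam * P.cc1 μ y + lam ^ 2 * -P.cC y,
      fun y => P.cc1 μ y + 2 * lam * -P.cC y, fun y => -P.cC y] := by
  obtain ⟨L, hL, hL'⟩ := P.exists_shift hp μ
  have hy₁ := P.y₁_pos
  have hfac : ∀ y, 0 ≤ y → 0 < 4 * P.R y ^ 2 / P.w y := fun y hy =>
    div_pos (mul_pos four_pos (pow_pos (P.R_pos y hy) 2)) (P.w_pos y hy)
  have hb0 := P.smooth_cb0 μ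
  have hb1 := P.smooth_cb1
  have hc1 := P.smooth_cc1 μ
  have hC := P.smooth_C
  have hE := P.smooth_E
  have hH := P.smooth_H
  refine ⟨
    { y₁ := P.y₁
      a := fun y => 4 * (P.cH y - y * P.cE y)
      b := ![fun y => P.cb0 μ y + lam * P.cb1 y, P.cb1, 0]
      c := ![fun y => lam * P.cc1 μ y + lam ^ 2 * -P.cC y,
        fun y => P.cc1 μ y + 2 * lam * -P.cC y, fun y => -P.cC y]
      -- The pencil is expanded around `Λ = lam`, so `ε₀` corresponds to `Λ = L`.
      ε₀ := L - lam
      y₁_pos := hy₁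
      smooth_a := by fun_prop
      smooth_b := fun l => by
        fin_cases l
        · exact hb0.add (contDiffOn_const.mul hb1)
        · exact hb1
        · exact contDiffOn_const
      smooth_c := fun l => by
        fin_cases l
        · exact (contDiffOn_const.mul hc1).add (contDiffOn_const.mul hC.neg)
        · exact hc1.add (contDiffOn_const.mul hC.neg)
        · exact hC.neg
      a_pos := fun y hy h => by
        rw [P.principal_eq hy]
        exact mul_pos (hfac y hy) (P.disc_pos y hy h)
      a_neg := fun y h => by
        rw [P.principal_eq (hy₁.le.trans h.le)]
        exact mul_neg_of_pos_of_neg (hfac y (hy₁.le.trans h.le)) (P.disc_neg y h)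
      a_zero := by rw [P.principal_eq hy₁.le, P.disc_zero, mul_zero]
      a_deriv := ?_
      b_left := ?_
      b_right := ?_
      c_neg := ?_ }, rfl, rfl, rfl⟩
  · have hd1 : ContDiffOn ℝ ∞ (fun y => 4 * P.R y ^ 2 / P.w y) (Ici 0) :=
      (contDiffOn_const.mul (P.smooth_R.pow 2)).div P.smooth_w fun y hy => (P.w_pos y hy).ne'
    have hq := P.smooth_q
    have hd2 : ContDiffOn ℝ ∞ (fun y => (1 - y * P.q y) ^ 2 - ell p * (y * (1 - P.q y) ^ 2))
        (Ici 0) := by fun_prop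
    have h1 := (hasDerivWithinAt_dHalf hd1 hy₁.le).mul (hasDerivWithinAt_dHalf hd2 hy₁.le)
    have h2 := h1.congr (f₁ := fun y => 4 * (P.cH y - y * P.cE y))
      (fun y hy => P.principal_eq hy) (P.principal_eq hy₁.le)
    rw [h2.derivWithin (uniqueDiffOn_Ici 0 _ hy₁.le), P.disc_zero, mul_zero, zero_add]
    exact mul_ne_zero (hfac _ hy₁.le).ne' P.disc_deriv
  -- At `y = 0` only `2 d H(0) = 2 d R(0)²` survives.
  · have h0 : 0 < P.R 0 ^ 2 := pow_pos (P.R_pos 0 le_rfl) 2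
    simp [Fin.sum_univ_three, cb0, cb1, cH]
    positivity
  · simp [Fin.sum_univ_three]
    linarith
  · intro y hy
    have := hL' y hy
    simp [Fin.sum_univ_three]
    linarith

/-- Solvability of the linearized equation, in divergence form. -/
theorem exists_dv_eq (hp : 3 ≤ p) (μ lam : ℝ) {h : ℝ → ℝ → ℝ} (hh : TauPoly h) :
    ∃ g, TauPoly g ∧ ∀ y, 0 ≤ y → ∀ τ, dv d (2 * μ + lam)
      (fun y τ => 2 * y * P.cE y * dY g y τ - P.cC y * (lam * g y τ - dT g y τ))
      (fun y τ => 2 * P.cH y * dY g y τ - P.cN y * (lam * g y τ - dT g y τ)) y τ = h y τ := by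
  obtain ⟨Q, ha, hb, hc⟩ := P.exists_pencil hp μ lam
  obtain ⟨g, hg, e⟩ := Q.exists_op_eq hh
  refine ⟨g, hg, fun y hy τ => ?_⟩
  rw [dv_eq P.smooth_E P.smooth_C P.smooth_H P.smooth_N hg d μ lam hy τ, ← e y hy τ,
    TwoPointPencil.op, ha, hb, hc]
  simp [cb0, cb1, cc1]
  ring

end RadialProfile

end WaveBlowup

end

/-! ### Solving the linearized equations with self-similar data -/

noncomputable section

namespace WaveBlowup

open Set MeasureTheory Filter Topology

namespace RadialProfile

variable {d p : ℕ} {β T : ℝ} (P : RadialProfile d p β)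

/-- The profile of the time derivative of the phase. -/
def A (y : ℝ) : ℝ := (β - 1) * P.Φ y / (1 - y * P.q y)

lemma smooth_A : ContDiffOn ℝ ∞ P.A (Ici 0) :=
  (contDiffOn_const.mul P.smooth_Φ).div (contDiffOn_const.sub (contDiffOn_id.mul P.smooth_q))
    fun y hy => (P.e_pos y hy).ne'

lemma A_pos (hβ : 1 < β) {y : ℝ} (hy : 0 ≤ y) : 0 < P.A y :=
  div_pos (mul_pos (by linarith) (P.Φ_pos y hy)) (P.e_pos y hy)

lemma A_mul {y : ℝ} (hy : 0 ≤ y) : P.A y * (1 - y * P.q y) = (β - 1) * P.Φ y :=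
  div_mul_cancel₀ _ (P.e_pos y hy).ne'

lemma dHalf_Φ {y : ℝ} (hy : 0 ≤ y) : dHalf P.Φ y = P.A y * P.q y / 2 := P.Φ_deriv y hy

lemma R_pow' {y : ℝ} (hy : 0 ≤ y) : P.R y ^ (p - 1) = P.A y ^ 2 * P.w y := P.R_pow y hy

lemma pd_zero_phase {φ₀ : STFun d ℝ} (hφ₀ : SlabEq T φ₀ (fld T (1 - β) fun y _ => P.Φ y)) :
    SlabEq T (pd T 0 φ₀) (fld T (-β) fun y _ => P.A y) := by
  intro t ht x
  rw [hφ₀.pd 0 t ht x, pd_zero_fld (TauPoly.coeff P.smooth_Φ) _ ht, show 1 - β - 1 = -β by ring]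
  have hy : 0 ≤ ‖x‖ ^ 2 / (T - t) ^ 2 := by positivity
  simp only [fld, dY_coeff, dT_coeff, P.dHalf_Φ hy]
  linear_combination (T - t) ^ (-β) * -(P.A_mul hy)

lemma pd_succ_phase {φ₀ : STFun d ℝ} (hφ₀ : SlabEq T φ₀ (fld T (1 - β) fun y _ => P.Φ y))
    (j : Fin d) : SlabEq T (pd T j.succ φ₀)
      fun t x => x j * fld T (-β - 1) (fun y _ => P.A y * P.q y) t x := by
  intro t ht x
  rw [hφ₀.pd j.succ t ht x, pd_succ_fld (TauPoly.coeff P.smooth_Φ) _ ht,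
    show 1 - β - 2 = -β - 1 by ring]
  have hy : 0 ≤ ‖x‖ ^ 2 / (T - t) ^ 2 := by positivity
  simp only [fld, dY_coeff, P.dHalf_Φ hy]
  ring

lemma mform_phase {φ₀ φ : STFun d ℝ} (hφ₀ : SlabEq T φ₀ (fld T (1 - β) fun y _ => P.Φ y))
    {lam : ℝ} {g : ℝ → ℝ → ℝ} (hg : TauPoly g) (hφ : SlabEq T φ (fld T lam g)) :
    SlabEq T (mform T φ₀ φ) (fld T (lam - β - 1) fun y τ =>
      P.A y * (lam * g y τ - dT g y τ - 2 * y * (1 - P.q y) * dY g y τ)) := by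
  intro t ht x
  rw [hφ₀.mform hφ t ht x, mform_fld (TauPoly.coeff P.smooth_Φ) hg _ _ t ht x,
    show 1 - β + lam - 2 = lam - β - 1 by ring]
  have hy : 0 ≤ ‖x‖ ^ 2 / (T - t) ^ 2 := by positivity
  simp only [fld, dY_coeff, dT_coeff, P.dHalf_Φ hy]
  linear_combination (T - t) ^ (lam - β - 1) * (2 * (‖x‖ ^ 2 / (T - t) ^ 2)
    * dY g (‖x‖ ^ 2 / (T - t) ^ 2) (-Real.log (T - t))
    + dT g (‖x‖ ^ 2 / (T - t) ^ 2) (-Real.log (T - t))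
    - lam * g (‖x‖ ^ 2 / (T - t) ^ 2) (-Real.log (T - t))) * P.A_mul hy

/-- Together with `mform_phase_self` this is the equation of order zero `ρ₀^(p-1) = -∂^α φ₀ ∂_α φ₀`.
It also shows that the coefficient of `ρ_n` in the first linearized equation does not vanish when `1
< β`. -/
lemma modulus_pow (hp : 3 ≤ p) {ρ₀ : STFun d ℝ}
    (hρ₀ : SlabEq T ρ₀ (fld T (-(2 * β / ((p : ℝ) - 1))) fun y _ => P.R y)) :
    SlabEq T (fun t x => ρ₀ t x ^ (p - 1)) (fld T (-(2 * β)) fun y _ => P.A y ^ 2 * P.w y) := by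
  intro t ht x
  have hs : 0 < T - t := by linarith [ht.2]
  have hpR : (3 : ℝ) ≤ p := by exact_mod_cast hp
  beta_reduce
  rw [hρ₀ t ht x]
  simp only [fld, mul_pow]
  rw [P.R_pow' (by positivity), ← Real.rpow_natCast, ← Real.rpow_mul hs.le,
    Nat.cast_sub (by omega), Nat.cast_one, neg_mul, div_mul_cancel₀ _ (by linarith)]

/-- Solvability of the linearized equations. -/
theorem exists_linear_solution (hp : 3 ≤ p) (hβ : 1 < β) {φ₀ ρ₀ F G : STFun d ℝ} {μ₀ : ℝ}
    (hμ₀ : μ₀ = -(2 * β / ((p : ℝ) - 1))) (hφ₀ : SlabEq T φ₀ (fld T (1 - β) fun y _ => P.Φ y))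
    (hρ₀ : SlabEq T ρ₀ (fld T μ₀ fun y _ => P.R y)) {lam : ℝ}
    (hF : InX T (lam + μ₀ - β - 1) F) (hG : InX T (lam + μ₀ - 2) G) :
    ∃ φ ρ : STFun d ℝ, InX T lam φ ∧ InX T (lam + μ₀ + β - 1) ρ ∧
      ∀ t ∈ Ico 0 T, ∀ x,
        ((p : ℝ) - 1) * ρ₀ t x ^ (p - 1) * ρ t x + 2 * ρ₀ t x * mform T φ₀ φ t x = F t x ∧
        div T (fun α t x => ρ₀ t x ^ 2 * pd T α φ t x) t x
          + 2 * div T (fun α t x => ρ₀ t x * pd T α φ₀ t x * ρ t x) t x = ρ₀ t x * G t x := by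
  obtain ⟨f, hf, hFf⟩ := hF
  obtain ⟨f', hf', hGf⟩ := hG
  have hpR : (3 : ℝ) ≤ p := by exact_mod_cast hp
  have hp1 : (p : ℝ) - 1 ≠ 0 := by linarith
  have hA := P.smooth_A
  have hw := P.smooth_w
  have hR := P.smooth_R
  have hq := P.smooth_q
  have hA0 : ∀ y, 0 ≤ y → P.A y ≠ 0 := fun y hy => (P.A_pos hβ hy).ne'
  have hw0 : ∀ y, 0 ≤ y → P.w y ≠ 0 := fun y hy => (P.w_pos y hy).ne'
  have hcs : ContDiffOn ℝ ∞ (fun y => 2 * P.R y / (((p : ℝ) - 1) * P.A y * P.w y)) (Ici 0) :=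
    (contDiffOn_const.mul hR).div ((contDiffOn_const.mul hA).mul hw)
      fun y hy => mul_ne_zero (mul_ne_zero hp1 (hA0 y hy)) (hw0 y hy)
  -- The part of `2 ρ₀ ∂φ₀ ρ_n` due to the source `F`. It does not contain `g`, and its divergence
  -- goes to the right-hand side of the equation for `g`.
  set S : ℝ → ℝ → ℝ := fun y τ => 2 * P.R y / (((p : ℝ) - 1) * P.A y * P.w y) * f y τ with hS
  have hSp : TauPoly S := (TauPoly.coeff hcs).mul hf
  have hqS : TauPoly fun y τ => P.q y * S y τ := (TauPoly.coeff hq).mul hSp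
  obtain ⟨g, hg, hgeq⟩ := P.exists_dv_eq hp μ₀ lam
    (((TauPoly.coeff hR).mul hf').sub (hSp.dv hqS d (2 * μ₀ + lam)))
  set M : ℝ → ℝ → ℝ := fun y τ => lam * g y τ - dT g y τ - 2 * y * (1 - P.q y) * dY g y τ with hM
  have hMp : TauPoly M := ((hg.const_mul lam).sub hg.dT).sub
    (((TauPoly.id.const_mul 2).mul (TauPoly.coeff (contDiffOn_const.sub hq))).mul hg.dY)
  have hrs : ContDiffOn ℝ ∞ (fun y => 1 / (((p : ℝ) - 1) * P.A y ^ 2 * P.w y)) (Ici 0) :=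
    contDiffOn_const.div ((contDiffOn_const.mul (hA.pow 2)).mul hw)
      fun y hy => mul_ne_zero (mul_ne_zero hp1 (pow_ne_zero 2 (hA0 y hy))) (hw0 y hy)
  -- The profile of `ρ_n`, obtained by solving the first equation. Substitution gives `2 R A r = S -
  -- om * M`, and this is where the coefficients `cE`, `cC`, `cH`, `cN` come from.
  set r : ℝ → ℝ → ℝ := fun y τ =>
    1 / (((p : ℝ) - 1) * P.A y ^ 2 * P.w y) * (f y τ - 2 * P.R y * P.A y * M y τ) with hr
  have hrp : TauPoly r := (TauPoly.coeff hrs).mul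
    (hf.sub ((TauPoly.coeff ((contDiffOn_const.mul hR).mul hA)).mul hMp))
  set φ : STFun d ℝ := fld T lam g with hφ
  set ρ : STFun d ℝ := fld T (lam + μ₀ + β - 1) r with hρ
  refine ⟨φ, ρ, ⟨g, hg, fun _ _ _ => rfl⟩, ⟨r, hrp, fun _ _ _ => rfl⟩, fun t ht x => ⟨?_, ?_⟩⟩
  · have hpow := P.modulus_pow hp (T := T) (by rw [← hμ₀]; exact hρ₀) t ht x
    beta_reduce at hpow
    have hm := P.mform_phase hφ₀ hg (φ := φ) (fun _ _ _ => rfl) t ht x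
    have e1 := fld_mul_fld (-(2 * β)) (lam + μ₀ + β - 1) (fun y _ => P.A y ^ 2 * P.w y) r ht x
    have e2 := fld_mul_fld μ₀ (lam - β - 1) (fun y _ => P.R y) (fun y τ => P.A y * M y τ) ht x
    rw [hpow, hm, hρ₀ t ht x, hFf t ht x, mul_assoc, mul_assoc, e1, e2,
      show -(2 * β) + (lam + μ₀ + β - 1) = lam + μ₀ - β - 1 by ring,
      show μ₀ + (lam - β - 1) = lam + μ₀ - β - 1 by ring]
    have hy : 0 ≤ ‖x‖ ^ 2 / (T - t) ^ 2 := by positivity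
    have h1 := hA0 _ hy
    have h2 := hw0 _ hy
    simp only [fld, hr]
    field_simp
    ring
  · set κ := 2 * μ₀ + lam with hκ
    have hb0 : TauPoly fun y τ => P.R y ^ 2 * (2 * y * dY g y τ + dT g y τ - lam * g y τ) :=
      (TauPoly.coeff (hR.pow 2)).mul
        ((((TauPoly.id.const_mul 2).mul hg.dY).add hg.dT).sub (hg.const_mul lam))
    have hb1 : TauPoly fun y τ => P.R y ^ 2 * (2 * dY g y τ) :=
      (TauPoly.coeff (hR.pow 2)).mul (hg.dY.const_mul 2)
    have hc0 : TauPoly fun y τ => P.R y * P.A y * r y τ := (TauPoly.coeff (hR.mul hA)).mul hrp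
    have hc1 : TauPoly fun y τ => P.R y * (P.A y * P.q y) * r y τ :=
      (TauPoly.coeff (hR.mul (hA.mul hq))).mul hrp
    have hE0 : TauPoly fun y τ => 2 * y * P.cE y * dY g y τ - P.cC y * (lam * g y τ - dT g y τ) :=
      ((((TauPoly.id.const_mul 2).mul (TauPoly.coeff P.smooth_E))).mul hg.dY).sub
        ((TauPoly.coeff P.smooth_C).mul ((hg.const_mul lam).sub hg.dT))
    have hE1 : TauPoly fun y τ => 2 * P.cH y * dY g y τ - P.cN y * (lam * g y τ - dT g y τ) :=
      (((TauPoly.coeff P.smooth_H).const_mul 2).mul hg.dY).sub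
        ((TauPoly.coeff P.smooth_N).mul ((hg.const_mul lam).sub hg.dT))
    have hsq : ∀ t ∈ Ico 0 T, ∀ x, ρ₀ t x ^ 2 = fld T (μ₀ + μ₀) (fun y _ => P.R y * P.R y) t x :=
      fun t ht x => by rw [hρ₀ t ht x, sq, fld_mul_fld _ _ _ _ ht]
    have hd1 := div_fld hb0 hb1 κ (T := T) (V := fun α t x => ρ₀ t x ^ 2 * pd T α φ t x)
      (fun t ht x => by
        beta_reduce
        rw [hsq t ht x, pd_zero_fld hg _ ht, fld_mul_fld _ _ _ _ ht,
          show μ₀ + μ₀ + (lam - 1) = κ - 1 by rw [hκ]; ring]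
        simp only [fld, sq])
      (fun j t ht x => by
        beta_reduce
        rw [hsq t ht x, pd_succ_fld hg _ ht, mul_left_comm, fld_mul_fld _ _ _ _ ht,
          show μ₀ + μ₀ + (lam - 2) = κ - 2 by rw [hκ]; ring]
        simp only [fld, sq]) t ht x
    have hd2 := div_fld hc0 hc1 κ (T := T) (V := fun α t x => ρ₀ t x * pd T α φ₀ t x * ρ t x)
      (fun t ht x => by
        beta_reduce
        rw [hρ₀ t ht x, P.pd_zero_phase hφ₀ t ht x, fld_mul_fld _ _ _ _ ht, fld_mul_fld _ _ _ _ ht,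
          show μ₀ + -β + (lam + μ₀ + β - 1) = κ - 1 by rw [hκ]; ring])
      (fun j t ht x => by
        beta_reduce
        rw [hρ₀ t ht x, P.pd_succ_phase hφ₀ j t ht x, mul_left_comm, mul_assoc,
          fld_mul_fld _ _ _ _ ht, fld_mul_fld _ _ _ _ ht,
          show μ₀ + (-β - 1) + (lam + μ₀ + β - 1) = κ - 2 by rw [hκ]; ring]) t ht x
    rw [hd1, hd2, hρ₀ t ht x, hGf t ht x, fld_mul_fld _ _ _ _ ht,
      show μ₀ + (lam + μ₀ - 2) = κ - 2 by rw [hκ]; ring]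
    have hy : 0 ≤ ‖x‖ ^ 2 / (T - t) ^ 2 := by positivity
    have key : ∀ y, 0 ≤ y → ∀ τ,
        dv d κ (fun y τ => P.R y ^ 2 * (2 * y * dY g y τ + dT g y τ - lam * g y τ))
          (fun y τ => P.R y ^ 2 * (2 * dY g y τ)) y τ
        + 2 * dv d κ (fun y τ => P.R y * P.A y * r y τ)
          (fun y τ => P.R y * (P.A y * P.q y) * r y τ) y τ = P.R y * f' y τ := by
      intro y hy τ
      -- The factor `2` is realised by adding the same vector field twice.
      have s1 := dv_add (d := d) (κ := κ) (hb0.add hc0) (hb1.add hc1) hc0 hc1 hy τ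
      rw [dv_add hb0 hb1 hc0 hc1 hy τ] at s1
      have s2 := dv_add (d := d) (κ := κ) hE0 hE1 hSp hqS hy τ
      rw [hgeq y hy τ] at s2
      have s3 := dv_congr (d := d) (κ := κ)
        (B₀ := fun y τ => P.R y ^ 2 * (2 * y * dY g y τ + dT g y τ - lam * g y τ)
          + P.R y * P.A y * r y τ + P.R y * P.A y * r y τ)
        (B₁ := fun y τ => P.R y ^ 2 * (2 * dY g y τ) + P.R y * (P.A y * P.q y) * r y τ
          + P.R y * (P.A y * P.q y) * r y τ)
        (B₀' := fun y τ => 2 * y * P.cE y * dY g y τ - P.cC y * (lam * g y τ - dT g y τ) + S y τ)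
        (B₁' := fun y τ => 2 * P.cH y * dY g y τ - P.cN y * (lam * g y τ - dT g y τ)
          + P.q y * S y τ)
        (fun y hy τ => by
          have h1 := hA0 _ hy
          have h2 := hw0 _ hy
          simp only [cE, cC, om, ell, hS, hr, hM]
          field_simp
          ring)
        (fun y hy τ => by
          have h1 := hA0 _ hy
          have h2 := hw0 _ hy
          simp only [cH, cN, om, ell, hS, hr, hM]
          field_simp
          ring) hy τ
      linarith
    have hk := key _ hy (-Real.log (T - t))
    simp only [dv] at hk
    simp only [fld]
    rw [← hk]
    ring

end RadialProfile

end WaveBlowup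

end

noncomputable section

namespace WaveBlowup

open Set MeasureTheory Filter Topology

/-! ### The equations of order zero -/

namespace RadialProfile

variable {d p : ℕ} {β T : ℝ} (P : RadialProfile d p β)

lemma mform_phase_self {φ₀ : STFun d ℝ} (hφ₀ : SlabEq T φ₀ (fld T (1 - β) fun y _ => P.Φ y)) :
    SlabEq T (mform T φ₀ φ₀) (fld T (-(2 * β)) fun y _ => -(P.A y ^ 2 * P.w y)) := by
  intro t ht x
  rw [P.mform_phase hφ₀ (TauPoly.coeff P.smooth_Φ) hφ₀ t ht x,
    show 1 - β - β - 1 = -(2 * β) by ring]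
  have hy : 0 ≤ ‖x‖ ^ 2 / (T - t) ^ 2 := by positivity
  simp only [fld, dY_coeff, dT_coeff, P.dHalf_Φ hy, w]
  linear_combination (T - t) ^ (-(2 * β)) * P.A (‖x‖ ^ 2 / (T - t) ^ 2) * P.A_mul hy

/-- The profile equation is the continuity equation of order zero. -/
lemma continuity_algebra (hp : 3 ≤ p) {y : ℝ} (hy : 0 ≤ y) :
    2 * (-((2 * y * dHalf P.R y + 2 * β / ((p : ℝ) - 1) * P.R y) * P.A y)
        + 2 * y * dHalf P.R y * (P.A y * P.q y))
      + P.R y * (-(2 * y * dHalf P.A y + β * P.A y) + d * (P.A y * P.q y)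
        + 2 * y * (dHalf P.A y * P.q y + P.A y * dHalf P.q y)) = 0 := by
  have hpR : (3 : ℝ) ≤ p := by exact_mod_cast hp
  have hp1 : (p : ℝ) - 1 ≠ 0 := by linarith
  have hq := hasDerivWithinAt_dHalf P.smooth_q hy
  have hA := hasDerivWithinAt_dHalf P.smooth_A hy
  have hΦ := hasDerivWithinAt_dHalf P.smooth_Φ hy
  have hR := hasDerivWithinAt_dHalf P.smooth_R hy
  have hu := uniqueDiffOn_Ici (0 : ℝ) y hy
  have he : HasDerivWithinAt (fun y => 1 - y * P.q y) (-(1 * P.q y + y * dHalf P.q y)) (Ici 0) y :=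
    ((hasDerivWithinAt_id y _).mul hq).const_sub 1
  have hw : HasDerivWithinAt P.w (-(1 * P.q y ^ 2 + y * (2 * P.q y * dHalf P.q y))) (Ici 0) y := by
    have := ((hasDerivWithinAt_id y (Ici 0)).mul (hq.pow 2)).const_sub 1
    refine this.congr_deriv ?_
    simp
  have h2 : dHalf P.A y * (1 - y * P.q y) + P.A y * -(1 * P.q y + y * dHalf P.q y)
      = (β - 1) * dHalf P.Φ y :=
    hu.eq_deriv _ (hA.mul he) ((hΦ.const_mul (β - 1)).congr (fun r hr => P.A_mul hr) (P.A_mul hy))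
  rw [P.dHalf_Φ hy] at h2
  -- Derivative of `R^(p-1) = A² w`; multiplied by `R` below, it expresses `R'` by `A'` and `q'`
  -- without any power of `R` other than the first.
  have h1 : ((p : ℝ) - 1) * P.R y ^ (p - 2) * dHalf P.R y
      = 2 * P.A y * dHalf P.A y * P.w y
        + P.A y ^ 2 * -(1 * P.q y ^ 2 + y * (2 * P.q y * dHalf P.q y)) := by
    have a1 := hR.pow (p - 1)
    have a2 := (hA.pow 2).mul hw
    have a3 := hu.eq_deriv _ a1 (a2.congr (fun r hr => P.R_pow' hr) (P.R_pow' hy))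
    rw [Nat.cast_sub (by omega), Nat.cast_one, show p - 1 - 1 = p - 2 by omega] at a3
    rw [a3]
    simp
  have h1' : ((p : ℝ) - 1) * P.A y ^ 2 * P.w y * dHalf P.R y
      = P.R y * (2 * P.A y * dHalf P.A y * P.w y
        + P.A y ^ 2 * -(1 * P.q y ^ 2 + y * (2 * P.q y * dHalf P.q y))) := by
    rw [← h1]
    have h3 : P.R y * P.R y ^ (p - 2) = P.A y ^ 2 * P.w y := by
      rw [← pow_succ', show p - 2 + 1 = p - 1 by omega, P.R_pow' hy]
    linear_combination (-((p : ℝ) - 1)) * dHalf P.R y * h3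
  have hode := P.ode y hy
  have hepos := (P.e_pos y hy).ne'
  have hwpos : P.w y ≠ 0 := (P.w_pos y hy).ne'
  -- Without `1 < β` the function `A` may vanish; then `h2` gives `A' = 0` too and every term is
  -- zero.
  by_cases hA0 : P.A y = 0
  · have h4 : dHalf P.A y * (1 - y * P.q y) = 0 := by
      rw [hA0] at h2; linarith
    rw [hA0, (mul_eq_zero.1 h4).resolve_right hepos]
    ring
  · have h5 : ((p : ℝ) - 1) * P.A y * P.w y * dHalf P.R y
        = P.R y * (2 * dHalf P.A y * P.w y
          + P.A y * -(1 * P.q y ^ 2 + y * (2 * P.q y * dHalf P.q y))) := by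
      refine mul_left_cancel₀ hA0 ?_
      linear_combination h1'
    refine mul_left_cancel₀ (mul_ne_zero (mul_ne_zero hp1 hepos) hwpos) ?_
    simp only [ell] at hode
    rw [mul_zero]
    have h6 : ((p : ℝ) - 1) * (2 * β / ((p : ℝ) - 1)) = 2 * β := by field_simp
    have h7 : ((p : ℝ) - 1) * (4 / ((p : ℝ) - 1)) = 4 := by field_simp
    generalize 2 * β / ((p : ℝ) - 1) = m at *
    generalize 4 / ((p : ℝ) - 1) = c at *
    simp only [w] at *
    linear_combination (-4 * y * (1 - P.q y) * (1 - y * P.q y)) * h5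
      + (-2 * y * (1 - P.q y) * (4 + ((p : ℝ) - 1)) * P.R y * (1 - y * P.q y ^ 2)) * h2
      + ((p : ℝ) - 1) * P.R y * P.A y * hode
      - 2 * P.R y * P.A y * (1 - y * P.q y) * (1 - y * P.q y ^ 2) * h6
      + (P.R y * P.A y * (y * (1 - P.q y) ^ 2 * (P.q y + 2 * y * dHalf P.q y)
        + β * (1 - y * P.q y ^ 2) ^ 2)) * h7

theorem continuity_zero (hp : 3 ≤ p) {φ₀ ρ₀ : STFun d ℝ}
    (hφ₀ : SlabEq T φ₀ (fld T (1 - β) fun y _ => P.Φ y))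
    (hρ₀ : SlabEq T ρ₀ (fld T (-(2 * β / ((p : ℝ) - 1))) fun y _ => P.R y)) :
    ∀ t ∈ Ico 0 T, ∀ x, 2 * mform T ρ₀ φ₀ t x + ρ₀ t x * box T φ₀ t x = 0 := by
  intro t ht x
  have hAq := P.smooth_A.mul P.smooth_q
  have hy : 0 ≤ ‖x‖ ^ 2 / (T - t) ^ 2 := by positivity
  have hs : 0 < T - t := by linarith [ht.2]
  have hbox := div_fld (TauPoly.coeff P.smooth_A) (TauPoly.coeff hAq) (1 - β) (T := T)
    (V := fun α => pd T α φ₀)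
    (fun t ht x => by
      rw [P.pd_zero_phase hφ₀ t ht x, show 1 - β - 1 = -β by ring])
    (fun j t ht x => by
      rw [P.pd_succ_phase hφ₀ j t ht x, show 1 - β - 2 = -β - 1 by ring]) t ht x
  have hdAq : dHalf (fun y => P.A y * P.q y) (‖x‖ ^ 2 / (T - t) ^ 2) = dHalf P.A (‖x‖ ^ 2 / (T - t) ^ 2)
      * P.q (‖x‖ ^ 2 / (T - t) ^ 2) + P.A (‖x‖ ^ 2 / (T - t) ^ 2)
      * dHalf P.q (‖x‖ ^ 2 / (T - t) ^ 2) :=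
    dHalf_eq hy ((hasDerivWithinAt_dHalf P.smooth_A hy).mul (hasDerivWithinAt_dHalf P.smooth_q hy))
  rw [box, hbox, hρ₀ t ht x, hρ₀.mform hφ₀ t ht x, mform_fld (TauPoly.coeff P.smooth_R)
    (TauPoly.coeff P.smooth_Φ) _ _ t ht x, fld_mul_fld _ _ _ _ ht,
    show -(2 * β / ((p : ℝ) - 1)) + (1 - β) - 2 = -(2 * β / ((p : ℝ) - 1)) + (1 - β - 2) by ring]
  have hkey := P.continuity_algebra hp hy
  have hAm := P.A_mul hy
  simp only [fld, dY_coeff, dT_coeff, P.dHalf_Φ hy, hdAq]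
  linear_combination (T - t) ^ (-(2 * β / ((p : ℝ) - 1)) + (1 - β - 2)) * (hkey +
    2 * (2 * (‖x‖ ^ 2 / (T - t) ^ 2) * dHalf P.R (‖x‖ ^ 2 / (T - t) ^ 2)
      + 2 * β / ((p : ℝ) - 1) * P.R (‖x‖ ^ 2 / (T - t) ^ 2)) * hAm)

end RadialProfile

end WaveBlowup

end

noncomputable section

namespace WaveBlowup

open Set MeasureTheory Filter Topology

/-! ### Separating the top order terms -/

/-- A tuple of sum `n` with an entry at least `n` has that entry equal to `n` and zeros elsewhere;
for `n ≥ 1` its position is unique. -/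
lemma sum_antidiagonalTuple_eq {k n : ℕ} (hn : 1 ≤ n) (f : (Fin k → ℕ) → ℝ) :
    ∑ ν ∈ Finset.Nat.antidiagonalTuple k n, f ν
      = ∑ ν ∈ (Finset.Nat.antidiagonalTuple k n).filter (fun ν => ∀ i, ν i < n), f ν
        + ∑ i, f (Pi.single i n) := by
  classical
  rw [← Finset.sum_filter_add_sum_filter_not _ (fun ν => ∀ i, ν i < n)]
  congr 1
  symm
  refine Finset.sum_bij (fun i _ => Pi.single i n) (fun i _ => ?_) (fun i _ j _ h => ?_)
    (fun ν hν => ?_) (fun _ _ => rfl)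
  · rw [Finset.mem_filter, Finset.Nat.mem_antidiagonalTuple]
    refine ⟨by simp, fun h => ?_⟩
    have := h i
    simp at this
  · by_contra hij
    have h1 := congrFun h i
    rw [Pi.single_eq_same, Pi.single_eq_of_ne hij] at h1
    omega
  · rw [Finset.mem_filter, Finset.Nat.mem_antidiagonalTuple] at hν
    obtain ⟨hsum, hlt⟩ := hν
    push Not at hlt
    obtain ⟨i, hi⟩ := hlt
    refine ⟨i, Finset.mem_univ i, ?_⟩
    have h1 := Finset.add_sum_erase Finset.univ ν (Finset.mem_univ i)
    rw [hsum] at h1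
    have h2 : ∑ j ∈ Finset.univ.erase i, ν j = 0 := by omega
    rw [Finset.sum_eq_zero_iff] at h2
    funext j
    rcases eq_or_ne j i with rfl | hj
    · rw [Pi.single_eq_same]
      omega
    · rw [Pi.single_eq_of_ne hj, h2 j (Finset.mem_erase.2 ⟨hj, Finset.mem_univ j⟩)]

lemma sum_antidiagonal_eq {n : ℕ} (hn : 1 ≤ n) (f : ℕ × ℕ → ℝ) :
    ∑ ν ∈ Finset.HasAntidiagonal.antidiagonal n, f ν
      = ∑ ν ∈ (Finset.HasAntidiagonal.antidiagonal n).filter (fun ν => ν.1 < n ∧ ν.2 < n), f ν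
        + (f (n, 0) + f (0, n)) := by
  classical
  rw [← Finset.sum_filter_add_sum_filter_not _ (fun ν : ℕ × ℕ => ν.1 < n ∧ ν.2 < n)]
  congr 1
  have h : (Finset.HasAntidiagonal.antidiagonal n).filter (fun ν => ¬(ν.1 < n ∧ ν.2 < n))
      = {(n, 0), (0, n)} := by
    ext ⟨a, b⟩
    simp only [Finset.mem_filter, Finset.HasAntidiagonal.mem_antidiagonal, Finset.mem_insert,
      Finset.mem_singleton, Prod.mk.injEq]
    omega
  rw [h, Finset.sum_pair (by simp; omega)]

lemma prod_single {p n : ℕ} (ρ : ℕ → ℝ) (i : Fin p) :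
    ∏ j, ρ ((Pi.single i n : Fin p → ℕ) j) = ρ n * ρ 0 ^ (p - 1) := by
  classical
  rw [← Finset.mul_prod_erase Finset.univ _ (Finset.mem_univ i), Pi.single_eq_same]
  congr 1
  rw [Finset.prod_congr rfl fun j hj => by rw [Pi.single_eq_of_ne (Finset.ne_of_mem_erase hj)],
    Finset.prod_const, Finset.card_erase_of_mem (Finset.mem_univ i), Finset.card_univ,
    Fintype.card_fin]

section Order

variable {d p n : ℕ} {T : ℝ} {ρ φ ρ' φ' : ℕ → STFun d ℝ}

lemma mform_comm (f g : STFun d ℝ) : mform T f g = mform T g f := by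
  funext t x
  exact Finset.sum_congr rfl fun α _ => by ring

/-- The sources depend only on earlier terms, as the recursive construction requires. -/
lemma sourceF_congr (hρ : ∀ k < n, ρ k = ρ' k) (hφ : ∀ k < n, φ k = φ' k) (hn : 1 ≤ n) :
    sourceF p T ρ φ n = sourceF p T ρ' φ' n := by
  funext t x
  have h1 : boxPrev T ρ n t x = boxPrev T ρ' n t x := by
    simp only [boxPrev]
    rw [hρ (n - 1) (by omega)]
  unfold sourceF
  rw [h1]
  congr 1
  · congr 1
    refine Finset.sum_congr rfl fun ν hν => Finset.prod_congr rfl fun i _ => ?_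
    rw [hρ _ ((Finset.mem_filter.1 hν).2 i)]
  · refine Finset.sum_congr rfl fun ν hν => ?_
    have := (Finset.mem_filter.1 hν).2
    rw [hρ _ (this 0), hφ _ (this 1), hφ _ (this 2)]

lemma sourceG_congr (hρ : ∀ k < n, ρ k = ρ' k) (hφ : ∀ k < n, φ k = φ' k) :
    sourceG T ρ φ n = sourceG T ρ' φ' n := by
  funext t x
  unfold sourceG
  congr 1
  · congr 1
    refine Finset.sum_congr rfl fun ν hν => ?_
    have := (Finset.mem_filter.1 hν).2
    rw [hρ _ this.1, hφ _ this.2]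
  · refine Finset.sum_congr rfl fun ν hν => ?_
    have := (Finset.mem_filter.1 hν).2
    rw [hρ _ this.1, hφ _ this.2]

lemma InX.congr_exp {lam lam' : ℝ} {f : STFun d ℝ} (hf : InX T lam f) (h : lam = lam') :
    InX T lam' f := h ▸ hf

lemma muSeq_zero (p : ℕ) (β : ℝ) : muSeq p β 0 = -(2 * β / ((p : ℝ) - 1)) := by
  simp [muSeq]

/-- Exponent count: `λ_k` and `μ_k` are affine in `k` with the same slope `2 (β - 1)`, so products
of total index `n` share one exponent, and `□ρ_{n-1}` agrees because one step of the index makes up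
for the loss of `2` in the exponent up to `-2β`, the exponent of `ρ₀^(p-1)`. -/
theorem InX.sourceF {β : ℝ} (hp : 3 ≤ p) (hn : 1 ≤ n)
    (hφ : ∀ k < n, InX T (lamSeq β k) (φ k)) (hρ : ∀ k < n, InX T (muSeq p β k) (ρ k)) :
    InX T (lamSeq β n + muSeq p β 0 - β - 1) (sourceF p T ρ φ n) := by
  have hpR : (3 : ℝ) ≤ p := by exact_mod_cast hp
  have hp1 : (p : ℝ) - 1 ≠ 0 := by linarith
  refine InX.sub (InX.sub ?_ (InX.sum _ fun ν hν => ?_)) (InX.sum _ fun ν hν => ?_)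
  · have h := (hρ (n - 1) (by omega)).box.congr_exp
      (show _ = lamSeq β n + muSeq p β 0 - β - 1 by
        rw [muSeq_zero]
        unfold muSeq lamSeq
        push_cast [Nat.cast_sub hn]
        ring)
    unfold boxPrev
    simpa only [if_neg (by omega : ¬ n = 0)] using h
  · obtain ⟨h1, h2⟩ := Finset.mem_filter.1 hν
    rw [Finset.Nat.mem_antidiagonalTuple] at h1
    refine (InX.prod Finset.univ fun i _ => hρ (ν i) (h2 i)).congr_exp ?_
    have h3 : (∑ i, (ν i : ℝ)) = n := by exact_mod_cast h1
    simp only [muSeq_zero]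
    simp only [muSeq, lamSeq, Finset.sum_sub_distrib, ← Finset.sum_mul, ← Finset.mul_sum, h3,
      Finset.sum_const, Finset.card_univ, Fintype.card_fin, nsmul_eq_mul]
    field_simp
    ring
  · obtain ⟨h1, h2⟩ := Finset.mem_filter.1 hν
    rw [Finset.Nat.mem_antidiagonalTuple, Fin.sum_univ_three] at h1
    have h3 : (ν 0 : ℝ) + ν 1 + ν 2 = n := by exact_mod_cast h1
    refine ((hρ _ (h2 0)).mul ((hφ _ (h2 1)).mform (hφ _ (h2 2)))).congr_exp ?_
    rw [muSeq_zero, lamSeq, lamSeq, lamSeq, muSeq, ← h3]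
    ring

theorem InX.sourceG {β : ℝ} (hφ : ∀ k < n, InX T (lamSeq β k) (φ k))
    (hρ : ∀ k < n, InX T (muSeq p β k) (ρ k)) :
    InX T (lamSeq β n + muSeq p β 0 - 2) (sourceG T ρ φ n) := by
  have hexp : ∀ ν ∈ (Finset.HasAntidiagonal.antidiagonal n).filter
      (fun ν => ν.1 < n ∧ ν.2 < n), muSeq p β ν.1 + lamSeq β ν.2 - 2
        = lamSeq β n + muSeq p β 0 - 2 := fun ν hν => by
    have h1 := Finset.HasAntidiagonal.mem_antidiagonal.1 (Finset.mem_filter.1 hν).1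
    have h3 : (ν.1 : ℝ) + ν.2 = n := by exact_mod_cast h1
    rw [muSeq_zero, lamSeq, lamSeq, muSeq, ← h3]
    ring
  refine InX.sub (InX.const_mul (-2) (InX.sum _ fun ν hν => ?_)) (InX.sum _ fun ν hν => ?_)
  · have h2 := (Finset.mem_filter.1 hν).2
    exact ((hρ _ h2.1).mform (hφ _ h2.2)).congr_exp (hexp ν hν)
  · have h2 := (Finset.mem_filter.1 hν).2
    exact ((hρ _ h2.1).mul (hφ _ h2.2).box).congr_exp ((by ring : _ = _).trans (hexp ν hν))

end Order

/-! ### The product rule -/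

/-- Differentiability in each variable on the slab. -/
def SlabDiff {d : ℕ} (T : ℝ) (f : STFun d ℝ) : Prop := ∀ t ∈ Ico 0 T, ∀ x,
  DifferentiableWithinAt ℝ (fun s => f s x) (Ico 0 T) t ∧ DifferentiableAt ℝ (f t) x

section Leibniz

variable {d : ℕ} {T lam : ℝ} {f g : STFun d ℝ}

lemma SlabDiff.mul (hf : SlabDiff T f) (hg : SlabDiff T g) : SlabDiff T fun t x => f t x * g t x :=
  fun t ht x => ⟨(hf t ht x).1.mul (hg t ht x).1, (hf t ht x).2.mul (hg t ht x).2⟩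

lemma InX.slabDiff (hf : InX T lam f) : SlabDiff T f := by
  obtain ⟨G, hG, h⟩ := hf
  intro t ht x
  refine ⟨(hasDerivWithinAt_fld hG lam ht x).differentiableWithinAt.congr
    (fun s hs => h s hs x) (h t ht x), ?_⟩
  rw [show f t = fld T lam G t from funext (h t ht)]
  exact (hasFDerivAt_fld hG lam ht x).differentiableAt

lemma InX.pd_slabDiff (hf : InX T lam f) (α : Fin (d + 1)) : SlabDiff T (pd T α f) := by
  obtain ⟨G, hG, h⟩ := hf
  refine Fin.cases ?_ (fun j => ?_) α
  · exact InX.slabDiff (lam := lam - 1) ⟨_, (((TauPoly.id.const_mul 2).mul hG.dY).add hG.dT).sub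
      (hG.const_mul lam), fun t ht x => (h.pd 0 t ht x).trans (pd_zero_fld hG lam ht x)⟩
  · have h1 : SlabEq T (pd T j.succ f) fun t x => x j * fld T (lam - 2) (fun y τ => 2 * dY G y τ) t x :=
      fun t ht x => (h.pd j.succ t ht x).trans (pd_succ_fld hG lam ht x j)
    have hG' := hG.dY.const_mul 2
    intro t ht x
    refine ⟨((hasDerivWithinAt_fld hG' (lam - 2) ht x).differentiableWithinAt.const_mul
      (x j)).congr (fun s hs => h1 s hs x) (h1 t ht x), ?_⟩
    rw [show pd T j.succ f t = _ from funext (h1 t ht)]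
    exact (EuclideanSpace.proj j : EuclideanSpace ℝ (Fin d) →L[ℝ] ℝ).differentiableAt.mul
      (hasFDerivAt_fld hG' (lam - 2) ht x).differentiableAt

lemma pd_mul (hf : SlabDiff T f) (hg : SlabDiff T g) (α : Fin (d + 1)) {t : ℝ} (ht : t ∈ Ico 0 T)
    (x : EuclideanSpace ℝ (Fin d)) : pd T α (fun t x => f t x * g t x) t x
      = pd T α f t x * g t x + f t x * pd T α g t x := by
  refine Fin.cases ?_ (fun j => ?_) α
  · exact (((hf t ht x).1.hasDerivWithinAt.mul (hg t ht x).1.hasDerivWithinAt).derivWithin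
      (uniqueDiffOn_Ico 0 T t ht))
  · have h1 : HasFDerivAt (fun x => f t x * g t x) _ x :=
      (hf t ht x).2.hasFDerivAt.mul (hg t ht x).2.hasFDerivAt
    simp only [pd_succ]
    rw [h1.fderiv]
    simp
    ring

lemma div_mul {V : Fin (d + 1) → STFun d ℝ} (hf : SlabDiff T f) (hV : ∀ α, SlabDiff T (V α))
    {t : ℝ} (ht : t ∈ Ico 0 T) (x : EuclideanSpace ℝ (Fin d)) :
    div T (fun α t x => f t x * V α t x) t x
      = ∑ α, mink α * pd T α f t x * V α t x + f t x * div T V t x := by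
  simp only [div, Finset.mul_sum, ← Finset.sum_add_distrib]
  refine Finset.sum_congr rfl fun α _ => ?_
  rw [pd_mul hf (hV α) α ht x]
  ring

end Leibniz

end WaveBlowup

end

noncomputable section

namespace WaveBlowup

open Set MeasureTheory Filter Topology

/-! ### The recurrence relations -/

section Recurrence

variable {d p n : ℕ} {T : ℝ} {ρ φ : ℕ → STFun d ℝ}

/-- The recurrence relation of order zero. -/
lemma recurrenceRelation_zero
    (h1 : ∀ t ∈ Ico 0 T, ∀ x, ρ 0 t x ^ p + ρ 0 t x * mform T (φ 0) (φ 0) t x = 0)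
    (h2 : ∀ t ∈ Ico 0 T, ∀ x, 2 * mform T (ρ 0) (φ 0) t x + ρ 0 t x * box T (φ 0) t x = 0) :
    RecurrenceRelation p T ρ φ 0 := by
  intro t ht x
  constructor
  · rw [Finset.Nat.antidiagonalTuple_zero_right, Finset.Nat.antidiagonalTuple_zero_right]
    simpa [boxPrev] using (h1 t ht x).symm
  · simpa using (h2 t ht x).symm

/-- The linearized equations imply the recurrence relations. -/
lemma LinearizedEqs.recurrenceRelation (hn : 1 ≤ n)
    (hlin : LinearizedEqs p T ρ φ n)
    (h0 : ∀ t ∈ Ico 0 T, ∀ x, ρ 0 t x ≠ 0)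
    (h1 : ∀ t ∈ Ico 0 T, ∀ x, mform T (φ 0) (φ 0) t x = -ρ 0 t x ^ (p - 1))
    (h2 : ∀ t ∈ Ico 0 T, ∀ x, 2 * mform T (ρ 0) (φ 0) t x + ρ 0 t x * box T (φ 0) t x = 0)
    (dρ₀ : SlabDiff T (ρ 0)) (dρ : SlabDiff T (ρ n)) (dφ₀ : ∀ α, SlabDiff T (pd T α (φ 0)))
    (dφ : ∀ α, SlabDiff T (pd T α (φ n))) : RecurrenceRelation p T ρ φ n := by
  intro t ht x
  obtain ⟨e1, e2⟩ := hlin t ht x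
  constructor
  -- The top order terms are `p ρ_n ρ₀^(p-1)`, `ρ_n ∂^α φ₀ ∂_α φ₀ = -ρ_n ρ₀^(p-1)` and twice `ρ₀ ∂^α
  -- φ₀ ∂_α φ_n`, which accounts for the coefficient `p - 1`.
  · rw [sum_antidiagonalTuple_eq hn, sum_antidiagonalTuple_eq hn, Fin.sum_univ_three]
    have hprod : ∑ i : Fin p, ∏ j, ρ ((Pi.single i n : Fin p → ℕ) j) t x
        = p * (ρ n t x * ρ 0 t x ^ (p - 1)) := by
      rw [Finset.sum_congr rfl fun i _ => prod_single (fun k => ρ k t x) i]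
      simp
    rw [hprod]
    have hs : ∀ i j : Fin 3, (Pi.single i n : Fin 3 → ℕ) j = if j = i then n else 0 := fun i j =>
      Pi.single_apply i n j
    simp only [hs]
    have hc := congrFun (congrFun (mform_comm (T := T) (φ n) (φ 0)) t) x
    simp only [sourceF] at e1
    simp
    rw [hc, h1 t ht x]
    linear_combination -e1
  · rw [sum_antidiagonal_eq hn, sum_antidiagonal_eq hn]
    have d1 : div T (fun α t x => ρ 0 t x ^ 2 * pd T α (φ n) t x) t x
        = ρ 0 t x * (2 * mform T (ρ 0) (φ n) t x + ρ 0 t x * box T (φ n) t x) := by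
      simp only [sq]
      rw [div_mul (dρ₀.mul dρ₀) dφ ht x]
      simp only [pd_mul dρ₀ dρ₀ _ ht x, mform, box, mul_add, Finset.mul_sum]
      congr 1
      · exact Finset.sum_congr rfl fun α _ => by ring
      · ring
    have d2 : div T (fun α t x => ρ 0 t x * pd T α (φ 0) t x * ρ n t x) t x
        = ρ n t x * mform T (ρ 0) (φ 0) t x + ρ 0 t x * mform T (ρ n) (φ 0) t x
          + ρ 0 t x * ρ n t x * box T (φ 0) t x := by
      have : (fun α t x => ρ 0 t x * pd T α (φ 0) t x * ρ n t x)
          = fun α t x => (ρ 0 t x * ρ n t x) * pd T α (φ 0) t x := by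
        funext α t x; ring
      rw [this, div_mul (dρ₀.mul dρ) dφ₀ ht x]
      simp only [pd_mul dρ₀ dρ _ ht x, mform, box, Finset.mul_sum, ← Finset.sum_add_distrib]
      congr 1
      exact Finset.sum_congr rfl fun α _ => by ring
    rw [d1, d2] at e2
    -- The divergence form is `ρ₀` times the relation plus `ρ_n` times the continuity equation of
    -- order zero.
    refine mul_left_cancel₀ (h0 t ht x) ?_
    simp only [sourceG] at e2
    linear_combination -e2 + ρ n t x * h2 t ht x

end Recurrence

/-- The hierarchy of corrections to the leading-order profile. -/
theorem exists_hierarchy {d p : ℕ} {β T : ℝ} (P : RadialProfile d p β) (hp : 3 ≤ p) (hβ : 1 < β)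
    {φ₀ ρ₀ : STFun d ℝ} (hφ₀ : SlabEq T φ₀ (fld T (1 - β) fun y _ => P.Φ y))
    (hρ₀ : SlabEq T ρ₀ (fld T (-(2 * β / ((p : ℝ) - 1))) fun y _ => P.R y)) :
    ∃ φ ρ : ℕ → STFun d ℝ, φ 0 = φ₀ ∧ ρ 0 = ρ₀ ∧
      (∀ n, InX T (lamSeq β n) (φ n) ∧ InX T (muSeq p β n) (ρ n)) ∧
      (∀ n, 1 ≤ n → LinearizedEqs p T ρ φ n) ∧ ∀ n, RecurrenceRelation p T ρ φ n := by
  have hl0 : lamSeq β 0 = 1 - β := by simp [lamSeq]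
  have hX₀ : InX T (lamSeq β 0) φ₀ ∧ InX T (muSeq p β 0) ρ₀ := by
    rw [hl0, muSeq_zero]
    exact ⟨⟨_, TauPoly.coeff P.smooth_Φ, hφ₀⟩, ⟨_, TauPoly.coeff P.smooth_R, hρ₀⟩⟩
  -- The pairs `(φ_n, ρ_n)` are chosen recursively. The leading terms are written as the fixed `φ₀`,
  -- `ρ₀`, so that at each step the sequence enters only through the sources.
  obtain ⟨s, hs⟩ := exists_seq_of_forall_exists (α := STFun d ℝ × STFun d ℝ)
    (fun n s a => (n = 0 → a = (φ₀, ρ₀)) ∧ InX T (lamSeq β n) a.1 ∧ InX T (muSeq p β n) a.2 ∧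
      (1 ≤ n → ∀ t ∈ Ico 0 T, ∀ x,
        ((p : ℝ) - 1) * ρ₀ t x ^ (p - 1) * a.2 t x + 2 * ρ₀ t x * mform T φ₀ a.1 t x
          = sourceF p T (fun k => (s k).2) (fun k => (s k).1) n t x ∧
        div T (fun α t x => ρ₀ t x ^ 2 * pd T α a.1 t x) t x
          + 2 * div T (fun α t x => ρ₀ t x * pd T α φ₀ t x * a.2 t x) t x
          = ρ₀ t x * sourceG T (fun k => (s k).2) (fun k => (s k).1) n t x))
    (fun n s s' a hss ⟨h1, h2, h3, h4⟩ => ⟨h1, h2, h3, fun hn => by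
      rw [← sourceF_congr (ρ := fun k => (s k).2) (φ := fun k => (s k).1)
          (fun k hk => by rw [hss k hk]) (fun k hk => by rw [hss k hk]) hn,
        ← sourceG_congr (ρ := fun k => (s k).2) (φ := fun k => (s k).1)
          (fun k hk => by rw [hss k hk]) (fun k hk => by rw [hss k hk])]
      exact h4 hn⟩)
    (fun n s ih => by
      rcases Nat.eq_zero_or_pos n with rfl | hn
      · exact ⟨(φ₀, ρ₀), fun _ => rfl, hX₀.1, hX₀.2, fun h => absurd h (by norm_num)⟩
      · have hφ : ∀ k < n, InX T (lamSeq β k) (s k).1 := fun k hk => (ih k hk).2.1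
        have hρ : ∀ k < n, InX T (muSeq p β k) (s k).2 := fun k hk => (ih k hk).2.2.1
        obtain ⟨φ, ρ, h1, h2, h3⟩ := P.exists_linear_solution hp hβ (muSeq_zero p β) hφ₀
          (by rw [muSeq_zero]; exact hρ₀) (InX.sourceF hp hn hφ hρ) (InX.sourceG hφ hρ)
        refine ⟨(φ, ρ), fun h => absurd h (by omega), h1, h2.congr_exp ?_, fun _ => h3⟩
        rw [muSeq_zero, lamSeq, muSeq]
        ring)
  have hs0 : s 0 = (φ₀, ρ₀) := (hs 0).1 rfl
  have hφ0 : (s 0).1 = φ₀ := by rw [hs0]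
  have hρ0 : (s 0).2 = ρ₀ := by rw [hs0]
  have hlin : ∀ n, 1 ≤ n → LinearizedEqs p T (fun k => (s k).2) (fun k => (s k).1) n :=
    fun n hn t ht x => by
      have := (hs n).2.2.2 hn t ht x
      simp only [hφ0, hρ0]
      exact this
  have hmass : ∀ t ∈ Ico 0 T, ∀ x, mform T φ₀ φ₀ t x = -ρ₀ t x ^ (p - 1) := fun t ht x => by
    have h1 := P.modulus_pow hp hρ₀ t ht x
    beta_reduce at h1
    rw [h1, P.mform_phase_self hφ₀ t ht x]
    simp only [fld]
    ring
  have hcont := P.continuity_zero hp hφ₀ hρ₀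
  have hne : ∀ t ∈ Ico 0 T, ∀ x, ρ₀ t x ≠ 0 := fun t ht x => by
    rw [hρ₀ t ht x]
    exact mul_ne_zero (Real.rpow_pos_of_pos (by linarith [ht.2]) _).ne'
      (P.R_pos _ (by positivity)).ne'
  refine ⟨fun k => (s k).1, fun k => (s k).2, hφ0, hρ0, fun n => ⟨(hs n).2.1, (hs n).2.2.1⟩, hlin,
    fun n => ?_⟩
  rcases Nat.eq_zero_or_pos n with rfl | hn
  · refine recurrenceRelation_zero ?_ ?_
    · intro t ht x
      simp only [hφ0, hρ0]
      rw [hmass t ht x, mul_neg, ← pow_succ', Nat.sub_add_cancel (by omega), add_neg_cancel]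
    · simp only [hφ0, hρ0]
      exact hcont
  · refine (hlin n hn).recurrenceRelation hn ?_ ?_ ?_ ?_ (hs n).2.2.1.slabDiff ?_
      (hs n).2.1.pd_slabDiff
    · simp only [hρ0]; exact hne
    · simp only [hφ0, hρ0]; exact hmass
    · simp only [hφ0, hρ0]; exact hcont
    · simp only [hρ0]; exact hX₀.2.slabDiff
    · simp only [hφ0]; exact hX₀.1.pd_slabDiff

end WaveBlowup

end

/-! ### The proposition -/

theorem mainTheorem6 (d p : ℕ) (hd : 4 ≤ d) (hp : Odd p) (hp3 : 3 ≤ p)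
    (T β : ℝ) (hT : 0 < T) (hβ : 1 < β)
    (hk : β * (WaveBlowup.ell p + Real.sqrt (WaveBlowup.ell p)) < (d : ℝ) - 1)
    (v : ℝ → ℝ) (hv : WaveBlowup.IsProfile d p β v) :
    ∃ φ ρ : ℕ → WaveBlowup.STFun d ℝ,
      φ 0 = WaveBlowup.phiZero d T β v ∧
      ρ 0 = WaveBlowup.rhoZero d p T β v ∧
      (∀ n : ℕ,
        (fun t x => (φ n t x : ℂ)) ∈ WaveBlowup.X d T (WaveBlowup.lamSeq β n : ℂ) ∧
        (fun t x => (ρ n t x : ℂ)) ∈ WaveBlowup.X d T (WaveBlowup.muSeq p β n : ℂ)) ∧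
      (∀ n : ℕ, 1 ≤ n → WaveBlowup.LinearizedEqs p T ρ φ n) ∧
      (∀ n : ℕ, WaveBlowup.RecurrenceRelation p T ρ φ n) := by
  obtain ⟨P, hP⟩ := WaveBlowup.exists_radialProfile hβ hp3 hk hv
  have hZ : ∀ t ∈ Set.Ico 0 T, ∀ x : EuclideanSpace ℝ (Fin d), 0 ≤ ‖x‖ / (T - t) := fun t ht x =>
    div_nonneg (norm_nonneg x) (by linarith [ht.2])
  obtain ⟨φ, ρ, h1, h2, h3, h4, h5⟩ := WaveBlowup.exists_hierarchy (T := T) P hp3 hβ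
    (φ₀ := WaveBlowup.phiZero d T β v) (ρ₀ := WaveBlowup.rhoZero d p T β v)
    (fun t ht x => by
      rw [WaveBlowup.phiZero, (hP _ (hZ t ht x)).1, div_pow]
      rfl)
    (fun t ht x => by
      rw [WaveBlowup.rhoZero, (hP _ (hZ t ht x)).2, div_pow]
      rfl)
  exact ⟨φ, ρ, h1, h2, fun n => ⟨(h3 n).1.mem_X, (h3 n).2.mem_X⟩, h4, h5⟩
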